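/- **Setting.** Let $N\ge 2$ and let $\mathcal S=\{S_1,\dots,S_N\}$ be an iterated function system (IFS) of contracting similitudes of $\mathbb R^d$ with invariant set $K$, i.e. the unique non-empty compact set with $K=\bigcup_{i=1}^N S_i(K)$; put $s=\dim_H K$ and let $\mathcal H^s$ be $s$-dimensional Hausdorff measure. Assume the open set condition (OSC): there is a non-empty open set $U$ such that the sets $S_i(U)$ are pairwise disjoint subsets of $U$. A set $A\subset K$ is a *skeleton* if $A\subset\bigcup_i S_i(A)$ and the graph on $\{1,\dots,N\}$ joining $i\ne j$ when $S_i(A)\cap S_j(A)\ne\emptyset$ is connected. Let $A=\{a_1,\dots,a_m\}$ be a finite skeleton with distinct points listed in a fixed order, and put $a_{m+1}=a_1$. **Paths.** Let $v_j$ be a formal edge from $a_j$ to $a_{j+1}$, and $v_j^{-1}$ a formal edge from $a_{j+1}$ to $a_j$ (these $2m$ edges are regarded as distinct); let $V=\{v_1,\dots,v_m,v_1^{-1},\dots,v_m^{-1}\}$ and $(v_j^{-1})^{-1}=v_j$. For $v\in V$ and a word $I=i_1\cdots i_n$ over $\{1,\dots,N\}$, $S_I(v)$ is the formal edge, labelled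 by $I$ and $v$, whose end points are the images under $S_I=S_{i_1}\circ\cdots\circ S_{i_n}$ of those of $v$. For an orientation vector $\beta\in\{1,-1\}^N$, let $G(\mathcal S,A,\beta)$ be the directed multigraph with edges $S_i(v_j^{\beta_i})$, $1\le i\le N$, $1\le j\le m$. A *unicursal path* of it is a path using every edge exactly once. A *partition* $P=P_1+\cdots+P_m$ of such a path $P$ writes it as the concatenation of pairwise edge-disjoint paths; it is *consistent* if $P_j$ goes from $a_j$ to $a_{j+1}$ for every $j$. **Induced substitution and GIFS.** Write $P_j=S_{j,1}(v_{j,1})\cdots S_{j,\ell_j}(v_{j,\ell_j})$ with $S_{j,k}\in\mathcal S$, $v_{j,k}\in V$, and $P_j^{-1}=S_{j,\ell_j}(v_{j,\ell_j}^{-1})\cdots S_{j,1}(v_{j,1}^{-1})$. The fine substitution is $\tau(v_j)=P_j$, $\tau(v_j^{-1})=P_j^{-1}$, iterated by $\tau(S_I(u))=S_I(\tau(u))$ and concatenation. The coarse substitution $\tau^*$ on $\{v_1,\dots,v_m\}$ maps $v_j$ to the word $|v_{j,1}|\cdots|v_{j,\ell_j}|$, where $|v_i|=|v_i^{-1}|=v_i$.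 The partition is *primitive* if for some $n\ge 1$ every $v_i$ occurs in $(\tau^*)^n(v_j)$ for every $j$. It *contains a pure cell* if there are $n$, a word $I$ of length $n$ and $u\in V$ such that all of $S_I(v_1),\dots,S_I(v_m)$, or all of $S_I(v_1^{-1}),\dots,S_I(v_m^{-1})$, are edges of $\tau^n(u)$. The *induced GIFS* (graph-directed IFS) has state set $V$; if $S_i(v)$ is the $k$-th edge of $\tau(u)$, it has a bridge (edge of its base graph) from $u$ to $v$ with map $S_i$, and the bridges from $u$ are ordered by $k$. **Terminology for an ordered GIFS.** Let it have states $u$ and bridges $e$ from $o(e)$ to $t(e)$ with similitudes $g_e$. Its invariant sets are the non-empty compact sets $E_u$ with $E_u=\bigcup_{o(e)=u}g_e(E_{t(e)})$. It is *linear* if for every state $u$, every $k\ge1$, and any two paths $\gamma=e_1\cdots e_k$, $\omega=f_1\cdots f_k$ of length $k$ from $u$ that are adjacent in the dictionary order, the sets $g_{e_1}\circ\cdots\circ g_{e_k}(E_{t(e_k)})$ and $g_{f_1}\circ\cdots\circ g_{f_k}(E_{t(f_k)})$ intersect. It satisfies the *OSC* if there are non-empty open sets $U_u$ such that $g_e(U_{t(e)})\subset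 U_{o(e)}$ for all $e$, and the sets $g_e(U_{t(e)})$ for distinct $e$ with the same origin are disjoint. **Theorem 1.3.** Suppose there are a finite skeleton $A$ (as above), an orientation vector $\beta$ and a unicursal path $P$ of $G(\mathcal S,A,\beta)$ with a partition $P=P_1+\cdots+P_m$ that is consistent, primitive and contains a pure cell. Then: (i) the induced GIFS is a linear GIFS satisfying the OSC; (ii) the induced GIFS has a unique family of invariant sets $\{E_v\}_{v\in V}$, and $K=\bigcup_{j=1}^m E_{v_j}$ with $\mathcal H^s(E_{v_i}\cap E_{v_j})=0$ for $i\neq j$; (iii) $K$ admits an optimal parameterization: $s>0$, $0<c:=\mathcal H^s(K)<\infty$, and there is a map $\varphi$ from $[0,1]$ onto $K$ such that, with $\mathcal L$ denoting Lebesgue measure, (a) $\varphi$ restricts to a bijection $I'\to K'$ for some $I'\subset[0,1]$ and $K'\subset K$ with $\mathcal L([0,1]\setminus I')=0=\mathcal H^s(K\setminus K')$; (b) $\mathcal H^s(\varphi(F))=c\,\mathcal L(F)$ and $\mathcal L(\varphi^{-1}(B))=c^{-1}\mathcal H^s(B)$ for all Borel sets $F\subset[0,1]$, $B\subset K$; (c)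 $|\varphi(x)-\varphi(y)|\le C|x-y|^{1/s}$ for all $x,y\in[0,1]$ and some constant $C$. -/

import Mathlib

open scoped NNReal ENNReal MeasureTheory

/-! ### Iterated function systems -/

/-- A contracting similitude: `dist (f x) (f y) = c * dist x y` for some ratio `0 < c < 1`. -/
def IsContractingSimilitude {X : Type} [MetricSpace X] (f : X → X) : Prop :=
  ∃ c : ℝ, 0 < c ∧ c < 1 ∧ ∀ x y, dist (f x) (f y) = c * dist x y

/-- `K` is the invariant set of the IFS `S`: non-empty, compact, and the union of its images. -/
def IsInvariantSet {X : Type} [MetricSpace X] {N : ℕ} (S : Fin N → X → X) (K : Set X) : Prop :=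
  K.Nonempty ∧ IsCompact K ∧ K = ⋃ i, S i '' K

/-- The open set condition for an IFS. (For contractions, intersecting `U` with a large ball shows
that asking `U` to be bounded as well would give the same notion.) -/
def IFSOpenSetCondition {X : Type} [MetricSpace X] {N : ℕ} (S : Fin N → X → X) : Prop :=
  ∃ U : Set X, IsOpen U ∧ U.Nonempty ∧ (∀ i, S i '' U ⊆ U) ∧
    ∀ i j, i ≠ j → Disjoint (S i '' U) (S j '' U)

/-- The Hata graph `H(F)`: vertices are the (indices of the) maps of the IFS, and `i`, `j` are
joined if and only if `S i (F)` meets `S j (F)`. -/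
def hataGraph {X : Type} {N : ℕ} (S : Fin N → X → X) (F : Set X) : SimpleGraph (Fin N) where
  Adj i j := i ≠ j ∧ (S i '' F ∩ S j '' F).Nonempty
  symm := ⟨fun _ _ h => ⟨h.1.symm, by rw [Set.inter_comm]; exact h.2⟩⟩
  loopless := ⟨fun _ h => h.1 rfl⟩

/-- A skeleton of the IFS `S` with invariant set `K`. -/
def IsSkeleton {X : Type} {N : ℕ} (S : Fin N → X → X) (K A : Set X) : Prop :=
  A ⊆ K ∧ (hataGraph S A).Connected ∧ A ⊆ ⋃ i, S i '' A

/-! ### Paths in directed multigraphs -/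

/-- `IsWalk src tgt x p y`: the list of edges `p` is a path from the vertex `x` to the vertex `y`
in the directed multigraph whose edges run from `src e` to `tgt e`. -/
def IsWalk {ε V : Type} (src tgt : ε → V) : V → List ε → V → Prop
  | x, [], y => x = y
  | x, e :: p, y => src e = x ∧ IsWalk src tgt (tgt e) p y

/-! ### Ordered and linear graph-directed iterated function systems -/

/-- An ordered graph-directed iterated function system on the space `X` with state set `V`:
a finite set of edges (`Bridge`) between states, a contracting similitude on each edge, and a
partial order on the edges which is linear on the edges emanating from one state and in which
edges emanating from different states are not comparable. -/
structure OrderedGIFS (X : Type) [MetricSpace X] (V : Type) where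
  Bridge : Type
  finite_bridge : Finite Bridge
  init : Bridge → V
  term : Bridge → V
  map : Bridge → X → X
  similitude : ∀ e, IsContractingSimilitude (map e)
  order : PartialOrder Bridge
  total : ∀ e f, init e = init f → e ≤ f ∨ f ≤ e
  init_eq_of_le : ∀ e f, e ≤ f → init e = init f

namespace OrderedGIFS

variable {X : Type} [MetricSpace X] {V : Type} (G : OrderedGIFS X V)

/-- `Γ_i^k`, the set of paths of length `k` emanating from the state `i`. -/
def paths (i : V) (k : ℕ) : Set (List G.Bridge) :=
  {p | p.length = k ∧ ∃ j, IsWalk G.init G.term i p j}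

/-- The dictionary order on paths (used only for paths of the same length). -/
def dictLT (p q : List G.Bridge) : Prop :=
  List.Lex G.order.lt p q

/-- `p` and `q` are adjacent elements of `Γ_i^k` in the dictionary order, with `p ≺ q`. -/
def Adjacent (i : V) (k : ℕ) (p q : List G.Bridge) : Prop :=
  p ∈ G.paths i k ∧ q ∈ G.paths i k ∧ G.dictLT p q ∧
    ∀ r ∈ G.paths i k, ¬ (G.dictLT p r ∧ G.dictLT r q)

/-- The non-empty compact sets `E i` are the invariant sets of the GIFS:
`E i` is the union of the sets `g_e (E (t e))` over the edges `e` emanating from `i`. -/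
def IsInvariantFamily (E : V → Set X) : Prop :=
  (∀ i, (E i).Nonempty ∧ IsCompact (E i)) ∧
    ∀ i, E i = ⋃ e : {e : G.Bridge // G.init e = i}, G.map e '' E (G.term e)

/-- For a path `p = e₁ … eₙ` from `i` to `j`, the set `g_{e₁} ∘ ⋯ ∘ g_{eₙ} (E j)`. -/
def cylinder (E : V → Set X) : V → List G.Bridge → Set X
  | i, [] => E i
  | _, e :: p => G.map e '' cylinder E (G.term e) p

/-- An ordered GIFS is linear if the cylinders of adjacent paths of the same length, emanating from
the same state, always meet. -/
def IsLinear : Prop :=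
  ∀ E, G.IsInvariantFamily E → ∀ i, ∀ k ≥ 1, ∀ p q, G.Adjacent i k p q →
    (G.cylinder E i p ∩ G.cylinder E i q).Nonempty

/-- The open set condition for a GIFS. (Again boundedness of the open sets would change nothing.) -/
def OpenSetCondition : Prop :=
  ∃ U : V → Set X, (∀ i, IsOpen (U i) ∧ (U i).Nonempty) ∧
    (∀ e, G.map e '' U (G.term e) ⊆ U (G.init e)) ∧
    ∀ e f, e ≠ f → G.init e = G.init f →
      Disjoint (G.map e '' U (G.term e)) (G.map f '' U (G.term f))

end OrderedGIFS

/-! ### The loop through the skeleton, unicursal paths and their partitions -/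

/-- The set `V = {v_1, …, v_m} ∪ {v_1⁻¹, …, v_m⁻¹}` of abstract oriented edges; the pair `(j, 1)` is
`v_j`, the edge from `a_j` to `a_{j+1}`, and `(j, -1)` is `v_j⁻¹`, the edge from `a_{j+1}` to `a_j`.
Indices are cyclic. -/
abbrev OEdge (m : ℕ) : Type := Fin m × ℤˣ

/-- The reverse edge. -/
def OEdge.rev {m : ℕ} (v : OEdge m) : OEdge m := (v.1, -v.2)

def OEdge.src {X : Type} {m : ℕ} [NeZero m] (a : Fin m → X) (v : OEdge m) : X :=
  if v.2 = 1 then a v.1 else a (v.1 + 1)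

def OEdge.tgt {X : Type} {m : ℕ} [NeZero m] (a : Fin m → X) (v : OEdge m) : X :=
  if v.2 = 1 then a (v.1 + 1) else a v.1

/-- Edges of the induced graph `G = ⋃ S_i(V)`: the pair `(i, v)` is the affine copy `S_i(v)`, where
copies with different labels count as different edges. -/
abbrev CopyEdge (N m : ℕ) : Type := Fin N × OEdge m

/-- `S_i(v)` starts at the image under `S_i` of the starting point of `v`. -/
def CopyEdge.src {X : Type} {N m : ℕ} [NeZero m] (S : Fin N → X → X) (a : Fin m → X)
    (e : CopyEdge N m) : X :=
  S e.1 (OEdge.src a e.2)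

def CopyEdge.tgt {X : Type} {N m : ℕ} [NeZero m] (S : Fin N → X → X) (a : Fin m → X)
    (e : CopyEdge N m) : X :=
  S e.1 (OEdge.tgt a e.2)

/-- The edge set of `G(S, A, β) = ⋃ S_i(Λ₀^{β_i})`, where `Λ₀ = v_1 + ⋯ + v_m`. -/
def orientedGraph {N : ℕ} (m : ℕ) (β : Fin N → ℤˣ) : Set (CopyEdge N m) :=
  {e | e.2.2 = β e.1}

/-- `P` is a unicursal path of `G(S, A, β)`: it uses every edge exactly once, and no other edge. -/
def IsUnicursal {X : Type} {N m : ℕ} [NeZero m] (S : Fin N → X → X) (a : Fin m → X)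
    (β : Fin N → ℤˣ) (P : List (CopyEdge N m)) : Prop :=
  (∃ x y, IsWalk (CopyEdge.src S a) (CopyEdge.tgt S a) x P y) ∧
    P.Nodup ∧ ∀ e, e ∈ P ↔ e ∈ orientedGraph m β

/-- `P = Q_1 + ⋯ + Q_m` is the concatenation of pairwise disjoint pieces. -/
def IsPathPartition {N m : ℕ} (P : List (CopyEdge N m)) (Q : Fin m → List (CopyEdge N m)) : Prop :=
  P = (List.ofFn Q).flatten ∧ ∀ i j, i ≠ j → List.Disjoint (Q i) (Q j)

/-- The partition is consistent: `Q_j` is a path from `a_j` to `a_{j+1}`. -/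
def IsConsistent {X : Type} {N m : ℕ} [NeZero m] (S : Fin N → X → X) (a : Fin m → X)
    (Q : Fin m → List (CopyEdge N m)) : Prop :=
  ∀ j, IsWalk (CopyEdge.src S a) (CopyEdge.tgt S a) (a j) (Q j) (a (j + 1))

/-! ### Substitution rules -/

/-- The fine substitution rule `v_j ↦ Q_j`, `v_j⁻¹ ↦ Q_j⁻¹`, where the reverse path lists the
reversed edges in the opposite order. -/
def fineRule {N m : ℕ} (Q : Fin m → List (CopyEdge N m)) (v : OEdge m) : List (CopyEdge N m) :=
  if v.2 = 1 then Q v.1 else (Q v.1).reverse.map fun e => (e.1, e.2.rev)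

/-- The iterates `τⁿ(u)` of the fine substitution rule; the pair `(I, v)` is the edge
`S_I(v) = S_{i_1} ∘ ⋯ ∘ S_{i_n} (v)`, and `τ(S_I(v)) = S_I(τ(v))`. -/
def fineIter {N m : ℕ} (Q : Fin m → List (CopyEdge N m)) (u : OEdge m) :
    ℕ → List (List (Fin N) × OEdge m)
  | 0 => [([], u)]
  | n + 1 => (fineIter Q u n).flatMap fun w =>
      (fineRule Q w.2).map fun e => (w.1 ++ [e.1], e.2)

/-- The coarse substitution `v_j ↦ |v_{j,1}| … |v_{j,ℓ_j}|` over the alphabet `{v_1, …, v_m}`. -/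
def coarseRule {N m : ℕ} (Q : Fin m → List (CopyEdge N m)) (j : Fin m) : List (Fin m) :=
  (Q j).map fun e => e.2.1

/-- The partition is primitive: for some `n ≥ 1` every letter appears in the image of every letter
under the `n`-th iterate of the coarse substitution. -/
def IsPrimitivePartition {N m : ℕ} (Q : Fin m → List (CopyEdge N m)) : Prop :=
  ∃ n ≥ 1, ∀ u v : Fin m, u ∈ (fun w : List (Fin m) => w.flatMap (coarseRule Q))^[n] [v]

/-- The partition contains a pure cell: for some word `I`, all the edges of the positive
`S_I`-cell `{S_I(v_j)}` or of the negative one `{S_I(v_j⁻¹)}` lie on one path `τⁿ(u)`, `n = |I|`. -/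
def HasPureCell {N m : ℕ} (Q : Fin m → List (CopyEdge N m)) : Prop :=
  ∃ (I : List (Fin N)) (ε : ℤˣ) (u : OEdge m), ∀ j : Fin m, (I, (j, ε)) ∈ fineIter Q u I.length

/-- The ordered GIFS induced by a partition: the states are the elements of `V`, the `k`-th bridge
from the state `u` carries the map `S_i` and ends at `v`, where `S_i(v)` is the `k`-th edge of the
path `τ(u)`, and the bridges from `u` are ordered by `k`. -/
def inducedGIFS {X : Type} [MetricSpace X] {N m : ℕ} (S : Fin N → X → X)
    (hS : ∀ i, IsContractingSimilitude (S i)) (Q : Fin m → List (CopyEdge N m)) :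
    OrderedGIFS X (OEdge m) where
  Bridge := Σ u : OEdge m, Fin (fineRule Q u).length
  finite_bridge := inferInstance
  init e := e.1
  term e := ((fineRule Q e.1).get e.2).2
  map e := S ((fineRule Q e.1).get e.2).1
  similitude _ := hS _
  order := inferInstance -- the disjoint sum of the usual orders on the index sets
  total := by
    rintro ⟨u, k⟩ ⟨v, l⟩ h
    obtain rfl : u = v := h
    exact (le_total k l).imp (Sigma.LE.fiber _ _ _) (Sigma.LE.fiber _ _ _)
  init_eq_of_le := by
    rintro _ _ ⟨u, k, l, h⟩
    rfl

/-! ### Optimal parameterizations -/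

/-- `φ : [0, 1] → K` is an optimal parameterization of the `s`-set `K`: it is onto, almost
one-to-one, measure-preserving (up to the normalizing factor `H^s(K)`), and `1/s`-Hölder. -/
structure IsOptimalParameterization {X : Type} [MetricSpace X] [MeasurableSpace X] [BorelSpace X]
    (s : ℝ≥0) (K : Set X) (φ : ℝ → X) : Prop where
  dim_pos : 0 < s
  measure_pos : 0 < μH[(s : ℝ)] K
  measure_lt_top : μH[(s : ℝ)] K < ∞
  image_eq : φ '' Set.Icc 0 1 = K
  almost_injective : ∃ I' ⊆ Set.Icc (0 : ℝ) 1, ∃ K' ⊆ K,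
    MeasureTheory.volume (Set.Icc (0 : ℝ) 1 \ I') = 0 ∧ μH[(s : ℝ)] (K \ K') = 0 ∧ Set.BijOn φ I' K'
  measure_image : ∀ F ⊆ Set.Icc (0 : ℝ) 1, MeasurableSet F →
    μH[(s : ℝ)] (φ '' F) = μH[(s : ℝ)] K * MeasureTheory.volume F
  measure_preimage : ∀ B ⊆ K, MeasurableSet B →
    MeasureTheory.volume (Set.Icc 0 1 ∩ φ ⁻¹' B) = (μH[(s : ℝ)] K)⁻¹ * μH[(s : ℝ)] B
  holder : ∃ C : ℝ≥0, HolderOnWith C (1 / s) φ (Set.Icc 0 1)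

/-! One device recurs: if the points of one bounded family of sets are images, under uniform
contractions, of points of that family, and the same contractions preserve a family of non-empty
closed sets, then the two families are within `ρ ^ n * D` of each other for every `n`, whence an
inclusion. It yields uniqueness of invariant sets, their independence of orientation, the position
of the end points and the covering of `K`.

Measure theory. The open set condition gives Moran's equation `∑ r i ^ s = 1` and `0 < μH[s] K < ∞`
(`moran`). Every edge `S_i(v_l^{β_i})` lies on exactly one `Q j`, once. Subadditivity bounds the
measure of each `E (j, 1)` by the sum over the edges of `Q j`. Summed over `j`, both sides agree by
Moran's equation, so every one of these inequalities is an equality (`hausdorffMeasure_eq`) and the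
pieces of `τ(u)`, hence of `τⁿ(u)`, overlap in null sets. A pure cell places similar copies of all
the sets `E (j, 1)` on one path `τⁿ(u)`, so these sets overlap in null sets as well. Primitivity
makes all their measures positive.

Linearity holds because consecutive edges of a path share an end point and end points belong to the
invariant sets. For the open set condition, each `E (j, 1)` has a point outside the others. Small
neighbourhoods of such points, cut down to the open set `U` of the IFS, are spread along all
iterates of the substitution (`inducedGIFS_openSetCondition`).

Parameterization. Subdivide an interval of length `μH[s] K` along `P`, then along the fine
substitution, giving each piece its Hausdorff measure as length. Contracting space by `r i` scales
length by `r i ^ s`, which gives the Hölder exponent `1 / s`. The image of Lebesgue measure and the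
restricted Hausdorff measure solve the same self-similarity equations with the same total mass, so
they coincide (`imageMeasure_eq`). Points with several preimages come from countably many null
overlaps (`mem_multiplePoints`). -/

open MeasureTheory Set Filter Topology

/-! ### Comparison of invariant families -/

/-- If every point of `E u` is the image under a contraction of a point of some `E v`, and the same
contraction maps `F v` into `F u`, then `E u` is contained in the closed set `F u`. -/
theorem subset_of_contracting_families {X : Type*} [MetricSpace X] {V B : Type*} (g : B → X → X)
    {r : ℝ} (hr0 : 0 ≤ r) (hr1 : r < 1) (hg : ∀ b x y, dist (g b x) (g b y) ≤ r * dist x y)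
    (E F : V → Set X)
    (hEF : ∀ u, ∀ x ∈ E u, ∃ b v, ∃ y ∈ E v, x = g b y ∧ ∀ z ∈ F v, g b z ∈ F u)
    (hFc : ∀ u, IsClosed (F u)) (hFn : ∀ u, (F u).Nonempty)
    {D : ℝ} (hD : ∀ u, ∀ x ∈ E u, ∀ y ∈ F u, dist x y ≤ D) (u : V) : E u ⊆ F u := by
  have key : ∀ n : ℕ, ∀ u, ∀ x ∈ E u, ∃ y ∈ F u, dist x y ≤ r ^ n * D := by
    intro n
    induction n with
    | zero =>
      intro u x hx
      obtain ⟨y, hy⟩ := hFn u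
      exact ⟨y, hy, by simpa using hD u x hx y hy⟩
    | succ n ih =>
      intro u x hx
      obtain ⟨b, v, y, hy, rfl, hF⟩ := hEF u x hx
      obtain ⟨z, hz, hyz⟩ := ih v y hy
      refine ⟨g b z, hF z hz, (hg b y z).trans ?_⟩
      calc r * dist y z ≤ r * (r ^ n * D) := by gcongr
        _ = r ^ (n + 1) * D := by ring
  intro x hx
  rw [← (hFc u).closure_eq, Metric.mem_closure_iff]
  intro ε hε
  have ht : Tendsto (fun n : ℕ => r ^ n * D) atTop (𝓝 0) := by
    simpa using (tendsto_pow_atTop_nhds_zero_of_lt_one hr0 hr1).mul_const D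
  obtain ⟨n, hn⟩ := (ht.eventually (gt_mem_nhds hε)).exists
  obtain ⟨y, hy, hxy⟩ := key n u x hx
  exact ⟨y, hy, hxy.trans_lt hn⟩

/-- Two compact families over a finite index set are at bounded distance. -/
theorem exists_dist_bound {X : Type*} [MetricSpace X] {V : Type*} [Finite V]
    (E F : V → Set X) (hE : ∀ u, Bornology.IsBounded (E u)) (hF : ∀ u, Bornology.IsBounded (F u)) :
    ∃ D : ℝ, ∀ u, ∀ x ∈ E u, ∀ y ∈ F u, dist x y ≤ D := by
  have : Bornology.IsBounded (⋃ u, (E u ∪ F u)) :=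
    (Bornology.isBounded_iUnion).2 fun u => (hE u).union (hF u)
  obtain ⟨D, hD⟩ := Metric.isBounded_iff.1 this
  exact ⟨D, fun u x hx y hy =>
    hD (mem_iUnion.2 ⟨u, Or.inl hx⟩) (mem_iUnion.2 ⟨u, Or.inr hy⟩)⟩

/-! ### Similitudes -/

/-- A similitude is Lipschitz with constant `c` and antilipschitz with constant `c⁻¹`. The two
resulting bounds coincide, for arbitrary `A` and without surjectivity of `f`. -/
theorem hausdorffMeasure_image_similitude {X : Type*} [MetricSpace X] [MeasurableSpace X]
    [BorelSpace X] {f : X → X} {c s : ℝ} (hc : 0 < c) (hs : 0 ≤ s)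
    (hf : ∀ x y, dist (f x) (f y) = c * dist x y) (A : Set X) :
    μH[s] (f '' A) = ENNReal.ofReal (c ^ s) * μH[s] A := by
  have hL : LipschitzWith c.toNNReal f := LipschitzWith.of_dist_le_mul fun x y => by
    rw [hf, Real.coe_toNNReal c hc.le]
  have hAL : AntilipschitzWith (c⁻¹).toNNReal f := AntilipschitzWith.of_le_mul_dist fun x y => by
    rw [hf, Real.coe_toNNReal _ (inv_nonneg.2 hc.le), inv_mul_cancel_left₀ hc.ne']
  have hcs : ENNReal.ofReal (c ^ s) = (c.toNNReal : ℝ≥0∞) ^ s :=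
    (ENNReal.ofReal_rpow_of_pos hc).symm
  have hcs' : ((c⁻¹).toNNReal : ℝ≥0∞) ^ s * (c.toNNReal : ℝ≥0∞) ^ s = 1 := by
    rw [← ENNReal.mul_rpow_of_nonneg _ _ hs, ← ENNReal.coe_mul, ← Real.toNNReal_mul (by positivity),
      inv_mul_cancel₀ hc.ne']
    simp
  refine le_antisymm ?_ ?_
  · rw [hcs]; exact hL.hausdorffMeasure_image_le hs A
  · rw [hcs]
    calc (c.toNNReal : ℝ≥0∞) ^ s * μH[s] A
        ≤ (c.toNNReal : ℝ≥0∞) ^ s * (((c⁻¹).toNNReal : ℝ≥0∞) ^ s * μH[s] (f '' A)) := by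
          gcongr; exact hAL.le_hausdorffMeasure_image hs A
      _ = μH[s] (f '' A) := by rw [← mul_assoc, mul_comm (_ ^ s), hcs', one_mul]

theorem injective_of_dist_eq_mul {X : Type*} [MetricSpace X] {f : X → X} {c : ℝ} (hc : 0 < c)
    (hf : ∀ x y, dist (f x) (f y) = c * dist x y) : Function.Injective f := fun x y h => by
  have := hf x y
  rw [h, dist_self, eq_comm, mul_eq_zero] at this
  exact dist_eq_zero.1 (this.resolve_left hc.ne')

theorem continuous_of_dist_eq_mul {X : Type*} [MetricSpace X] {f : X → X} {c : ℝ} (hc : 0 < c)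
    (hf : ∀ x y, dist (f x) (f y) = c * dist x y) : Continuous f :=
  (LipschitzWith.of_dist_le_mul (K := c.toNNReal) fun x y => by
    rw [hf, Real.coe_toNNReal c hc.le]).continuous

/-- The composition `S_{i_1} ∘ ⋯ ∘ S_{i_n}` along a word. -/
def wordMap {X ι : Type*} (S : ι → X → X) : List ι → X → X
  | [], x => x
  | i :: I, x => S i (wordMap S I x)

/-- The contraction ratio of `wordMap S I`. -/
def wordRatio {ι : Type*} (r : ι → ℝ) (I : List ι) : ℝ := (I.map r).prod

/-! ### Compositions along words and their contraction ratios -/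

section Words

variable {X ι : Type*} (S : ι → X → X) (r : ι → ℝ)

@[simp] theorem wordMap_nil (x : X) : wordMap S [] x = x := rfl

@[simp] theorem wordMap_cons (i : ι) (I : List ι) (x : X) :
    wordMap S (i :: I) x = S i (wordMap S I x) := rfl

theorem wordMap_append (I J : List ι) (x : X) :
    wordMap S (I ++ J) x = wordMap S I (wordMap S J x) := by
  induction I with
  | nil => rfl
  | cons i I ih => simp [ih]

@[simp] theorem wordRatio_nil : wordRatio r [] = 1 := rfl

@[simp] theorem wordRatio_cons (i : ι) (I : List ι) :
    wordRatio r (i :: I) = r i * wordRatio r I := by simp [wordRatio]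

theorem wordRatio_append (I J : List ι) :
    wordRatio r (I ++ J) = wordRatio r I * wordRatio r J := by simp [wordRatio]

variable {r}

theorem wordRatio_pos (hr : ∀ i, 0 < r i) (I : List ι) : 0 < wordRatio r I := by
  induction I with
  | nil => simp
  | cons i I ih => rw [wordRatio_cons]; exact mul_pos (hr i) ih

theorem wordRatio_le_one (hr : ∀ i, 0 < r i) (hr1 : ∀ i, r i < 1) (I : List ι) :
    wordRatio r I ≤ 1 := by
  induction I with
  | nil => simp
  | cons i I ih =>
    rw [wordRatio_cons]
    exact mul_le_one₀ (hr1 i).le (wordRatio_pos hr I).le ih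

theorem wordRatio_le_pow {ρ : ℝ} (hr : ∀ i, 0 < r i) (hρ : ∀ i, r i ≤ ρ) (I : List ι) :
    wordRatio r I ≤ ρ ^ I.length := by
  induction I with
  | nil => simp
  | cons i I ih =>
    rw [wordRatio_cons, List.length_cons, pow_succ']
    exact mul_le_mul (hρ i) ih (wordRatio_pos hr I).le ((hr i).le.trans (hρ i))

variable {S}

theorem dist_wordMap [MetricSpace X] (h : ∀ i x y, dist (S i x) (S i y) = r i * dist x y)
    (I : List ι) (x y : X) :
    dist (wordMap S I x) (wordMap S I y) = wordRatio r I * dist x y := by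
  induction I with
  | nil => simp
  | cons i I ih => rw [wordMap_cons, wordMap_cons, h, ih, wordRatio_cons, mul_assoc]

end Words

/-- A uniform contraction ratio for finitely many contractions. -/
theorem exists_uniform_ratio {ι : Type*} [Finite ι] {r : ι → ℝ}
    (hr0 : ∀ i, 0 < r i) (hr1 : ∀ i, r i < 1) : ∃ ρ : ℝ, 0 < ρ ∧ ρ < 1 ∧ ∀ i, r i ≤ ρ := by
  cases isEmpty_or_nonempty ι
  · exact ⟨1 / 2, by norm_num, by norm_num, fun i => isEmptyElim i⟩
  · obtain ⟨i, hi⟩ := Finite.exists_max r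
    exact ⟨r i, hr0 i, hr1 i, hi⟩

theorem exists_pos_le {ι : Type*} [Finite ι] {f : ι → ℝ} (hf : ∀ i, 0 < f i) :
    ∃ δ : ℝ, 0 < δ ∧ ∀ i, δ ≤ f i := by
  cases isEmpty_or_nonempty ι
  · exact ⟨1, one_pos, fun i => isEmptyElim i⟩
  · obtain ⟨i, hi⟩ := Finite.exists_min f
    exact ⟨f i, hf i, hi⟩

/-! ### The coding map -/

/-- The coding map of finitely many contractions, characterized by its functional equation. -/
theorem exists_coding_map {X : Type*} [MetricSpace X] [CompleteSpace X] [Nonempty X] {N : ℕ}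
    {S : Fin N → X → X} {r : Fin N → ℝ} (hr0 : ∀ i, 0 < r i) (hr1 : ∀ i, r i < 1)
    (hS : ∀ i x y, dist (S i x) (S i y) = r i * dist x y) :
    ∃ π : (ℕ → Fin N) → X, Continuous π ∧ ∀ ω, π ω = S (ω 0) (π fun n => ω (n + 1)) := by
  obtain ⟨ρ, hρ0, hρ1, hρ⟩ := exists_uniform_ratio hr0 hr1
  have hSc : Continuous fun p : Fin N × X => S p.1 p.2 :=
    continuous_prod_of_discrete_left.2 fun i => continuous_of_dist_eq_mul (hr0 i) (hS i)
  -- The coding map is the fixed point of this operator, a contraction by `ρ` for the sup metric on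
  -- continuous maps of the compact code space.
  let T : C(ℕ → Fin N, X) → C(ℕ → Fin N, X) := fun f =>
    ⟨fun ω => S (ω 0) (f fun n => ω (n + 1)),
      hSc.comp (g := fun p : Fin N × X => S p.1 p.2)
        (f := fun ω : ℕ → Fin N => (ω 0, f fun n => ω (n + 1)))
        ((continuous_apply 0).prodMk (f.continuous.comp
          (continuous_pi fun n => continuous_apply (n + 1))))⟩
  have hT : ContractingWith ⟨ρ, hρ0.le⟩ T := by
    refine ⟨by exact_mod_cast hρ1, LipschitzWith.of_dist_le_mul fun f g => ?_⟩
    rw [ContinuousMap.dist_le (by positivity)]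
    intro ω
    change dist (S (ω 0) _) (S (ω 0) _) ≤ _
    rw [hS]
    exact mul_le_mul (hρ _) (ContinuousMap.dist_apply_le_dist _) dist_nonneg hρ0.le
  let x₀ : X := Classical.arbitrary X
  have : Nonempty C(ℕ → Fin N, X) := ⟨ContinuousMap.const _ x₀⟩
  obtain ⟨f, hf⟩ : ∃ f, T f = f := ⟨_, hT.fixedPoint_isFixedPt⟩
  refine ⟨f, f.continuous, fun ω => ?_⟩
  conv_lhs => rw [← hf]
  rfl

/-! ### Unions of full measure -/

/-- If the measure of a finite union is at least the sum of the measures, the overlaps are null. -/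
theorem measure_inter_eq_zero_of_sum_le {X ι : Type*} [MeasurableSpace X] [Fintype ι]
    {μ : Measure X} {A : ι → Set X} (hA : ∀ i, MeasurableSet (A i))
    (hfin : ∀ i, μ (A i) ≠ ∞) (hsum : ∑ i, μ (A i) ≤ μ (⋃ i, A i)) {i j : ι} (hij : i ≠ j) :
    μ (A i ∩ A j) = 0 := by
  classical
  set R : Finset ι := (Finset.univ.erase i).erase j with hR
  have hj : j ∈ Finset.univ.erase i := by simp [hij.symm]
  have e1 : ∑ k, μ (A k) = (μ (A i) + μ (A j)) + ∑ k ∈ R, μ (A k) := by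
    rw [← Finset.add_sum_erase _ _ (Finset.mem_univ i), ← Finset.add_sum_erase _ _ hj, add_assoc]
  have e2 : μ (⋃ k, A k) ≤ μ (A i ∪ A j) + ∑ k ∈ R, μ (A k) := by
    calc μ (⋃ k, A k) ≤ μ ((A i ∪ A j) ∪ ⋃ k ∈ R, A k) := by
          refine measure_mono (iUnion_subset fun k => ?_)
          by_cases hk : k = i
          · subst hk; exact fun x hx => Or.inl (Or.inl hx)
          by_cases hk' : k = j
          · subst hk'; exact fun x hx => Or.inl (Or.inr hx)
          · exact fun x hx => Or.inr (mem_biUnion (by simp [hR, hk, hk']) hx)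
      _ ≤ _ := (measure_union_le _ _).trans (by gcongr; exact measure_biUnion_finset_le _ _)
  have e3 := (e1 ▸ hsum).trans e2
  have hRfin : ∑ k ∈ R, μ (A k) ≠ ∞ := ENNReal.sum_ne_top.2 fun k _ => hfin k
  have e4 : μ (A i) + μ (A j) ≤ μ (A i ∪ A j) := (ENNReal.add_le_add_iff_right hRfin).1 e3
  rw [← measure_union_add_inter (A i) (hA j)] at e4
  have hu : μ (A i ∪ A j) ≠ ∞ :=
    ((measure_union_le _ _).trans_lt (ENNReal.add_lt_top.2
      ⟨(hfin i).lt_top, (hfin j).lt_top⟩)).ne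
  have : μ (A i ∪ A j) + μ (A i ∩ A j) ≤ μ (A i ∪ A j) + 0 := by simpa using e4
  exact le_zero_iff.1 ((ENNReal.add_le_add_iff_left hu).1 this)

/-! ### Dimension and Hausdorff measure of a self-similar set with the open set condition -/

/-- The similarity dimension: the positive solution of Moran's equation. -/
theorem exists_similarity_dimension {N : ℕ} (hN : 2 ≤ N) {r : Fin N → ℝ} (hr0 : ∀ i, 0 < r i)
    (hr1 : ∀ i, r i < 1) : ∃ D : ℝ≥0, 0 < D ∧ ∑ i, r i ^ (D : ℝ) = 1 := by
  have hc : Continuous fun t : ℝ => ∑ i, r i ^ t :=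
    continuous_finsetSum _ fun i _ => Real.continuous_const_rpow (hr0 i).ne'
  have ht : Tendsto (fun t : ℝ => ∑ i, r i ^ t) atTop (𝓝 0) := by
    have := tendsto_finsetSum (Finset.univ : Finset (Fin N)) fun i _ =>
      tendsto_rpow_atTop_of_base_lt_one (r i) (by linarith [hr0 i]) (hr1 i)
    simpa using this
  obtain ⟨T, hT1, hT0⟩ := ((ht.eventually (gt_mem_nhds one_pos)).and (eventually_ge_atTop 0)).exists
  have h0 : (1 : ℝ) < ∑ i, r i ^ (0 : ℝ) := by
    simp only [Real.rpow_zero, Finset.sum_const, Finset.card_univ, Fintype.card_fin, nsmul_eq_mul,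
      mul_one]
    exact_mod_cast hN
  obtain ⟨D, hD, hD1⟩ := intermediate_value_Icc' hT0 hc.continuousOn ⟨hT1.le, h0.le⟩
  refine ⟨⟨D, hD.1⟩, ?_, hD1⟩
  rcases hD.1.lt_or_eq with h | h
  · exact h
  · subst h
    exact absurd hD1 h0.ne'

theorem IsInvariantSet.subset_iUnion_wordMap {X : Type} [MetricSpace X] {N : ℕ}
    {S : Fin N → X → X} {K : Set X} (hK : IsInvariantSet S K) (n : ℕ) :
    K ⊆ ⋃ w : Fin n → Fin N, wordMap S (List.ofFn w) '' K := by
  induction n with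
  | zero =>
    intro x hx
    exact mem_iUnion.2 ⟨Fin.elim0, x, hx, by simp⟩
  | succ n ih =>
    intro x hx
    rw [hK.2.2] at hx
    obtain ⟨i, y, hy, rfl⟩ := mem_iUnion.1 hx
    obtain ⟨w, z, hz, rfl⟩ := mem_iUnion.1 (ih hy)
    exact mem_iUnion.2 ⟨Fin.cons i w, z, hz, by simp [List.ofFn_succ]⟩

theorem wordRatio_ofFn {ι : Type*} (r : ι → ℝ) {n : ℕ} (w : Fin n → ι) :
    wordRatio r (List.ofFn w) = ∏ k, r (w k) := by
  simp [wordRatio, List.map_ofFn, List.prod_ofFn]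

/-- Cover `K` by its pieces of level `n`. Moran's equation keeps the sum of the `D`-th powers of
their diameters below `M ^ D` at every level, while the diameters tend to zero. -/
theorem hausdorffMeasure_lt_top_of_sum_rpow {X : Type} [MetricSpace X] [MeasurableSpace X]
    [BorelSpace X] {N : ℕ} {S : Fin N → X → X} {r : Fin N → ℝ} (hr0 : ∀ i, 0 < r i)
    (hr1 : ∀ i, r i < 1) (hS : ∀ i x y, dist (S i x) (S i y) = r i * dist x y) {K : Set X}
    (hK : IsInvariantSet S K) {D : ℝ} (hD0 : 0 < D) (hD : ∑ i, r i ^ D = 1) :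
    μH[D] K < ∞ := by
  obtain ⟨ρ, hρ0, hρ1, hρ⟩ := exists_uniform_ratio hr0 hr1
  obtain ⟨M, hM⟩ := Metric.isBounded_iff.1 hK.2.1.isBounded
  have hM0 : 0 ≤ M := by
    obtain ⟨x, hx⟩ := hK.1
    simpa using hM hx hx
  have hdiam : ∀ I : List (Fin N),
      Metric.ediam (wordMap S I '' K) ≤ ENNReal.ofReal (wordRatio r I * M) := by
    intro I
    refine Metric.ediam_le ?_
    rintro _ ⟨x, hx, rfl⟩ _ ⟨y, hy, rfl⟩
    rw [edist_dist, dist_wordMap hS]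
    exact ENNReal.ofReal_le_ofReal
      (mul_le_mul_of_nonneg_left (hM hx hy) (wordRatio_pos hr0 I).le)
  have h := Measure.hausdorffMeasure_le_liminf_sum D K (l := atTop)
    (fun n : ℕ => ENNReal.ofReal (ρ ^ n * M)) (by
      rw [← ENNReal.ofReal_zero]
      refine ENNReal.tendsto_ofReal ?_
      simpa using (tendsto_pow_atTop_nhds_zero_of_lt_one hρ0.le hρ1).mul_const M)
    (fun n (w : Fin n → Fin N) => wordMap S (List.ofFn w) '' K)
    (Eventually.of_forall fun n w => (hdiam _).trans (ENNReal.ofReal_le_ofReal (by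
      gcongr
      simpa using wordRatio_le_pow hr0 hρ (List.ofFn w))))
    (Eventually.of_forall fun n => hK.subset_iUnion_wordMap n)
  refine h.trans_lt (lt_of_le_of_lt ?_ (ENNReal.ofReal_lt_top (r := M ^ D)))
  refine (liminf_le_liminf (v := fun _ => ENNReal.ofReal (M ^ D))
    (Eventually.of_forall fun n => ?_)).trans (liminf_const _).le
  calc ∑ w : Fin n → Fin N, Metric.ediam (wordMap S (List.ofFn w) '' K) ^ D
      ≤ ∑ w : Fin n → Fin N, ENNReal.ofReal ((∏ k, r (w k) ^ D) * M ^ D) := by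
        refine Finset.sum_le_sum fun w _ => ?_
        refine (ENNReal.rpow_le_rpow (hdiam _) hD0.le).trans ?_
        rw [ENNReal.ofReal_rpow_of_nonneg (mul_nonneg (wordRatio_pos hr0 _).le hM0) hD0.le,
          Real.mul_rpow (wordRatio_pos hr0 _).le hM0, wordRatio_ofFn,
          Real.finsetProd_rpow _ _ fun k _ => (hr0 _).le]
    _ = ENNReal.ofReal (M ^ D) := by
        rw [← ENNReal.ofReal_sum_of_nonneg fun w _ => by
            have := fun k => (Real.rpow_pos_of_pos (hr0 (w k)) D).le
            exact mul_nonneg (Finset.prod_nonneg fun k _ => this k) (Real.rpow_nonneg hM0 D),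
          ← Finset.sum_mul, ← Fintype.sum_pow (fun i => r i ^ D) n, hD, one_pow, one_mul]

/-! #### Cut sets -/

/-- The words at which the contraction ratio drops to `ρ` for the first time. -/
def cutWords {ι : Type*} (r : ι → ℝ) (ρ : ℝ) : Set (List ι) :=
  {I | wordRatio r I ≤ ρ ∧ ∀ J, J <+: I → J ≠ I → ρ < wordRatio r J}

/-- Cut words form an antichain for the prefix order. This is what makes the corresponding images of
an OSC set disjoint. -/
theorem cutWords_eq_of_prefix {ι : Type*} {r : ι → ℝ} {ρ : ℝ} {I J : List ι}
    (hI : I ∈ cutWords r ρ) (hJ : J ∈ cutWords r ρ) (h : I <+: J) : I = J := by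
  by_contra hne
  exact absurd hI.1 (not_le.2 (hJ.2 I h hne))

/-- The word without its last letter still has ratio above `ρ`, and one letter costs at most a
factor `δ`. The empty word is covered by `ρ ≤ 1`. -/
theorem mul_le_wordRatio_of_mem_cutWords {ι : Type*} {r : ι → ℝ} {ρ δ : ℝ} (hρ1 : ρ ≤ 1)
    (hρ0 : 0 < ρ) (hδ0 : 0 < δ) (hδ1 : δ ≤ 1) (hδ : ∀ i, δ ≤ r i) {I : List ι}
    (hI : I ∈ cutWords r ρ) : ρ * δ ≤ wordRatio r I := by
  rcases List.eq_nil_or_concat I with rfl | ⟨J, i, rfl⟩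
  · simpa using mul_le_one₀ hρ1 hδ0.le hδ1
  · have hJ := hI.2 J (by simp) (by simp)
    rw [List.concat_eq_append, wordRatio_append]
    simp only [wordRatio_cons, wordRatio_nil, mul_one]
    exact mul_le_mul hJ.le (hδ i) hδ0.le (hρ0.le.trans hJ.le)

/-- Ratios along a code tend to zero, so there is a first `n` at which they drop to `ρ`. Hence the
cylinders of the cut words cover the code space. -/
theorem exists_prefix_mem_cutWords {ι : Type*} [Finite ι] {r : ι → ℝ} (hr0 : ∀ i, 0 < r i)
    (hr1 : ∀ i, r i < 1) {ρ : ℝ} (hρ : 0 < ρ) (ω : ℕ → ι) :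
    ∃ n, (List.range n).map ω ∈ cutWords r ρ := by
  classical
  obtain ⟨c, hc0, hc1, hc⟩ := exists_uniform_ratio hr0 hr1
  have hex : ∃ n, wordRatio r ((List.range n).map ω) ≤ ρ := by
    obtain ⟨n, hn⟩ := exists_pow_lt_of_lt_one hρ hc1
    exact ⟨n, (wordRatio_le_pow hr0 hc _).trans (by simpa using hn.le)⟩
  refine ⟨Nat.find hex, Nat.find_spec hex, fun J hJ hne => ?_⟩
  have hlen : J.length < Nat.find hex := by
    have h1 := hJ.length_le
    have h2 : J.length ≠ ((List.range (Nat.find hex)).map ω).length :=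
      fun h => hne (hJ.eq_of_length h)
    simp only [List.length_map, List.length_range] at h1 h2
    omega
  have hJ' : J = (List.range J.length).map ω := by
    have := List.prefix_iff_eq_take.1 hJ
    rw [← List.map_take, List.take_range, min_eq_left hlen.le] at this
    exact this
  rw [hJ']
  exact not_le.1 (Nat.find_min hex hlen)

/-- Incomparable words have a first position where their letters differ. The common prefix is
cancelled by injectivity, and the two differing letters are separated by the open set condition. -/
theorem disjoint_wordMap_image {X ι : Type*} {S : ι → X → X} (hinj : ∀ i, Function.Injective (S i))
    {U : Set X} (hU : ∀ i, S i '' U ⊆ U)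
    (hdisj : ∀ i j, i ≠ j → Disjoint (S i '' U) (S j '' U)) (I J : List ι)
    (hIJ : ¬ I <+: J) (hJI : ¬ J <+: I) :
    Disjoint (wordMap S I '' U) (wordMap S J '' U) := by
  have hsub : ∀ I : List ι, wordMap S I '' U ⊆ U := by
    intro I
    induction I with
    | nil => rintro _ ⟨x, hx, rfl⟩; exact hx
    | cons i I ih => rintro _ ⟨x, hx, rfl⟩; exact hU i ⟨_, ih ⟨x, hx, rfl⟩, rfl⟩
  induction I generalizing J with
  | nil => exact absurd (List.nil_prefix) hIJ
  | cons i I ih =>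
    cases J with
    | nil => exact absurd (List.nil_prefix) hJI
    | cons j J =>
      rw [Set.disjoint_left]
      rintro _ ⟨x, hx, rfl⟩ ⟨y, hy, h⟩
      by_cases hij : i = j
      · subst hij
        have h' := hinj i h
        refine Set.disjoint_left.1 (ih J ?_ ?_) ⟨x, hx, rfl⟩ ⟨y, hy, h'⟩
        · exact fun hp => hIJ (by simpa using hp)
        · exact fun hp => hJI (by simpa using hp)
      · exact Set.disjoint_left.1 (hdisj i j hij) ⟨_, hsub I ⟨x, hx, rfl⟩, rfl⟩
          ⟨_, hsub J ⟨y, hy, rfl⟩, h⟩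

/-- Under the open set condition, boundedly many cut pieces of size `ρ` meet a set of
diameter at most `ρ`. -/
theorem exists_card_cutWords_le {d N : ℕ} {S : Fin N → EuclideanSpace ℝ (Fin d) →
      EuclideanSpace ℝ (Fin d)} {r : Fin N → ℝ} (hr0 : ∀ i, 0 < r i)
    (hS : ∀ i x y, dist (S i x) (S i y) = r i * dist x y) (hOSC : IFSOpenSetCondition S)
    {K : Set (EuclideanSpace ℝ (Fin d))} (hK : Bornology.IsBounded K) :
    ∃ q : ℝ, 0 < q ∧ ∀ ρ : ℝ, 0 < ρ → ρ ≤ 1 → ∀ B : Set (EuclideanSpace ℝ (Fin d)),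
      (∀ x ∈ B, ∀ y ∈ B, dist x y ≤ ρ) → ∀ F : Finset (List (Fin N)),
      (∀ I ∈ F, I ∈ cutWords r ρ ∧ (wordMap S I '' K ∩ B).Nonempty) → (F.card : ℝ) ≤ q := by
  obtain ⟨U, hUo, ⟨x₀, hx₀⟩, hUsub, hUdisj⟩ := hOSC
  obtain ⟨ε, hε, hball⟩ := Metric.isOpen_iff.1 hUo x₀ hx₀
  obtain ⟨δ', hδ'0, hδ'⟩ := exists_pos_le hr0
  set δ := min δ' 1 with hδdef
  have hδ0 : 0 < δ := lt_min hδ'0 one_pos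
  have hδ : ∀ i, δ ≤ r i := fun i => (min_le_left _ _).trans (hδ' i)
  obtain ⟨R, hR⟩ : ∃ R, 0 ≤ R ∧ ∀ x ∈ K, dist x₀ x ≤ R := by
    obtain ⟨R, hR⟩ := hK.subset_closedBall x₀
    exact ⟨max R 0, le_max_right _ _, fun x hx => by
      rw [dist_comm]; exact (hR hx).trans (le_max_left _ _)⟩
  -- Halving the radius puts a closed ball inside `U`; its images are compact, hence measurable.
  set a := ε / 2 with ha
  have ha0 : 0 < a := by positivity
  have haU : Metric.closedBall x₀ a ⊆ U :=
    (Metric.closedBall_subset_ball (by linarith)).trans hball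
  -- In units of `ρ`: `a + R` from a point of the small ball to a point of `K` in the same piece,
  -- and `1` across `B`.
  set L := 1 + R + a with hL
  have hL0 : 0 < L := by have := hR.1; positivity
  -- Volume comparison: disjoint balls of radius at least `ρ * δ * a` inside one ball of radius `ρ *
  -- L`.
  refine ⟨(L / (δ * a)) ^ d, by positivity, fun ρ hρ0 hρ1 B hB F hF => ?_⟩
  rcases F.eq_empty_or_nonempty with rfl | ⟨I₀, hI₀⟩
  · simp; positivity
  obtain ⟨-, z, -, hz⟩ := hF I₀ hI₀
  -- Volume is taken as Hausdorff measure of full dimension: it is a Haar measure, and its scaling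
  -- under similitudes is already available.
  let μ : Measure (EuclideanSpace ℝ (Fin d)) :=
    μH[(Module.finrank ℝ (EuclideanSpace ℝ (Fin d)) : ℝ)]
  have hsub : ∀ I ∈ F, wordMap S I '' Metric.closedBall x₀ a ⊆ Metric.closedBall z (ρ * L) := by
    rintro I hI _ ⟨y, hy, rfl⟩
    obtain ⟨hc, w, ⟨k, hk, rfl⟩, hw⟩ := hF I hI
    rw [Metric.mem_closedBall]
    have h1 : dist (wordMap S I y) (wordMap S I k) ≤ ρ * (a + R) := by
      rw [dist_wordMap hS]
      refine mul_le_mul hc.1 ?_ dist_nonneg hρ0.le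
      exact (dist_triangle y x₀ k).trans (add_le_add hy (hR.2 k hk))
    calc dist (wordMap S I y) z ≤ dist (wordMap S I y) (wordMap S I k) + dist (wordMap S I k) z :=
          dist_triangle _ _ _
      _ ≤ ρ * (a + R) + ρ := add_le_add h1 (hB _ hw _ hz)
      _ = ρ * L := by rw [hL]; ring
  have hinj : ∀ i, Function.Injective (S i) := fun i => injective_of_dist_eq_mul (hr0 i) (hS i)
  have hmeas : ∀ I ∈ F, MeasurableSet (wordMap S I '' Metric.closedBall x₀ a) := fun I _ =>
    ((isCompact_closedBall x₀ a).image (continuous_of_dist_eq_mul (wordRatio_pos hr0 I)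
      (dist_wordMap hS I))).measurableSet
  have hdisj : (F : Set (List (Fin N))).PairwiseDisjoint
      fun I => wordMap S I '' Metric.closedBall x₀ a := by
    intro I hI J hJ hIJ
    refine (disjoint_wordMap_image hinj hUsub hUdisj I J ?_ ?_).mono
      (image_mono haU) (image_mono haU)
    · exact fun h => hIJ (cutWords_eq_of_prefix (hF I hI).1 (hF J hJ).1 h)
    · exact fun h => hIJ (cutWords_eq_of_prefix (hF J hJ).1 (hF I hI).1 h).symm
  have hle : ∑ I ∈ F, μ (wordMap S I '' Metric.closedBall x₀ a) ≤
      μ (Metric.closedBall z (ρ * L)) := by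
    rw [← measure_biUnion_finset hdisj hmeas]
    exact measure_mono (iUnion₂_subset hsub)
  have hm0 : μ (Metric.ball 0 1) ≠ 0 := (Metric.measure_ball_pos μ _ one_pos).ne'
  have hmt : μ (Metric.ball 0 1) ≠ ∞ := measure_ball_lt_top.ne
  have hterm : ∀ I ∈ F, ENNReal.ofReal ((ρ * δ * a) ^ d) * μ (Metric.ball 0 1) ≤
      μ (wordMap S I '' Metric.closedBall x₀ a) := by
    intro I hI
    rw [hausdorffMeasure_image_similitude (wordRatio_pos hr0 I) (Nat.cast_nonneg _)
      (dist_wordMap hS I)]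
    change _ ≤ _ * μ (Metric.closedBall x₀ a)
    rw [Measure.addHaar_closedBall μ x₀ ha0.le, ← mul_assoc,
      ← ENNReal.ofReal_mul (Real.rpow_nonneg (wordRatio_pos hr0 I).le _), Real.rpow_natCast,
      finrank_euclideanSpace_fin, ← mul_pow]
    gcongr
    exact mul_le_wordRatio_of_mem_cutWords hρ1 hρ0 hδ0 (min_le_right _ _) hδ (hF I hI).1
  have hfinal := (Finset.sum_le_sum hterm).trans hle
  rw [Finset.sum_const, nsmul_eq_mul, Measure.addHaar_closedBall μ z (by positivity), ← mul_assoc,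
    ENNReal.mul_le_mul_iff_left hm0 hmt, finrank_euclideanSpace_fin,
    ← ENNReal.ofReal_natCast, ← ENNReal.ofReal_mul (by positivity),
    ENNReal.ofReal_le_ofReal_iff (by positivity)] at hfinal
  rw [div_pow, le_div_iff₀ (by positivity)]
  have h2 : (F.card : ℝ) * (δ * a) ^ d * ρ ^ d ≤ L ^ d * ρ ^ d := by
    rw [← mul_pow, mul_assoc, ← mul_pow, mul_comm L, mul_comm (δ * a), ← mul_assoc]
    exact hfinal
  exact le_of_mul_le_mul_right h2 (by positivity)

/-! #### The Bernoulli measure on the code space -/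

theorem pi_range_getElem?_measure {N : ℕ} {r : Fin N → ℝ} (hr0 : ∀ i, 0 < r i) {D : ℝ}
    (p : Measure (Fin N)) (hp : ∀ i, p {i} = ENNReal.ofReal (r i ^ D)) (I : List (Fin N)) :
    ∏ k ∈ Finset.range I.length, p {i | I[k]? = some i} = ENNReal.ofReal (wordRatio r I ^ D) := by
  induction I with
  | nil => simp
  | cons a I ih =>
    rw [List.length_cons, Finset.prod_range_succ']
    have h0 : {i | (a :: I)[0]? = some i} = {a} := by ext i; simp [eq_comm]
    rw [h0, hp, wordRatio_cons, Real.mul_rpow (hr0 a).le (wordRatio_pos hr0 I).le,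
      ENNReal.ofReal_mul (Real.rpow_nonneg (hr0 a).le D), mul_comm, ← ih]
    simp

/-- The Bernoulli measure giving the cylinder of a word `I` the mass `wordRatio r I ^ D`. -/
theorem exists_bernoulli_measure {N : ℕ} {r : Fin N → ℝ} (hr0 : ∀ i, 0 < r i) {D : ℝ}
    (hD : ∑ i, r i ^ D = 1) : ∃ μ : Measure (ℕ → Fin N), IsProbabilityMeasure μ ∧
      ∀ I : List (Fin N), μ {ω | (List.range I.length).map ω = I} =
        ENNReal.ofReal (wordRatio r I ^ D) := by
  let p : PMF (Fin N) := PMF.ofFintype (fun i => ENNReal.ofReal (r i ^ D)) (by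
    rw [← ENNReal.ofReal_sum_of_nonneg fun i _ => Real.rpow_nonneg (hr0 i).le D, hD,
      ENNReal.ofReal_one])
  refine ⟨Measure.infinitePi fun _ => p.toMeasure, inferInstance, fun I => ?_⟩
  have hset : {ω : ℕ → Fin N | (List.range I.length).map ω = I} =
      (↑(Finset.range I.length) : Set ℕ).pi fun k => {i | I[k]? = some i} := by
    ext ω
    simp only [mem_ofPred_eq, Set.mem_pi, Finset.coe_range, mem_Iio]
    constructor
    · intro h k hk
      conv_lhs => rw [← h]
      simp [hk]
    · intro h
      refine List.ext_getElem? fun k => ?_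
      by_cases hk : k < I.length
      · rw [h k hk]; simp [hk]
      · simp only [not_lt] at hk
        rw [List.getElem?_eq_none hk, List.getElem?_eq_none (by simpa using hk)]
  rw [hset, Measure.infinitePi_pi _ fun _ _ => MeasurableSet.of_discrete,
    pi_range_getElem?_measure hr0]
  intro i
  rw [PMF.toMeasure_apply_singleton _ _ (measurableSet_singleton i)]
  rfl

theorem coding_eq_wordMap {X ι : Type*} {S : ι → X → X} {π : (ℕ → ι) → X}
    (hπ : ∀ ω, π ω = S (ω 0) (π fun n => ω (n + 1))) (n : ℕ) (ω : ℕ → ι) :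
    π ω = wordMap S ((List.range n).map ω) (π fun k => ω (n + k)) := by
  induction n generalizing ω with
  | zero => simp
  | succ n ih =>
    rw [hπ ω, ih, List.range_succ_eq_map]
    simp [Function.comp_def, add_right_comm]

/-- The singletons `{π ω}`, indexed by all codes, are compared with the constant family `K`; the
shift of `ω` is the next index. -/
theorem coding_mem_of_isInvariantSet {X : Type} [MetricSpace X] {N : ℕ} {S : Fin N → X → X}
    {r : Fin N → ℝ} (hr0 : ∀ i, 0 < r i) (hr1 : ∀ i, r i < 1)
    (hS : ∀ i x y, dist (S i x) (S i y) = r i * dist x y) {K : Set X} (hK : IsInvariantSet S K)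
    {π : (ℕ → Fin N) → X} (hπc : Continuous π)
    (hπ : ∀ ω, π ω = S (ω 0) (π fun n => ω (n + 1))) (ω : ℕ → Fin N) : π ω ∈ K := by
  obtain ⟨ρ, hρ0, hρ1, hρ⟩ := exists_uniform_ratio hr0 hr1
  have hb : Bornology.IsBounded (range π ∪ K) :=
    (isCompact_range hπc).isBounded.union hK.2.1.isBounded
  obtain ⟨D, hD⟩ := Metric.isBounded_iff.1 hb
  have := subset_of_contracting_families S hρ0.le hρ1
    (fun i x y => (hS i x y).le.trans (mul_le_mul_of_nonneg_right (hρ i) dist_nonneg))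
    (fun ω : ℕ → Fin N => {π ω}) (fun _ => K) (by
      rintro ω x rfl
      refine ⟨ω 0, fun n => ω (n + 1), _, rfl, hπ ω, fun z hz => ?_⟩
      rw [hK.2.2]
      exact mem_iUnion.2 ⟨_, z, hz, rfl⟩) (fun _ => hK.2.1.isClosed) (fun _ => hK.1)
    (D := D) (by rintro ω x rfl y hy; exact hD (Or.inl (mem_range_self _)) (Or.inr hy)) ω
  exact this rfl

/-- Mass distribution principle. The Bernoulli measure, pushed to `K`, gives a set of diameter `ρ`
mass at most `q * ρ ^ D`: at most `q` cut pieces meet the set and each has mass at most `ρ ^ D`.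
Hence `μH[D]` dominates a positive multiple of a probability measure carried by `K`. -/
theorem hausdorffMeasure_pos_of_openSetCondition {d N : ℕ}
    {S : Fin N → EuclideanSpace ℝ (Fin d) → EuclideanSpace ℝ (Fin d)} {r : Fin N → ℝ}
    (hr0 : ∀ i, 0 < r i) (hr1 : ∀ i, r i < 1)
    (hS : ∀ i x y, dist (S i x) (S i y) = r i * dist x y) (hOSC : IFSOpenSetCondition S)
    {K : Set (EuclideanSpace ℝ (Fin d))} (hK : IsInvariantSet S K) {D : ℝ} (hD0 : 0 < D)
    (hD : ∑ i, r i ^ D = 1) : 0 < μH[D] K := by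
  obtain ⟨q, hq0, hq⟩ := exists_card_cutWords_le hr0 hS hOSC hK.2.1.isBounded
  obtain ⟨π, hπc, hπ⟩ := exists_coding_map hr0 hr1 hS
  have hπK := coding_mem_of_isInvariantSet hr0 hr1 hS hK hπc hπ
  obtain ⟨P, hP, hPcyl⟩ := exists_bernoulli_measure hr0 hD
  set ν := P.map π with hν
  have key : ∀ ρ : ℝ, 0 < ρ → ρ ≤ 1 → ∀ B : Set (EuclideanSpace ℝ (Fin d)),
      Metric.ediam B ≤ ENNReal.ofReal ρ → ν B ≤ ENNReal.ofReal (q * ρ ^ D) := by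
    intro ρ hρ0 hρ1 B hB
    -- Passing to the closure keeps the diameter and provides a measurable set for the push-forward.
    set T := {I | I ∈ cutWords r ρ ∧ (wordMap S I '' K ∩ closure B).Nonempty} with hT
    have hBd : ∀ x ∈ closure B, ∀ y ∈ closure B, dist x y ≤ ρ := by
      intro x hx y hy
      rw [← Metric.ediam_closure] at hB
      have := (Metric.edist_le_ediam_of_mem hx hy).trans hB
      rwa [edist_dist, ENNReal.ofReal_le_ofReal_iff hρ0.le] at this
    have hcard : ∀ F : Finset (List (Fin N)), (∀ I ∈ F, I ∈ T) → (F.card : ℝ) ≤ q :=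
      fun F hF => hq ρ hρ0 hρ1 _ hBd F hF
    have hTfin : T.Finite := by
      by_contra hinf
      obtain ⟨n, hn⟩ := exists_nat_gt q
      obtain ⟨F, hF, hFn⟩ := (show T.Infinite from hinf).exists_subset_card_eq n
      have := hcard F fun I hI => hF hI
      rw [hFn] at this
      linarith
    set F := hTfin.toFinset with hF
    calc ν B ≤ ν (closure B) := measure_mono subset_closure
      _ = P (π ⁻¹' closure B) := Measure.map_apply hπc.measurable isClosed_closure.measurableSet
      _ ≤ P (⋃ I ∈ F, {ω | (List.range I.length).map ω = I}) := by
          refine measure_mono fun ω hω => ?_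
          obtain ⟨n, hn⟩ := exists_prefix_mem_cutWords hr0 hr1 hρ0 ω
          refine mem_biUnion (x := (List.range n).map ω) ?_ (by simp)
          simp only [hF, Finite.coe_toFinset]
          exact ⟨hn, π ω, ⟨_, hπK _, (coding_eq_wordMap hπ n ω).symm⟩, hω⟩
      _ ≤ ∑ I ∈ F, P {ω | (List.range I.length).map ω = I} := measure_biUnion_finset_le _ _
      _ ≤ ∑ _I ∈ F, ENNReal.ofReal (ρ ^ D) := by
          refine Finset.sum_le_sum fun I hI => ?_
          rw [hPcyl]
          refine ENNReal.ofReal_le_ofReal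
            (Real.rpow_le_rpow (wordRatio_pos hr0 I).le ?_ hD0.le)
          exact (hTfin.mem_toFinset.1 hI).1.1
      _ ≤ ENNReal.ofReal (q * ρ ^ D) := by
          rw [Finset.sum_const, nsmul_eq_mul, ← ENNReal.ofReal_natCast,
            ← ENNReal.ofReal_mul (Nat.cast_nonneg _)]
          refine ENNReal.ofReal_le_ofReal (mul_le_mul_of_nonneg_right ?_
            (Real.rpow_nonneg hρ0.le D))
          exact hcard F fun I hI => hTfin.mem_toFinset.1 hI
  have hle : (ENNReal.ofReal q)⁻¹ • ν ≤ μH[D] := by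
    refine Measure.le_hausdorffMeasure D _ 1 one_pos fun B hB => ?_
    rw [Measure.smul_apply, smul_eq_mul,
      ENNReal.inv_mul_le_iff (ENNReal.ofReal_pos.2 hq0).ne' ENNReal.ofReal_ne_top]
    have htop : Metric.ediam B ≠ ∞ := (hB.trans_lt ENNReal.one_lt_top).ne
    -- The estimate `key` needs a positive radius, so sets of zero diameter are handled through
    -- radii `1 / (n + 1)`.
    rcases eq_or_ne (Metric.ediam B) 0 with h0 | h0
    · have hlim : Tendsto (fun n : ℕ => ENNReal.ofReal (q * (1 / ((n : ℝ) + 1)) ^ D)) atTop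
          (𝓝 0) := by
        rw [← ENNReal.ofReal_zero]
        refine ENNReal.tendsto_ofReal ?_
        have := (tendsto_one_div_add_atTop_nhds_zero_nat (𝕜 := ℝ)).rpow_const
          (p := D) (Or.inr hD0.le)
        rw [Real.zero_rpow hD0.ne'] at this
        simpa using this.const_mul q
      have : ν B ≤ 0 := ge_of_tendsto' hlim fun n => by
        refine key _ (by positivity) ?_ B (by simp [h0])
        rw [div_le_one (by positivity)]
        linarith [(Nat.cast_nonneg n : (0 : ℝ) ≤ n)]
      exact this.trans zero_le
    · have hpos : 0 < (Metric.ediam B).toReal := ENNReal.toReal_pos h0 htop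
      have h1 : (Metric.ediam B).toReal ≤ 1 := by
        simpa using ENNReal.toReal_mono ENNReal.one_ne_top hB
      have := key _ hpos h1 B (by rw [ENNReal.ofReal_toReal htop])
      rwa [ENNReal.ofReal_mul hq0.le, ← ENNReal.ofReal_rpow_of_pos hpos,
        ENNReal.ofReal_toReal htop] at this
  have hνK : ν K = 1 := by
    rw [hν, Measure.map_apply hπc.measurable hK.2.1.measurableSet,
      (eq_univ_of_forall hπK : π ⁻¹' K = univ), measure_univ]
  refine lt_of_lt_of_le ?_ (hle K)
  rw [Measure.smul_apply, hνK, smul_eq_mul, mul_one]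
  exact ENNReal.inv_pos.2 ENNReal.ofReal_ne_top

/-- Moran's theorem: under the open set condition the Hausdorff dimension `s` of the invariant set
solves Moran's equation, and the invariant set has positive and finite `s`-dimensional measure. -/
theorem moran {d N : ℕ} (hN : 2 ≤ N)
    {S : Fin N → EuclideanSpace ℝ (Fin d) → EuclideanSpace ℝ (Fin d)} {r : Fin N → ℝ}
    (hr0 : ∀ i, 0 < r i) (hr1 : ∀ i, r i < 1)
    (hS : ∀ i x y, dist (S i x) (S i y) = r i * dist x y) (hOSC : IFSOpenSetCondition S)
    {K : Set (EuclideanSpace ℝ (Fin d))} (hK : IsInvariantSet S K)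
    {s : ℝ≥0} (hs : dimH K = (s : ℝ≥0∞)) :
    0 < s ∧ ∑ i, r i ^ (s : ℝ) = 1 ∧ 0 < μH[(s : ℝ)] K ∧ μH[(s : ℝ)] K < ∞ := by
  obtain ⟨D, hD0, hD⟩ := exists_similarity_dimension hN hr0 hr1
  have hpos := hausdorffMeasure_pos_of_openSetCondition hr0 hr1 hS hOSC hK
    (NNReal.coe_pos.2 hD0) hD
  have hfin := hausdorffMeasure_lt_top_of_sum_rpow hr0 hr1 hS hK (NNReal.coe_pos.2 hD0) hD
  -- Positive finite measure in the similarity dimension `D` identifies `D` with the Hausdorff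
  -- dimension, hence with `s`.
  have hdim := dimH_of_hausdorffMeasure_ne_zero_ne_top hpos.ne' hfin.ne
  rw [hs, ENNReal.coe_inj] at hdim
  subst hdim
  exact ⟨hD0, hD, hpos, hfin⟩

/-! ### Curves parametrized by subdivision -/

/-- A system of subdivision rules: an interval of state `w` and length `len w` is divided into
`cnt w` consecutive intervals; the `k`-th is a copy of the interval of state `nxt w k`, scaled by
`ratio ^ s`, and carries the similitude of index `lab w k`. The points `src w` and `tgt w` are
compatible end points. -/
structure OrderedSubdivision (X : Type) [MetricSpace X] (N : ℕ) (W : Type) where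
  map : Fin N → X → X
  ratio : Fin N → ℝ
  ratio_pos : ∀ i, 0 < ratio i
  ratio_lt_one : ∀ i, ratio i < 1
  dist_map : ∀ i x y, dist (map i x) (map i y) = ratio i * dist x y
  s : ℝ
  s_pos : 0 < s
  cnt : W → ℕ
  lab : W → ℕ → Fin N
  nxt : W → ℕ → W
  len : W → ℝ
  len_pos : ∀ w, 0 < len w
  len_eq : ∀ w, len w = ∑ k ∈ Finset.range (cnt w), ratio (lab w k) ^ s * len (nxt w k)
  src : W → X
  tgt : W → X
  src_eq : ∀ w, src w = map (lab w 0) (src (nxt w 0))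
  tgt_eq : ∀ w, tgt w = map (lab w (cnt w - 1)) (tgt (nxt w (cnt w - 1)))
  link : ∀ w k, k + 1 < cnt w →
    map (lab w k) (tgt (nxt w k)) = map (lab w (k + 1)) (src (nxt w (k + 1)))

namespace OrderedSubdivision

variable {X : Type} [MetricSpace X] {N : ℕ} {W : Type} (G : OrderedSubdivision X N W)

/-- The factor by which the `k`-th child interval is scaled. -/
noncomputable def scale (w : W) (k : ℕ) : ℝ := G.ratio (G.lab w k) ^ G.s

/-- The left end point of the `k`-th child interval. -/
noncomputable def breakpoint (w : W) (k : ℕ) : ℝ :=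
  ∑ i ∈ Finset.range k, G.scale w i * G.len (G.nxt w i)

/-- The index of the child interval containing `t`. -/
noncomputable def digit (w : W) (t : ℝ) : ℕ :=
  open Classical in Nat.findGreatest (fun k => G.breakpoint w k ≤ t) (G.cnt w - 1)

/-- The coordinate of `t` in its child interval. -/
noncomputable def rescale (w : W) (t : ℝ) : ℝ :=
  (t - G.breakpoint w (G.digit w t)) / G.scale w (G.digit w t)

theorem scale_pos (w : W) (k : ℕ) : 0 < G.scale w k := Real.rpow_pos_of_pos (G.ratio_pos _) _

@[simp] theorem breakpoint_zero (w : W) : G.breakpoint w 0 = 0 := by simp [breakpoint]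

theorem breakpoint_succ (w : W) (k : ℕ) :
    G.breakpoint w (k + 1) = G.breakpoint w k + G.scale w k * G.len (G.nxt w k) := by
  simp [breakpoint, Finset.sum_range_succ]

theorem breakpoint_cnt (w : W) : G.breakpoint w (G.cnt w) = G.len w := (G.len_eq w).symm

theorem breakpoint_strictMono (w : W) : StrictMono (G.breakpoint w) :=
  strictMono_nat_of_lt_succ fun k => by
    rw [breakpoint_succ]
    exact lt_add_of_pos_right _ (mul_pos (G.scale_pos w k) (G.len_pos _))

theorem cnt_pos (w : W) : 0 < G.cnt w := by
  rw [Nat.pos_iff_ne_zero]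
  intro h
  have := G.len_pos w
  rw [G.len_eq, h] at this
  simp at this

theorem digit_lt (w : W) (t : ℝ) : G.digit w t < G.cnt w :=
  lt_of_le_of_lt (Nat.findGreatest_le _) (Nat.sub_lt (G.cnt_pos w) one_pos)

theorem breakpoint_digit_le (w : W) {t : ℝ} (ht : 0 ≤ t) : G.breakpoint w (G.digit w t) ≤ t := by
  classical
  exact Nat.findGreatest_spec (P := fun k => G.breakpoint w k ≤ t) (Nat.zero_le (G.cnt w - 1))
    (by simpa using ht)

theorem le_breakpoint_digit_succ (w : W) {t : ℝ} (ht : t ≤ G.len w) :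
    t ≤ G.breakpoint w (G.digit w t + 1) := by
  classical
  by_contra! h
  rcases (Nat.succ_le_of_lt (G.digit_lt w t)).lt_or_eq with h1 | h1
  · exact Nat.findGreatest_is_greatest (P := fun k => G.breakpoint w k ≤ t)
      (Nat.lt_succ_self (G.digit w t)) (Nat.le_sub_one_of_lt h1) h.le
  · rw [Nat.succ_eq_add_one] at h1
    rw [h1, breakpoint_cnt] at h
    exact absurd ht (not_le.2 h)

theorem digit_mono (w : W) {x y : ℝ} (h : x ≤ y) : G.digit w x ≤ G.digit w y := by
  classical
  exact Nat.findGreatest_mono_left (fun k hk => le_trans hk h) _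

theorem digit_eq {w : W} {k : ℕ} (hk : k < G.cnt w) {t : ℝ} (h1 : G.breakpoint w k ≤ t)
    (h2 : t < G.breakpoint w (k + 1)) : G.digit w t = k := by
  classical
  refine (Nat.findGreatest_eq_iff).2 ⟨Nat.le_sub_one_of_lt hk, fun _ => h1, fun n hn _ hle => ?_⟩
  exact absurd (((G.breakpoint_strictMono w).monotone hn).trans hle) (not_le.2 h2)

/-- The cap `cnt w - 1` in `digit` assigns the right end of the interval to the last child, so that
`rescale` sends it to the right end of that child. -/
theorem digit_len (w : W) : G.digit w (G.len w) = G.cnt w - 1 := by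
  classical
  refine (Nat.findGreatest_eq_iff).2 ⟨le_rfl, fun _ => ?_, fun n hn h => absurd h (not_le.2 hn)⟩
  rw [← breakpoint_cnt]
  exact (G.breakpoint_strictMono w).monotone (Nat.sub_le _ _)

theorem breakpoint_add_rescale (w : W) (t : ℝ) :
    G.breakpoint w (G.digit w t) + G.scale w (G.digit w t) * G.rescale w t = t := by
  rw [rescale, mul_div_cancel₀ _ (G.scale_pos w _).ne']
  ring

theorem rescale_mem (w : W) {t : ℝ} (ht : t ∈ Icc 0 (G.len w)) :
    G.rescale w t ∈ Icc 0 (G.len (G.nxt w (G.digit w t))) := by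
  constructor
  · exact div_nonneg (sub_nonneg.2 (G.breakpoint_digit_le w ht.1)) (G.scale_pos w _).le
  · rw [rescale, div_le_iff₀ (G.scale_pos w _), sub_le_iff_le_add', mul_comm,
      ← breakpoint_succ]
    exact G.le_breakpoint_digit_succ w ht.2

/-- A bounded family of maps satisfying the functional equations given by the subdivision. -/
structure IsCurve (φ : W → ℝ → X) : Prop where
  bounded : ∃ D : ℝ, ∀ v x w y, dist (φ v x) (φ w y) ≤ D
  eq_map : ∀ w t, φ w t = G.map (G.lab w (G.digit w t)) (φ (G.nxt w (G.digit w t)) (G.rescale w t))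

theorem exists_isCurve [CompleteSpace X] [Nonempty X] : ∃ φ, G.IsCurve φ := by
  obtain ⟨π, hπc, hπ⟩ := exists_coding_map G.ratio_pos G.ratio_lt_one G.dist_map
  -- Zooming into the child that contains `t`. The labels met along the orbit of `(w, t)` form a
  -- code of the point, and shifting this code amounts to applying `T` once, which is the functional
  -- equation.
  let T : W × ℝ → W × ℝ := fun z => (G.nxt z.1 (G.digit z.1 z.2), G.rescale z.1 z.2)
  refine ⟨fun w t => π fun n => G.lab (T^[n] (w, t)).1 (G.digit (T^[n] (w, t)).1 (T^[n] (w, t)).2),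
    ?_, fun w t => ?_⟩
  · obtain ⟨D, hD⟩ := Metric.isBounded_iff.1 (isCompact_range hπc).isBounded
    exact ⟨D, fun v x w y => hD (mem_range_self _) (mem_range_self _)⟩
  · rw [hπ]
    rfl

variable {G} {φ : W → ℝ → X}

/-! ### End points, continuity and the Hölder estimate for the curves -/

namespace IsCurve

theorem apply_zero [Finite W] (hφ : G.IsCurve φ) (w : W) : φ w 0 = G.src w := by
  obtain ⟨ρ, hρ0, hρ1, hρ⟩ := exists_uniform_ratio G.ratio_pos G.ratio_lt_one
  obtain ⟨D, hD⟩ := exists_dist_bound (fun w => {φ w 0}) (fun w => {G.src w})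
    (fun _ => Bornology.isBounded_singleton) (fun _ => Bornology.isBounded_singleton)
  refine subset_of_contracting_families G.map hρ0.le hρ1
    (fun i x y => (G.dist_map i x y).le.trans (mul_le_mul_of_nonneg_right (hρ i) dist_nonneg))
    (fun w => {φ w 0}) (fun w => {G.src w}) ?_ (fun _ => isClosed_singleton)
    (fun _ => singleton_nonempty _) hD w rfl
  rintro w x rfl
  have hd : G.digit w 0 = 0 := G.digit_eq (G.cnt_pos w) (by simp) (by
    rw [← G.breakpoint_zero w]; exact G.breakpoint_strictMono w (Nat.lt_succ_self _))
  refine ⟨G.lab w 0, G.nxt w 0, _, rfl, ?_, ?_⟩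
  · have := hφ.eq_map w 0
    rwa [rescale, hd, breakpoint_zero, sub_zero, zero_div] at this
  · rintro z rfl
    exact (G.src_eq w).symm

theorem apply_len [Finite W] (hφ : G.IsCurve φ) (w : W) : φ w (G.len w) = G.tgt w := by
  obtain ⟨ρ, hρ0, hρ1, hρ⟩ := exists_uniform_ratio G.ratio_pos G.ratio_lt_one
  obtain ⟨D, hD⟩ := exists_dist_bound (fun w => {φ w (G.len w)}) (fun w => {G.tgt w})
    (fun _ => Bornology.isBounded_singleton) (fun _ => Bornology.isBounded_singleton)
  refine subset_of_contracting_families G.map hρ0.le hρ1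
    (fun i x y => (G.dist_map i x y).le.trans (mul_le_mul_of_nonneg_right (hρ i) dist_nonneg))
    (fun w => {φ w (G.len w)}) (fun w => {G.tgt w}) ?_ (fun _ => isClosed_singleton)
    (fun _ => singleton_nonempty _) hD w rfl
  rintro w x rfl
  refine ⟨G.lab w (G.cnt w - 1), G.nxt w (G.cnt w - 1), _, rfl, ?_, ?_⟩
  · have h := hφ.eq_map w (G.len w)
    have hr : G.rescale w (G.len w) = G.len (G.nxt w (G.cnt w - 1)) := by
      have h2 := G.breakpoint_add_rescale w (G.len w)
      rw [digit_len] at h2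
      have h3 := G.breakpoint_succ w (G.cnt w - 1)
      rw [Nat.sub_add_cancel (G.cnt_pos w), breakpoint_cnt] at h3
      exact mul_left_cancel₀ (G.scale_pos w _).ne' (add_left_cancel (h2.trans h3))
    rwa [hr, digit_len] at h
  · rintro z rfl
    exact (G.tgt_eq w).symm

/-- The functional equation holds on the closed child intervals. -/
theorem apply_child [Finite W] (hφ : G.IsCurve φ) {w : W} {k : ℕ} (hk : k < G.cnt w) {x : ℝ}
    (hx : x ∈ Icc 0 (G.len (G.nxt w k))) :
    φ w (G.breakpoint w k + G.scale w k * x) = G.map (G.lab w k) (φ (G.nxt w k) x) := by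
  -- On half-open child intervals the digit is `k`. The right end has digit `k + 1` if there is a
  -- next child; there `link` matches the two values, and for the last child `tgt_eq` does.
  have hinner : ∀ k, k < G.cnt w → ∀ x, 0 ≤ x → x < G.len (G.nxt w k) →
      φ w (G.breakpoint w k + G.scale w k * x) = G.map (G.lab w k) (φ (G.nxt w k) x) := by
    intro k hk x hx0 hx1
    have hd : G.digit w (G.breakpoint w k + G.scale w k * x) = k := by
      refine G.digit_eq hk (le_add_of_nonneg_right (mul_nonneg (G.scale_pos w k).le hx0)) ?_
      rw [breakpoint_succ]
      exact add_lt_add_right (mul_lt_mul_of_pos_left hx1 (G.scale_pos w k)) _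
    have := hφ.eq_map w (G.breakpoint w k + G.scale w k * x)
    rwa [rescale, hd, add_sub_cancel_left, mul_div_cancel_left₀ _ (G.scale_pos w k).ne'] at this
  rcases hx.2.lt_or_eq with h | h
  · exact hinner k hk x hx.1 h
  · rw [h, ← breakpoint_succ, hφ.apply_len]
    rcases (Nat.succ_le_of_lt hk).lt_or_eq with h1 | h1
    · have := hinner (k + 1) h1 0 le_rfl (G.len_pos _)
      rw [mul_zero, add_zero, hφ.apply_zero] at this
      rw [this, G.link w k h1]
    · have hk' : k = G.cnt w - 1 := by omega
      rw [show k + 1 = G.cnt w from h1, breakpoint_cnt, hφ.apply_len, G.tgt_eq, ← hk']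

/-- Contracting space by `ratio` corresponds to scaling time by `ratio ^ s`, so a bound with
exponent `1 / s` passes from child to parent with the same constant. -/
theorem ratio_mul_rpow (i : Fin N) {x : ℝ} (hx : 0 ≤ x) :
    G.ratio i * x ^ (1 / G.s) = (G.ratio i ^ G.s * x) ^ (1 / G.s) := by
  rw [Real.mul_rpow (Real.rpow_nonneg (G.ratio_pos i).le _) hx, ← Real.rpow_mul (G.ratio_pos i).le,
    mul_one_div_cancel G.s_pos.ne', Real.rpow_one]

theorem le_of_forall_le_add_pow {a b ρ D : ℝ} (hρ0 : 0 ≤ ρ) (hρ1 : ρ < 1)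
    (h : ∀ n : ℕ, a ≤ b + ρ ^ n * D) : a ≤ b := by
  have ht : Tendsto (fun n : ℕ => b + ρ ^ n * D) atTop (𝓝 b) := by
    simpa using ((tendsto_pow_atTop_nhds_zero_of_lt_one hρ0 hρ1).mul_const D).const_add b
  exact ge_of_tendsto' ht h

/-- Only finitely many pairs of a label and a state occur, so child intervals have a common lower
bound for their lengths. -/
theorem exists_child_bound [Finite W] (G : OrderedSubdivision X N W) : ∃ δ : ℝ, 0 < δ ∧
    ∀ w k, G.breakpoint w k + δ ≤ G.breakpoint w (k + 1) := by
  obtain ⟨δ, hδ0, hδ⟩ := exists_pos_le (f := fun p : Fin N × W => G.ratio p.1 ^ G.s * G.len p.2)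
    fun p => mul_pos (Real.rpow_pos_of_pos (G.ratio_pos _) _) (G.len_pos _)
  refine ⟨δ, hδ0, fun w k => ?_⟩
  rw [breakpoint_succ]
  exact add_le_add_right (hδ (G.lab w k, G.nxt w k)) _

/-- The `1 / s`-Hölder estimate. -/
theorem exists_dist_le [Finite W] (hφ : G.IsCurve φ) : ∃ C : ℝ, 0 ≤ C ∧ ∀ w x y, 0 ≤ x → x ≤ y →
    y ≤ G.len w → dist (φ w x) (φ w y) ≤ C * (y - x) ^ (1 / G.s) := by
  obtain ⟨ρ, hρ0, hρ1, hρ⟩ := exists_uniform_ratio G.ratio_pos G.ratio_lt_one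
  obtain ⟨D₀, hD₀⟩ := hφ.bounded
  -- If there are no states, `D₀` may be negative.
  set D := max D₀ 0 with hDdef
  have hD : ∀ v x w y, dist (φ v x) (φ w y) ≤ D := fun v x w y =>
    (hD₀ v x w y).trans (le_max_left _ _)
  have hD0 : 0 ≤ D := le_max_right _ _
  obtain ⟨δ, hδ0, hδ⟩ := exists_child_bound G
  have hs : 0 ≤ 1 / G.s := one_div_nonneg.2 G.s_pos.le
  have hδs : 0 < δ ^ (1 / G.s) := Real.rpow_pos_of_pos hδ0 _
  -- Chosen so that the trivial bound `D` suffices for parameters at distance at least `δ`.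
  set C := D / δ ^ (1 / G.s) with hC
  have hC0 : 0 ≤ C := div_nonneg hD0 hδs.le
  have hfar : ∀ t, δ ≤ t → D ≤ C * t ^ (1 / G.s) := fun t ht => by
    rw [hC, div_mul_eq_mul_div, le_div_iff₀ hδs]
    exact mul_le_mul_of_nonneg_left (Real.rpow_le_rpow hδ0.le ht hs) hD0
  have hstep : ∀ (c : ℝ) (w : W) (k : ℕ) (a b : ℝ) (n : ℕ), 0 ≤ b →
      a ≤ c * b ^ (1 / G.s) + ρ ^ n * D →
      G.ratio (G.lab w k) * a ≤ c * (G.scale w k * b) ^ (1 / G.s) + ρ ^ (n + 1) * D := by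
    intro c w k a b n hb h
    rw [scale, ← ratio_mul_rpow _ hb]
    calc G.ratio (G.lab w k) * a
        ≤ G.ratio (G.lab w k) * (c * b ^ (1 / G.s) + ρ ^ n * D) :=
          mul_le_mul_of_nonneg_left h (G.ratio_pos _).le
      _ = c * (G.ratio (G.lab w k) * b ^ (1 / G.s)) + G.ratio (G.lab w k) * (ρ ^ n * D) := by ring
      _ ≤ c * (G.ratio (G.lab w k) * b ^ (1 / G.s)) + ρ * (ρ ^ n * D) := by
          gcongr; exact hρ _
      _ = _ := by ring
  have hbase : ∀ (c : ℝ) v x w y t, 0 ≤ c → 0 ≤ t →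
      dist (φ v x) (φ w y) ≤ c * t ^ (1 / G.s) + ρ ^ 0 * D := by
    intro c v x w y t hc ht
    have := hD v x w y
    have h2 : 0 ≤ c * t ^ (1 / G.s) := mul_nonneg hc (Real.rpow_nonneg ht _)
    simpa using this.trans (le_add_of_nonneg_left h2)
  have hpow : ∀ n : ℕ, 0 ≤ ρ ^ n * D := fun n => mul_nonneg (pow_nonneg hρ0.le n) hD0
  -- Estimates anchored at an end point come first: there, either both points lie in the same
  -- extreme child or they are `δ` apart. A direct induction for two general points would double the
  -- constant at each splitting.
  have hleft : ∀ n : ℕ, ∀ w, ∀ t ∈ Icc 0 (G.len w),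
      dist (φ w 0) (φ w t) ≤ C * t ^ (1 / G.s) + ρ ^ n * D := by
    intro n
    induction n with
    | zero => exact fun w t ht => hbase C w 0 w t t hC0 ht.1
    | succ n ih =>
      intro w t ht
      rcases Nat.eq_zero_or_pos (G.digit w t) with h | h
      · have hx := G.rescale_mem w ht
        have ht' := G.breakpoint_add_rescale w t
        rw [h] at hx ht'
        have e1 := hφ.apply_child (G.cnt_pos w) hx
        have e2 := hφ.apply_child (G.cnt_pos w) (left_mem_Icc.2 (G.len_pos _).le)
        rw [ht'] at e1
        rw [breakpoint_zero, mul_zero, zero_add] at e2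
        rw [breakpoint_zero, zero_add] at ht'
        rw [e1, e2, G.dist_map]
        conv_rhs => rw [← ht']
        exact hstep C w 0 _ _ n hx.1 (ih _ _ hx)
      · have h1 : δ ≤ t := by
          have h2 := hδ w 0
          rw [breakpoint_zero, zero_add] at h2
          exact h2.trans (((G.breakpoint_strictMono w).monotone h).trans
            (G.breakpoint_digit_le w ht.1))
        exact (hD _ _ _ _).trans ((hfar t h1).trans (le_add_of_nonneg_right (hpow _)))
  have hright : ∀ n : ℕ, ∀ w, ∀ t ∈ Icc 0 (G.len w),
      dist (φ w t) (φ w (G.len w)) ≤ C * (G.len w - t) ^ (1 / G.s) + ρ ^ n * D := by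
    intro n
    induction n with
    | zero => exact fun w t ht => hbase C w t w _ _ hC0 (sub_nonneg.2 ht.2)
    | succ n ih =>
      intro w t ht
      rcases (Nat.succ_le_of_lt (G.digit_lt w t)).lt_or_eq with h | h
      · have h1 : δ ≤ G.len w - t := by
          have h2 := hδ w (G.digit w t + 1)
          have h3 := (G.breakpoint_strictMono w).monotone (show G.digit w t + 1 + 1 ≤ G.cnt w from h)
          rw [breakpoint_cnt] at h3
          linarith [G.le_breakpoint_digit_succ w ht.2]
        exact (hD _ _ _ _).trans ((hfar _ h1).trans (le_add_of_nonneg_right (hpow _)))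
      · have hx := G.rescale_mem w ht
        have ht' := G.breakpoint_add_rescale w t
        set k := G.digit w t with hk
        have hkl : G.breakpoint w k + G.scale w k * G.len (G.nxt w k) = G.len w := by
          rw [← breakpoint_succ, ← breakpoint_cnt]; exact congrArg _ h
        have e1 := hφ.apply_child (G.digit_lt w t) hx
        have e2 := hφ.apply_child (G.digit_lt w t) (right_mem_Icc.2 (G.len_pos _).le)
        rw [← hk, ht'] at e1
        rw [← hk, hkl] at e2
        rw [e1, e2, G.dist_map]
        have e3 : G.len w - t = G.scale w k * (G.len (G.nxt w k) - G.rescale w t) := by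
          rw [← ht', ← hkl]
          have : G.rescale w (G.breakpoint w k + G.scale w k * G.rescale w t) = G.rescale w t := by
            rw [ht']
          rw [this]; ring
        rw [e3]
        exact hstep C w k _ _ n (sub_nonneg.2 hx.2) (ih _ _ hx)
  have hleft' : ∀ w, ∀ t ∈ Icc 0 (G.len w), dist (φ w 0) (φ w t) ≤ C * t ^ (1 / G.s) :=
    fun w t ht => le_of_forall_le_add_pow hρ0.le hρ1 fun n => hleft n w t ht
  have hright' : ∀ w, ∀ t ∈ Icc 0 (G.len w),
      dist (φ w t) (φ w (G.len w)) ≤ C * (G.len w - t) ^ (1 / G.s) :=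
    fun w t ht => le_of_forall_le_add_pow hρ0.le hρ1 fun n => hright n w t ht
  -- Points in the same child are rescaled. Points in adjacent children are split at the common
  -- breakpoint `z`, where the anchored estimates give `2 * C`. Otherwise a whole child lies between
  -- them and the gap is at least `δ`.
  have hmain : ∀ n : ℕ, ∀ w x y, 0 ≤ x → x ≤ y → y ≤ G.len w →
      dist (φ w x) (φ w y) ≤ 2 * C * (y - x) ^ (1 / G.s) + ρ ^ n * D := by
    intro n
    induction n with
    | zero =>
      exact fun w x y _ hxy _ => hbase (2 * C) w x w y _ (by positivity) (sub_nonneg.2 hxy)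
    | succ n ih =>
      intro w x y hx0 hxy hy1
      have hx : x ∈ Icc 0 (G.len w) := ⟨hx0, hxy.trans hy1⟩
      have hy : y ∈ Icc 0 (G.len w) := ⟨hx0.trans hxy, hy1⟩
      have hx' := G.rescale_mem w hx
      have hy' := G.rescale_mem w hy
      have ex := hφ.apply_child (G.digit_lt w x) hx'
      have ey := hφ.apply_child (G.digit_lt w y) hy'
      have bx := G.breakpoint_add_rescale w x
      have bY := G.breakpoint_add_rescale w y
      rw [bx] at ex
      rw [bY] at ey
      rcases (G.digit_mono w hxy).eq_or_lt with h | h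
      · rw [← h] at ey hy' bY
        rw [ex, ey, G.dist_map]
        have e3 : y - x = G.scale w (G.digit w x) * (G.rescale w y - G.rescale w x) := by
          rw [mul_sub]
          linarith
        rw [e3]
        have hle : G.rescale w x ≤ G.rescale w y := by
          refine le_of_mul_le_mul_left ?_ (G.scale_pos w (G.digit w x))
          linarith
        exact hstep (2 * C) w _ _ _ n (sub_nonneg.2 hle) (ih _ _ _ hx'.1 hle hy'.2)
      · refine le_trans ?_ (le_add_of_nonneg_right (hpow (n + 1)))
        rcases (Nat.succ_le_of_lt h).eq_or_lt with h1 | h1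
        · have h1' : G.digit w x + 1 = G.digit w y := h1
          set z := G.breakpoint w (G.digit w y) with hz
          have ez1 := hφ.apply_child (G.digit_lt w x) (right_mem_Icc.2 (G.len_pos _).le)
          rw [← breakpoint_succ, h1', ← hz] at ez1
          have ez2 := hφ.apply_child (G.digit_lt w y) (left_mem_Icc.2 (G.len_pos _).le)
          rw [mul_zero, add_zero, ← hz] at ez2
          have hxz : x ≤ z := by
            rw [hz, ← h1']; exact G.le_breakpoint_digit_succ w hx.2
          have hzy : z ≤ y := G.breakpoint_digit_le w hy.1
          have d1 : dist (φ w x) (φ w z) ≤ C * (z - x) ^ (1 / G.s) := by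
            rw [ex, ez1, G.dist_map]
            have e3 : z - x = G.scale w (G.digit w x) *
                (G.len (G.nxt w (G.digit w x)) - G.rescale w x) := by
              have := G.breakpoint_succ w (G.digit w x)
              rw [h1', ← hz] at this
              rw [mul_sub]; linarith
            rw [e3, scale, ← ratio_mul_rpow _ (sub_nonneg.2 hx'.2)]
            calc _ ≤ G.ratio (G.lab w (G.digit w x)) * _ :=
                  mul_le_mul_of_nonneg_left (hright' _ _ hx') (G.ratio_pos _).le
              _ = _ := by ring
          have d2 : dist (φ w z) (φ w y) ≤ C * (y - z) ^ (1 / G.s) := by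
            rw [ey, ez2, G.dist_map]
            have e3 : y - z = G.scale w (G.digit w y) * G.rescale w y := by linarith
            rw [e3, scale, ← ratio_mul_rpow _ hy'.1]
            calc _ ≤ G.ratio (G.lab w (G.digit w y)) * _ :=
                  mul_le_mul_of_nonneg_left (hleft' _ _ hy') (G.ratio_pos _).le
              _ = _ := by ring
          have p1 : (z - x) ^ (1 / G.s) ≤ (y - x) ^ (1 / G.s) :=
            Real.rpow_le_rpow (by linarith) (by linarith) hs
          have p2 : (y - z) ^ (1 / G.s) ≤ (y - x) ^ (1 / G.s) :=
            Real.rpow_le_rpow (by linarith) (by linarith) hs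
          calc dist (φ w x) (φ w y) ≤ _ := dist_triangle _ (φ w z) _
            _ ≤ C * (z - x) ^ (1 / G.s) + C * (y - z) ^ (1 / G.s) := add_le_add d1 d2
            _ ≤ C * (y - x) ^ (1 / G.s) + C * (y - x) ^ (1 / G.s) := by gcongr
            _ = _ := by ring
        · have hgap : δ ≤ y - x := by
            have a1 := hδ w (G.digit w x + 1)
            have a2 := (G.breakpoint_strictMono w).monotone
              (show G.digit w x + 1 + 1 ≤ G.digit w y from h1)
            linarith [G.le_breakpoint_digit_succ w hx.2, G.breakpoint_digit_le w hy.1]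
          have := hfar _ hgap
          have h0 : 0 ≤ C * (y - x) ^ (1 / G.s) := hD0.trans this
          calc dist (φ w x) (φ w y) ≤ D := hD _ _ _ _
            _ ≤ 2 * C * (y - x) ^ (1 / G.s) := by linarith
  exact ⟨2 * C, by positivity, fun w x y h0 h1 h2 =>
    le_of_forall_le_add_pow hρ0.le hρ1 fun n => hmain n w x y h0 h1 h2⟩

theorem continuousOn [Finite W] (hφ : G.IsCurve φ) (w : W) :
    ContinuousOn (φ w) (Icc 0 (G.len w)) := by
  obtain ⟨C, hC0, hC⟩ := hφ.exists_dist_le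
  have hs : 0 < 1 / G.s := one_div_pos.2 G.s_pos
  have habs : ∀ x ∈ Icc 0 (G.len w), ∀ y ∈ Icc 0 (G.len w),
      dist (φ w x) (φ w y) ≤ C * |y - x| ^ (1 / G.s) := by
    intro x hx y hy
    rcases le_total x y with h | h
    · rw [abs_of_nonneg (sub_nonneg.2 h)]; exact hC w x y hx.1 h hy.2
    · rw [abs_sub_comm, abs_of_nonneg (sub_nonneg.2 h), dist_comm]; exact hC w y x hy.1 h hx.2
  intro x hx
  have ht : Tendsto (fun y => C * |y - x| ^ (1 / G.s)) (𝓝[Icc 0 (G.len w)] x) (𝓝 0) := by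
    have hcont : Continuous fun y : ℝ => C * |y - x| ^ (1 / G.s) :=
      continuous_const.mul ((continuous_abs.comp (continuous_id.sub continuous_const)).rpow_const
        fun _ => Or.inr hs.le)
    have := hcont.tendsto x
    simp only [sub_self, abs_zero, Real.zero_rpow hs.ne', mul_zero] at this
    exact this.mono_left nhdsWithin_le_nhds
  refine tendsto_iff_dist_tendsto_zero.2
    (squeeze_zero' (Eventually.of_forall fun _ => dist_nonneg) ?_ ht)
  filter_upwards [self_mem_nhdsWithin] with y hy
  rw [dist_comm]
  exact habs x hx y hy

theorem isCompact_image [Finite W] (hφ : G.IsCurve φ) (w : W) :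
    IsCompact (φ w '' Icc 0 (G.len w)) := isCompact_Icc.image_of_continuousOn (hφ.continuousOn w)

theorem child_mem_Icc {w : W} {k : ℕ} (hk : k < G.cnt w) {x : ℝ}
    (hx : x ∈ Icc 0 (G.len (G.nxt w k))) :
    G.breakpoint w k + G.scale w k * x ∈ Icc 0 (G.len w) := by
  have h0 := (G.breakpoint_strictMono w).monotone (Nat.zero_le k)
  rw [breakpoint_zero] at h0
  have h1 := (G.breakpoint_strictMono w).monotone (Nat.succ_le_of_lt hk)
  rw [breakpoint_cnt, Nat.succ_eq_add_one, breakpoint_succ] at h1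
  have h2 := mul_le_mul_of_nonneg_left hx.2 (G.scale_pos w k).le
  exact ⟨add_nonneg h0 (mul_nonneg (G.scale_pos w k).le hx.1), by linarith⟩

theorem image_eq [Finite W] (hφ : G.IsCurve φ) (w : W) : φ w '' Icc 0 (G.len w) =
    ⋃ k : Fin (G.cnt w), G.map (G.lab w k) '' (φ (G.nxt w k) '' Icc 0 (G.len (G.nxt w k))) := by
  ext p
  simp only [mem_iUnion]
  constructor
  · rintro ⟨t, ht, rfl⟩
    exact ⟨⟨G.digit w t, G.digit_lt w t⟩, _, ⟨_, G.rescale_mem w ht, rfl⟩, (hφ.eq_map w t).symm⟩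
  · rintro ⟨k, _, ⟨x, hx, rfl⟩, rfl⟩
    exact ⟨_, child_mem_Icc k.2 hx, hφ.apply_child k.2 hx⟩

end IsCurve

end OrderedSubdivision

namespace OrderedSubdivision

variable {X : Type} [MetricSpace X] {N : ℕ} {W : Type} {G : OrderedSubdivision X N W}
  {φ : W → ℝ → X}

/-! #### Self-similar families of measures -/

/-- A family of measures which is self-similar along the subdivision. -/
def IsSelfSimilar [MeasurableSpace X] (G : OrderedSubdivision X N W) (μ : W → Measure X) : Prop :=
  ∀ w B, MeasurableSet B → μ w B = ∑ k ∈ Finset.range (G.cnt w),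
    ENNReal.ofReal (G.scale w k) * μ (G.nxt w k) (G.map (G.lab w k) ⁻¹' B)

theorem measurable_map [MeasurableSpace X] [BorelSpace X] (G : OrderedSubdivision X N W)
    (i : Fin N) : Measurable (G.map i) :=
  (continuous_of_dist_eq_mul (G.ratio_pos i) (G.dist_map i)).measurable

/-- Uniqueness of self-similar families. By induction on `n`, `ν` of a closed set is at most `μ` of
its `ρ ^ n * D`-thickening, since each map shrinks thickenings by at least `ρ`. At level zero the
thickening contains the whole carrier as soon as `B` meets it. Letting `n` grow gives the claim
because `B` is closed. -/
theorem IsSelfSimilar.le_of_isClosed [MeasurableSpace X] [BorelSpace X] {μ ν : W → Measure X}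
    [∀ w, IsFiniteMeasure (μ w)]
    (hμ : G.IsSelfSimilar μ) (hν : G.IsSelfSimilar ν) (A : W → Set X)
    (hμA : ∀ w, μ w (A w)ᶜ = 0) (hνA : ∀ w, ν w (A w)ᶜ = 0)
    (htot : ∀ w, ν w univ = μ w univ) {D : ℝ} (hD : ∀ w, ∀ x ∈ A w, ∀ y ∈ A w, dist x y < D)
    (w : W) {B : Set X} (hB : IsClosed B) : ν w B ≤ μ w B := by
  obtain ⟨ρ, hρ0, hρ1, hρ⟩ := exists_uniform_ratio G.ratio_pos G.ratio_lt_one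
  -- The thickening radii must tend to zero from the right, so `D` has to be positive; this can fail
  -- only when all carriers are empty.
  have hcase : 0 < D ∨ ∀ w, A w = ∅ := by
    by_cases h : ∃ w, (A w).Nonempty
    · obtain ⟨w, x, hx⟩ := h
      exact Or.inl (by simpa using hD w x hx x hx)
    · exact Or.inr fun w => by
        by_contra hne
        exact h ⟨w, nonempty_iff_ne_empty.2 hne⟩
  rcases hcase with hD0 | hempty
  swap
  · have := hνA w
    rw [hempty, compl_empty] at this
    exact (measure_mono (subset_univ B)).trans (this.le.trans zero_le)
  have key : ∀ n : ℕ, ∀ w, ∀ B : Set X, IsClosed B →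
      ν w B ≤ μ w (Metric.thickening (ρ ^ n * D) B) := by
    intro n
    induction n with
    | zero =>
      intro w B hB
      by_cases h : (B ∩ A w).Nonempty
      · obtain ⟨b, hbB, hbA⟩ := h
        have hsub : A w ⊆ Metric.thickening (ρ ^ 0 * D) B := fun x hx =>
          Metric.mem_thickening_iff.2 ⟨b, hbB, by simpa using hD w x hx b hbA⟩
        calc ν w B ≤ ν w univ := measure_mono (subset_univ _)
          _ = μ w univ := htot w
          _ ≤ μ w (A w) + μ w (A w)ᶜ := by
              rw [← union_compl_self (A w)]; exact measure_union_le _ _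
          _ = μ w (A w) := by rw [hμA, add_zero]
          _ ≤ _ := measure_mono hsub
      · have hsub : B ⊆ (A w)ᶜ := fun x hx hxA => h ⟨x, hx, hxA⟩
        exact (measure_mono hsub).trans ((hνA w).le.trans zero_le)
    | succ n ih =>
      intro w B hB
      rw [hν w B hB.measurableSet, hμ w _ Metric.isOpen_thickening.measurableSet]
      refine Finset.sum_le_sum fun k _ => ?_
      refine mul_le_mul_right ?_ _
      refine (ih _ _ (hB.preimage (continuous_of_dist_eq_mul (G.ratio_pos _)
        (G.dist_map (G.lab w k))))).trans (measure_mono fun x hx => ?_)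
      obtain ⟨z, hz, hxz⟩ := Metric.mem_thickening_iff.1 hx
      refine Metric.mem_thickening_iff.2 ⟨_, hz, ?_⟩
      rw [G.dist_map]
      calc G.ratio (G.lab w k) * dist x z ≤ ρ * dist x z := by gcongr; exact hρ _
        _ < ρ * (ρ ^ n * D) := mul_lt_mul_of_pos_left hxz hρ0
        _ = _ := by ring
  have hlim := tendsto_measure_thickening_of_isClosed (μ := μ w) (s := B)
    ⟨1, one_pos, measure_ne_top _ _⟩ hB
  have hseq : Tendsto (fun n : ℕ => ρ ^ n * D) atTop (𝓝[>] 0) := by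
    refine tendsto_nhdsWithin_iff.2 ⟨?_, Eventually.of_forall fun n =>
      mul_pos (pow_pos hρ0 n) hD0⟩
    simpa using (tendsto_pow_atTop_nhds_zero_of_lt_one hρ0.le hρ1).mul_const D
  exact ge_of_tendsto' (hlim.comp hseq) fun n => key n w B hB

/-! ### Images of Lebesgue measure under the curves -/

namespace IsCurve

theorem aemeasurable [Finite W] [MeasurableSpace X] [BorelSpace X] (hφ : G.IsCurve φ) (w : W) :
    AEMeasurable (φ w) (volume.restrict (Icc 0 (G.len w))) :=
  (hφ.continuousOn w).aemeasurable measurableSet_Icc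

/-- The push-forward of Lebesgue measure under the curve. -/
noncomputable def imageMeasure [MeasurableSpace X] (G : OrderedSubdivision X N W) (φ : W → ℝ → X)
    (w : W) : Measure X := (volume.restrict (Icc 0 (G.len w))).map (φ w)

/-- Half-open intervals are used because the children then tile the parent exactly; the omitted end
point is null. -/
theorem imageMeasure_apply [Finite W] [MeasurableSpace X] [BorelSpace X] (hφ : G.IsCurve φ) (w : W)
    {B : Set X} (hB : MeasurableSet B) :
    imageMeasure G φ w B = volume (φ w ⁻¹' B ∩ Ioc 0 (G.len w)) := by
  rw [imageMeasure, restrict_Ioc_eq_restrict_Icc.symm, Measure.map_apply_of_aemeasurable _ hB,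
    Measure.restrict_apply' measurableSet_Ioc]
  rw [restrict_Ioc_eq_restrict_Icc]
  exact hφ.aemeasurable w

theorem volume_inter_Ioc_breakpoint (T : Set ℝ) (w : W) (n : ℕ) :
    volume (T ∩ Ioc 0 (G.breakpoint w n)) =
      ∑ k ∈ Finset.range n, volume (T ∩ Ioc (G.breakpoint w k) (G.breakpoint w (k + 1))) := by
  induction n with
  | zero => simp
  | succ n ih =>
    have h0 := (G.breakpoint_strictMono w).monotone (Nat.zero_le n)
    rw [breakpoint_zero] at h0
    have h1 := (G.breakpoint_strictMono w).monotone (Nat.le_succ n)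
    rw [Finset.sum_range_succ, ← ih, ← measure_inter_add_sdiff (T ∩ Ioc 0 (G.breakpoint w (n + 1)))
      (measurableSet_Ioc (a := 0) (b := G.breakpoint w n))]
    congr 2
    · ext x
      simp only [mem_inter_iff, mem_Ioc]
      exact ⟨fun h => ⟨h.1.1, h.2⟩, fun h => ⟨⟨h.1, h.2.1, h.2.2.trans h1⟩, h.2⟩⟩
    · ext x
      simp only [mem_inter_iff, mem_Ioc, Set.mem_sdiff, not_and, not_le]
      exact ⟨fun h => ⟨h.1.1, h.2 h.1.2.1, h.1.2.2⟩,
        fun h => ⟨⟨h.1, h0.trans_lt h.2.1, h.2.2⟩, fun _ => h.2.1⟩⟩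

theorem volume_eq_mul_preimage {b c : ℝ} (hc : 0 < c) (T : Set ℝ) :
    volume T = ENNReal.ofReal c * volume ((fun x => b + c * x) ⁻¹' T) := by
  have : (fun x => b + c * x) ⁻¹' T = (fun x => c * x) ⁻¹' ((fun x => b + x) ⁻¹' T) := rfl
  rw [this, Real.volume_preimage_mul_left hc.ne', measure_preimage_add, ← mul_assoc,
    ← ENNReal.ofReal_mul hc.le, abs_of_pos (inv_pos.2 hc), mul_inv_cancel₀ hc.ne',
    ENNReal.ofReal_one, one_mul]

/-- On each child interval the curve is the child curve followed by a similitude; the affine change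
of variable contributes the factor `scale`. -/
theorem imageMeasure_isSelfSimilar [Finite W] [MeasurableSpace X] [BorelSpace X]
    (hφ : G.IsCurve φ) : G.IsSelfSimilar (imageMeasure G φ) := by
  intro w B hB
  rw [hφ.imageMeasure_apply w hB, ← breakpoint_cnt, volume_inter_Ioc_breakpoint]
  refine Finset.sum_congr rfl fun k hk => ?_
  rw [Finset.mem_range] at hk
  rw [hφ.imageMeasure_apply _ (G.measurable_map _ hB),
    volume_eq_mul_preimage (b := G.breakpoint w k) (G.scale_pos w k)]
  congr 2
  ext x
  have hp := G.scale_pos w k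
  simp only [mem_inter_iff, mem_preimage, mem_Ioc, breakpoint_succ, lt_add_iff_pos_right,
    add_le_add_iff_left, mul_pos_iff_of_pos_left hp, mul_le_mul_iff_right₀ hp]
  constructor
  · rintro ⟨h1, h2⟩
    exact ⟨by rwa [← hφ.apply_child hk ⟨h2.1.le, h2.2⟩], h2⟩
  · rintro ⟨h1, h2⟩
    exact ⟨by rwa [hφ.apply_child hk ⟨h2.1.le, h2.2⟩], h2⟩

/-- The image of the curve of state `w`. -/
def trace (G : OrderedSubdivision X N W) (φ : W → ℝ → X) (w : W) : Set X :=
  φ w '' Icc 0 (G.len w)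

theorem isCompact_child [Finite W] (hφ : G.IsCurve φ) (w : W) (k : ℕ) :
    IsCompact (G.map (G.lab w k) '' trace G φ (G.nxt w k)) :=
  (hφ.isCompact_image _).image (continuous_of_dist_eq_mul (G.ratio_pos _) (G.dist_map _))

/-! #### Multiple points -/

variable (G φ) in
/-- The points at which two different children of `w` meet, and their preimages down to
generation `n`. -/
def multiplePoints : ℕ → W → Set X
  | 0, w => ⋃ k : Fin (G.cnt w), ⋃ l : Fin (G.cnt w), ⋃ _ : k ≠ l,
      G.map (G.lab w k) '' trace G φ (G.nxt w k) ∩ G.map (G.lab w l) '' trace G φ (G.nxt w l)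
  | n + 1, w => ⋃ k : Fin (G.cnt w), G.map (G.lab w k) '' multiplePoints n (G.nxt w k)

/-- As long as two parameters of the same point lie in the same child, injectivity allows rescaling
and their distance grows by a factor at least `1 / ρ`. Lengths are bounded by `M`, so the parameters
eventually fall into different children, where the point belongs to an overlap. -/
theorem mem_multiplePoints [Finite W] (hφ : G.IsCurve φ) {w : W} {x y : ℝ}
    (hx : x ∈ Icc 0 (G.len w)) (hy : y ∈ Icc 0 (G.len w)) (hne : x ≠ y) (h : φ w x = φ w y) :
    φ w x ∈ ⋃ n, multiplePoints G φ n w := by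
  obtain ⟨ρ, hρ0, hρ1, hρ⟩ := exists_uniform_ratio (r := fun i => G.ratio i ^ G.s)
    (fun i => Real.rpow_pos_of_pos (G.ratio_pos i) _)
    (fun i => Real.rpow_lt_one (G.ratio_pos i).le (G.ratio_lt_one i) G.s_pos)
  obtain ⟨M, hM⟩ : ∃ M, ∀ w, G.len w ≤ M := by
    obtain ⟨M, hM⟩ := (Set.finite_range G.len).bddAbove
    exact ⟨M, fun w => hM (mem_range_self w)⟩
  have key : ∀ n : ℕ, ∀ w x y, x ∈ Icc 0 (G.len w) → y ∈ Icc 0 (G.len w) → φ w x = φ w y →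
      ρ ^ n * M < |x - y| → φ w x ∈ ⋃ n, multiplePoints G φ n w := by
    intro n
    induction n with
    | zero =>
      intro w x y hx hy _ hlt
      have : |x - y| ≤ G.len w := abs_sub_le_iff.2 ⟨by linarith [hx.2, hy.1], by
        linarith [hy.2, hx.1]⟩
      have := hM w
      rw [pow_zero, one_mul] at hlt
      linarith
    | succ n ih =>
      intro w x y hx hy hxy hlt
      have ex := hφ.eq_map w x
      have ey := hφ.eq_map w y
      have hx' := G.rescale_mem w hx
      have hy' := G.rescale_mem w hy
      by_cases hd : G.digit w x = G.digit w y
      · rw [← hd] at ey hy'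
        have heq : φ _ (G.rescale w x) = φ _ (G.rescale w y) :=
          injective_of_dist_eq_mul (G.ratio_pos _) (G.dist_map _) (ex.symm.trans (hxy.trans ey))
        have hlt' : ρ ^ n * M < |G.rescale w x - G.rescale w y| := by
          have bx := G.breakpoint_add_rescale w x
          have bY := G.breakpoint_add_rescale w y
          rw [← hd] at bY
          have e : x - y = G.scale w (G.digit w x) * (G.rescale w x - G.rescale w y) := by
            rw [mul_sub]; linarith
          rw [e, abs_mul, abs_of_pos (G.scale_pos w _)] at hlt
          by_contra! hcon
          have h1 : G.scale w (G.digit w x) * |G.rescale w x - G.rescale w y| ≤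
              ρ * (ρ ^ n * M) := mul_le_mul (hρ _) hcon (abs_nonneg _) hρ0.le
          rw [pow_succ', mul_assoc] at hlt
          linarith
        obtain ⟨m, hm⟩ := mem_iUnion.1 (ih _ _ _ hx' hy' heq hlt')
        refine mem_iUnion.2 ⟨m + 1, mem_iUnion.2 ⟨⟨G.digit w x, G.digit_lt w x⟩, _, hm, ?_⟩⟩
        exact ex.symm
      · refine mem_iUnion.2 ⟨0, ?_⟩
        simp only [multiplePoints, mem_iUnion]
        refine ⟨⟨G.digit w x, G.digit_lt w x⟩, ⟨G.digit w y, G.digit_lt w y⟩,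
          fun h => hd (congrArg Fin.val h), ⟨_, ⟨_, hx', rfl⟩, ex.symm⟩, _, ⟨_, hy', rfl⟩, ?_⟩
        rw [hxy]; exact ey.symm
  have ht : Tendsto (fun n : ℕ => ρ ^ n * M) atTop (𝓝 0) := by
    simpa using (tendsto_pow_atTop_nhds_zero_of_lt_one hρ0.le hρ1).mul_const M
  obtain ⟨n, hn⟩ := (ht.eventually (gt_mem_nhds (abs_pos.2 (sub_ne_zero.2 hne)))).exists
  exact key n w x y hx hy h hn

/-! ### Comparison with Hausdorff measure when traces have measure equal to length -/

section Hausdorff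

variable [MeasurableSpace X] [BorelSpace X]

theorem hausdorffMeasure_child (w : W) (k : ℕ) (A : Set X) :
    μH[G.s] (G.map (G.lab w k) '' A) = ENNReal.ofReal (G.scale w k) * μH[G.s] A :=
  hausdorffMeasure_image_similitude (G.ratio_pos _) G.s_pos.le (G.dist_map _) A

/-- By `len_eq` the measures of the children add up to the measure of the trace, which leaves no
mass for overlaps. -/
theorem null_inter_child [Finite W] (hφ : G.IsCurve φ)
    (hH : ∀ w, μH[G.s] (trace G φ w) = ENNReal.ofReal (G.len w)) (w : W) {k l : Fin (G.cnt w)}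
    (hkl : k ≠ l) : μH[G.s] (G.map (G.lab w k) '' trace G φ (G.nxt w k) ∩
      G.map (G.lab w l) '' trace G φ (G.nxt w l)) = 0 := by
  refine measure_inter_eq_zero_of_sum_le
    (A := fun k : Fin (G.cnt w) => G.map (G.lab w k) '' trace G φ (G.nxt w k))
    (fun k => (hφ.isCompact_child w k).measurableSet) (fun k => ?_) ?_ hkl
  · rw [hausdorffMeasure_child, hH]
    exact ENNReal.mul_ne_top ENNReal.ofReal_ne_top ENNReal.ofReal_ne_top
  · have : (⋃ k : Fin (G.cnt w), G.map (G.lab w k) '' trace G φ (G.nxt w k)) = trace G φ w :=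
      (hφ.image_eq w).symm
    rw [this, hH]
    simp only [hausdorffMeasure_child, hH]
    rw [Fin.sum_univ_eq_sum_range (fun k => ENNReal.ofReal (G.scale w k) *
      ENNReal.ofReal (G.len (G.nxt w k))), ← breakpoint_cnt, breakpoint,
      ENNReal.ofReal_sum_of_nonneg fun k _ => (mul_pos (G.scale_pos w k) (G.len_pos _)).le]
    exact (Finset.sum_congr rfl fun k _ => ENNReal.ofReal_mul (G.scale_pos w k).le).ge

theorem hausdorffMeasure_isSelfSimilar [Finite W] (hφ : G.IsCurve φ)
    (hH : ∀ w, μH[G.s] (trace G φ w) = ENNReal.ofReal (G.len w)) :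
    G.IsSelfSimilar fun w => μH[G.s].restrict (trace G φ w) := by
  intro w B hB
  simp only [Measure.restrict_apply hB]
  have h1 : B ∩ trace G φ w =
      ⋃ k : Fin (G.cnt w), B ∩ G.map (G.lab w k) '' trace G φ (G.nxt w k) := by
    rw [← inter_iUnion]
    exact congrArg _ (hφ.image_eq w)
  rw [h1, measure_iUnion₀, tsum_fintype]
  · rw [← Fin.sum_univ_eq_sum_range (fun k => ENNReal.ofReal (G.scale w k) *
      (μH[G.s].restrict (trace G φ (G.nxt w k))) (G.map (G.lab w k) ⁻¹' B))]
    refine Finset.sum_congr rfl fun k _ => ?_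
    rw [Measure.restrict_apply (G.measurable_map _ hB), ← hausdorffMeasure_child,
      image_preimage_inter]
  · intro k l hkl
    exact measure_mono_null (inter_subset_inter inter_subset_right inter_subset_right)
      (hφ.null_inter_child hH w hkl)
  · exact fun k => (hB.inter (hφ.isCompact_child w k).measurableSet).nullMeasurableSet

/-- Both families are self-similar, carried by the traces and of equal total mass. They agree on
closed sets by the comparison in both directions, and closed sets form a generating π-system. -/
theorem imageMeasure_eq [Finite W] (hφ : G.IsCurve φ)
    (hH : ∀ w, μH[G.s] (trace G φ w) = ENNReal.ofReal (G.len w)) (w : W) :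
    imageMeasure G φ w = μH[G.s].restrict (trace G φ w) := by
  have hm : ∀ w, MeasurableSet (trace G φ w) := fun w => (hφ.isCompact_image w).measurableSet
  have h1 : ∀ w, imageMeasure G φ w univ = ENNReal.ofReal (G.len w) := fun w => by
    rw [hφ.imageMeasure_apply w MeasurableSet.univ]; simp
  have h2 : ∀ w, (μH[G.s].restrict (trace G φ w)) univ = ENNReal.ofReal (G.len w) := fun w => by
    rw [Measure.restrict_apply_univ, hH]
  have : ∀ w, IsFiniteMeasure (imageMeasure G φ w) := fun w =>
    ⟨by rw [h1]; exact ENNReal.ofReal_lt_top⟩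
  have : ∀ w, IsFiniteMeasure (μH[G.s].restrict (trace G φ w)) := fun w =>
    ⟨by rw [h2]; exact ENNReal.ofReal_lt_top⟩
  have h3 : ∀ w, imageMeasure G φ w (trace G φ w)ᶜ = 0 := fun w => by
    rw [hφ.imageMeasure_apply w (hm w).compl]
    have : φ w ⁻¹' (trace G φ w)ᶜ ∩ Ioc 0 (G.len w) = ∅ := by
      ext x
      simp only [mem_inter_iff, mem_preimage, mem_compl_iff, mem_empty_iff_false, iff_false]
      exact fun h => h.1 ⟨x, Ioc_subset_Icc_self h.2, rfl⟩
    rw [this, measure_empty]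
  have h4 : ∀ w, (μH[G.s].restrict (trace G φ w)) (trace G φ w)ᶜ = 0 := fun w => by
    rw [Measure.restrict_apply (hm w).compl, compl_inter_self, measure_empty]
  obtain ⟨D, hD⟩ := hφ.bounded
  have hD' : ∀ w, ∀ x ∈ trace G φ w, ∀ y ∈ trace G φ w, dist x y < D + 1 := by
    rintro w _ ⟨x, -, rfl⟩ _ ⟨y, -, rfl⟩
    linarith [hD w x w y]
  have hS1 := hφ.imageMeasure_isSelfSimilar
  have hS2 := hφ.hausdorffMeasure_isSelfSimilar hH
  refine ext_of_generate_finite {s | IsClosed s}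
    (BorelSpace.measurable_eq.trans borel_eq_generateFrom_isClosed) isPiSystem_isClosed
    (fun B hB => le_antisymm ?_ ?_) (by rw [h1, h2])
  · exact hS2.le_of_isClosed hS1 (trace G φ) h4 h3 (fun w => by rw [h1, h2]) hD' w hB
  · exact hS1.le_of_isClosed hS2 (trace G φ) h3 h4 (fun w => by rw [h1, h2]) hD' w hB

theorem multiplePoints_null [Finite W] (hφ : G.IsCurve φ)
    (hH : ∀ w, μH[G.s] (trace G φ w) = ENNReal.ofReal (G.len w)) (n : ℕ) (w : W) :
    μH[G.s] (multiplePoints G φ n w) = 0 := by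
  induction n generalizing w with
  | zero =>
    simp only [multiplePoints, measure_iUnion_null_iff]
    exact fun k l hkl => hφ.null_inter_child hH w hkl
  | succ n ih =>
    simp only [multiplePoints, measure_iUnion_null_iff]
    intro k
    rw [hausdorffMeasure_child, ih, mul_zero]

/-- If the traces have Hausdorff measure equal to the lengths, the curves are optimal
parameterizations after normalization. -/
theorem isOptimalParameterization [Finite W] (hφ : G.IsCurve φ)
    (hH : ∀ w, μH[G.s] (trace G φ w) = ENNReal.ofReal (G.len w)) {s : ℝ≥0} (hs : (s : ℝ) = G.s)
    (w : W) : IsOptimalParameterization s (trace G φ w) fun t => φ w (G.len w * t) := by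
  have hc := G.len_pos w
  have hc0 : ENNReal.ofReal (G.len w) ≠ 0 := (ENNReal.ofReal_pos.2 hc).ne'
  have hIcc : ∀ t, G.len w * t ∈ Icc 0 (G.len w) ↔ t ∈ Icc (0 : ℝ) 1 := fun t => by
    simp only [mem_Icc, mul_nonneg_iff_of_pos_left hc]
    rw [mul_le_iff_le_one_right hc]
  have hnorm : (fun t => φ w (G.len w * t)) '' Icc 0 1 = trace G φ w := by
    ext p
    constructor
    · rintro ⟨t, ht, rfl⟩
      exact ⟨_, (hIcc t).2 ht, rfl⟩
    · rintro ⟨x, hx, rfl⟩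
      have hx' : G.len w * (x / G.len w) = x := mul_div_cancel₀ _ hc.ne'
      exact ⟨x / G.len w, (hIcc _).1 (by rwa [hx']), by simp only [hx']⟩
  have hpre : ∀ B, MeasurableSet B → volume (Icc 0 1 ∩ (fun t => φ w (G.len w * t)) ⁻¹' B) =
      (μH[G.s] (trace G φ w))⁻¹ * μH[G.s] (B ∩ trace G φ w) := by
    intro B hB
    have e1 : μH[G.s] (B ∩ trace G φ w) = volume (φ w ⁻¹' B ∩ Icc 0 (G.len w)) := by
      rw [← Measure.restrict_apply hB, ← hφ.imageMeasure_eq hH, imageMeasure,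
        Measure.map_apply_of_aemeasurable (hφ.aemeasurable w) hB,
        Measure.restrict_apply' measurableSet_Icc]
    rw [e1, hH, volume_eq_mul_preimage (b := 0) hc (φ w ⁻¹' B ∩ Icc 0 (G.len w)),
      ENNReal.inv_mul_cancel_left hc0 ENNReal.ofReal_ne_top]
    congr 1
    ext t
    simp only [mem_inter_iff, mem_preimage, zero_add, hIcc, and_comm]
  -- A measurable null hull of the multiple points; outside `Z` the map is injective.
  set Z := toMeasurable μH[G.s] (⋃ n, multiplePoints G φ n w) with hZ
  have hZm : MeasurableSet Z := measurableSet_toMeasurable _ _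
  have hZ0 : μH[G.s] Z = 0 := by
    rw [hZ, measure_toMeasurable, measure_iUnion_null_iff]
    exact fun n => hφ.multiplePoints_null hH n w
  set ψ : ℝ → X := fun t => φ w (G.len w * t) with hψ
  have hψc : ContinuousOn ψ (Icc 0 1) := (hφ.continuousOn w).comp (by fun_prop)
    fun t ht => (hIcc t).2 ht
  have huniq : ∀ x ∈ Icc (0 : ℝ) 1, ∀ y ∈ Icc (0 : ℝ) 1, ψ x = ψ y → ψ x ∉ Z → x = y := by
    intro x hx y hy hxy hxZ
    by_contra hne
    refine hxZ (subset_toMeasurable _ _ (hφ.mem_multiplePoints ((hIcc x).2 hx) ((hIcc y).2 hy)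
      (fun h => hne (mul_left_cancel₀ hc.ne' h)) hxy))
  have hpreZ : volume (Icc 0 1 ∩ ψ ⁻¹' Z) = 0 := by
    rw [hpre Z hZm, measure_mono_null inter_subset_left hZ0, mul_zero]
  have hpos : 0 < μH[G.s] (trace G φ w) := by rw [hH]; exact ENNReal.ofReal_pos.2 hc
  have htop : μH[G.s] (trace G φ w) < ∞ := by rw [hH]; exact ENNReal.ofReal_lt_top
  refine ⟨NNReal.coe_pos.1 (hs ▸ G.s_pos), hs ▸ hpos, hs ▸ htop, hnorm, ?_, ?_, ?_, ?_⟩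
  · refine ⟨Icc 0 1 \ ψ ⁻¹' Z, sdiff_subset, trace G φ w \ Z, sdiff_subset, ?_, ?_, ?_, ?_, ?_⟩
    · rw [sdiff_sdiff_right_self]
      exact hpreZ
    · rw [sdiff_sdiff_right_self, hs]
      exact measure_mono_null inter_subset_right hZ0
    · exact fun t ht => ⟨hnorm ▸ mem_image_of_mem ψ ht.1, ht.2⟩
    · exact fun x hx y hy hxy => huniq x hx.1 y hy.1 hxy hx.2
    · rintro p ⟨hp, hpZ⟩
      rw [← hnorm] at hp
      obtain ⟨t, ht, rfl⟩ := hp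
      exact ⟨t, ⟨ht, hpZ⟩, rfl⟩
  · intro F hF hFm
    rw [hs]
    have hI'm : MeasurableSet (Icc 0 1 ∩ ψ ⁻¹' Z) := by
      have := (continuousOn_iff_continuous_domRestrict.1 hψc).measurable hZm
      rw [← Subtype.image_preimage_coe]
      exact measurableSet_Icc.subtype_image this
    set F' := F \ (Icc 0 1 ∩ ψ ⁻¹' Z) with hF'
    have hF'm : MeasurableSet F' := hFm.diff hI'm
    have hF'sub : F' ⊆ Icc 0 1 := sdiff_subset.trans hF
    have hF'Z : ∀ x ∈ F', ψ x ∉ Z := fun x hx hxZ => hx.2 ⟨hF hx.1, hxZ⟩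
    -- An injective continuous image of a Borel set is Borel (Lusin–Souslin); this is why preimages
    -- of `Z` were removed from `F`.
    have himgm : MeasurableSet (ψ '' F') :=
      hF'm.image_of_continuousOn_injOn (hψc.mono hF'sub) fun x hx y hy hxy =>
        huniq x (hF'sub hx) y (hF'sub hy) hxy (hF'Z x hx)
    have hback : Icc 0 1 ∩ ψ ⁻¹' (ψ '' F') = F' := by
      ext x
      constructor
      · rintro ⟨hx, y, hy, hxy⟩
        have := huniq y (hF'sub hy) x hx hxy (hF'Z y hy)
        exact this ▸ hy
      · exact fun hx => ⟨hF'sub hx, mem_image_of_mem ψ hx⟩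
    have hvol : volume F' = volume F :=
      measure_sdiff_null hpreZ
    have hsubtr : ψ '' F' ⊆ trace G φ w := hnorm ▸ image_mono hF'sub
    have h1 := hpre _ himgm
    rw [hback, hvol, inter_eq_left.2 hsubtr] at h1
    have h2 : μH[G.s] (ψ '' F) = μH[G.s] (ψ '' F') := by
      refine le_antisymm ?_ (measure_mono (image_mono sdiff_subset))
      calc μH[G.s] (ψ '' F) ≤ μH[G.s] (ψ '' F' ∪ Z) := by
            refine measure_mono ?_
            rintro _ ⟨x, hx, rfl⟩
            by_cases hxZ : ψ x ∈ Z
            · exact Or.inr hxZ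
            · exact Or.inl ⟨x, ⟨hx, fun h => hxZ h.2⟩, rfl⟩
        _ ≤ μH[G.s] (ψ '' F') + μH[G.s] Z := measure_union_le _ _
        _ = _ := by rw [hZ0, add_zero]
    rw [h2, h1, ENNReal.mul_inv_cancel_left hpos.ne' htop.ne]
  · intro B hB hBm
    rw [hs, hpre B hBm, inter_eq_left.2 hB]
  · obtain ⟨C, hC0, hC⟩ := hφ.exists_dist_le
    refine ⟨(C * G.len w ^ (1 / G.s)).toNNReal, fun x hx y hy => ?_⟩
    have hreal : ∀ x ∈ Icc (0 : ℝ) 1, ∀ y ∈ Icc (0 : ℝ) 1, x ≤ y →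
        dist (ψ x) (ψ y) ≤ C * G.len w ^ (1 / G.s) * dist x y ^ (1 / G.s) := by
      intro x hx y hy hxy
      have := hC w (G.len w * x) (G.len w * y) ((hIcc x).2 hx).1
        (mul_le_mul_of_nonneg_left hxy hc.le) ((hIcc y).2 hy).2
      rw [← mul_sub, Real.mul_rpow hc.le (sub_nonneg.2 hxy), ← mul_assoc] at this
      rwa [dist_comm x y, Real.dist_eq, abs_of_nonneg (sub_nonneg.2 hxy)]
    have hboth : dist (ψ x) (ψ y) ≤ C * G.len w ^ (1 / G.s) * dist x y ^ (1 / G.s) := by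
      rcases le_total x y with h | h
      · exact hreal x hx y hy h
      · rw [dist_comm, dist_comm x y]; exact hreal y hy x hx h
    have hCc : 0 ≤ C * G.len w ^ (1 / G.s) := mul_nonneg hC0 (Real.rpow_nonneg hc.le _)
    have hs0 : (0 : ℝ) ≤ 1 / G.s := one_div_nonneg.2 G.s_pos.le
    rw [edist_dist, edist_dist]
    have hexp : (((1 / s : ℝ≥0)) : ℝ) = 1 / G.s := by
      rw [NNReal.coe_div, NNReal.coe_one, hs]
    rw [hexp, ENNReal.ofReal_rpow_of_nonneg dist_nonneg hs0]
    change _ ≤ ENNReal.ofReal _ * _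
    rw [← ENNReal.ofReal_mul hCc]
    exact ENNReal.ofReal_le_ofReal hboth

end Hausdorff

end IsCurve

end OrderedSubdivision

/-! ### Walks -/

section Walks

variable {ε V : Type} {src tgt : ε → V}

theorem IsWalk.append {x y z : V} {p q : List ε} (hp : IsWalk src tgt x p y)
    (hq : IsWalk src tgt y q z) : IsWalk src tgt x (p ++ q) z := by
  induction p generalizing x with
  | nil => obtain rfl : x = y := hp; exact hq
  | cons e p ih => exact ⟨hp.1, ih hp.2⟩

theorem IsWalk.reverse_map {rev : ε → ε} (hsrc : ∀ e, src (rev e) = tgt e)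
    (htgt : ∀ e, tgt (rev e) = src e) {x y : V} {p : List ε} (hp : IsWalk src tgt x p y) :
    IsWalk src tgt y (p.reverse.map rev) x := by
  induction p generalizing x with
  | nil => obtain rfl : x = y := hp; rfl
  | cons e p ih =>
    rw [List.reverse_cons, List.map_append]
    exact (ih hp.2).append ⟨hsrc e, (htgt e).trans hp.1⟩

theorem IsWalk.map {δ : Type} {src' tgt' : δ → V} (f : ε → δ) (hsrc : ∀ e, src' (f e) = src e)
    (htgt : ∀ e, tgt' (f e) = tgt e) {x y : V} {p : List ε} (hp : IsWalk src tgt x p y) :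
    IsWalk src' tgt' x (p.map f) y := by
  induction p generalizing x with
  | nil => exact hp
  | cons e p ih => exact ⟨(hsrc e).trans hp.1, by rw [htgt]; exact ih hp.2⟩

theorem IsWalk.link {x y : V} {p : List ε} (hp : IsWalk src tgt x p y) {k : ℕ}
    (hk : k + 1 < p.length) : tgt p[k] = src p[k + 1] := by
  induction p generalizing x k with
  | nil => simp at hk
  | cons e p ih =>
    cases p with
    | nil => simp at hk
    | cons f p =>
      cases k with
      | zero => exact hp.2.1.symm
      | succ k => exact ih hp.2 (by simpa using hk)

theorem IsWalk.src_head {x y : V} {p : List ε} (hp : IsWalk src tgt x p y) (h : 0 < p.length) :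
    src p[0] = x := by
  cases p with
  | nil => simp at h
  | cons e p => exact hp.1

theorem IsWalk.tgt_last {x y : V} {p : List ε} (hp : IsWalk src tgt x p y) {k : ℕ}
    (hk : k + 1 = p.length) : tgt (p[k]'(by omega)) = y := by
  induction p generalizing x k with
  | nil => simp at hk
  | cons e p ih =>
    cases k with
    | zero =>
      obtain rfl : p = [] := List.length_eq_zero_iff.1 (by simpa using hk.symm)
      exact hp.2
    | succ k => exact ih hp.2 (by simpa using hk)

end Walks

/-! ### The fine substitution -/

section Substitution

variable {N m : ℕ} {Q : Fin m → List (CopyEdge N m)}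

@[simp] theorem OEdge.rev_rev (v : OEdge m) : v.rev.rev = v := by simp [OEdge.rev]

theorem mem_fineRule {v : OEdge m} {e : CopyEdge N m} :
    e ∈ fineRule Q v ↔ (e.1, (e.2.1, e.2.2 * v.2)) ∈ Q v.1 := by
  obtain ⟨j, ε⟩ := v
  obtain ⟨i, l, η⟩ := e
  rcases Int.units_eq_one_or ε with rfl | rfl
  · simp [fineRule]
  · have h1 : (-1 : ℤˣ) ≠ 1 := by decide
    simp only [fineRule, h1, if_false, List.mem_map, List.mem_reverse, mul_neg, mul_one]
    constructor
    · rintro ⟨⟨i', l', η'⟩, h, heq⟩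
      simp only [OEdge.rev, Prod.mk.injEq] at heq
      obtain ⟨rfl, rfl, rfl⟩ := heq
      simpa using h
    · intro h
      exact ⟨_, h, by simp [OEdge.rev]⟩

theorem mem_fineRule_rev {v : OEdge m} {e : CopyEdge N m} :
    e ∈ fineRule Q v.rev ↔ (e.1, e.2.rev) ∈ fineRule Q v := by
  rw [mem_fineRule, mem_fineRule]
  simp [OEdge.rev]

theorem nodup_fineRule (hQ : ∀ j, (Q j).Nodup) (v : OEdge m) : (fineRule Q v).Nodup := by
  unfold fineRule
  split_ifs
  · exact hQ _
  · refine (List.nodup_reverse.2 (hQ _)).map fun e f h => ?_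
    obtain ⟨h1, h2⟩ := Prod.ext_iff.1 h
    refine Prod.ext h1 ?_
    have := congrArg OEdge.rev h2
    simpa using this

theorem length_fineRule (v : OEdge m) : (fineRule Q v).length = (Q v.1).length := by
  unfold fineRule
  split_ifs <;> simp

theorem mem_fineIter_succ {u : OEdge m} {n : ℕ} {w : List (Fin N) × OEdge m} :
    w ∈ fineIter Q u (n + 1) ↔
      ∃ w' ∈ fineIter Q u n, ∃ e ∈ fineRule Q w'.2, w = (w'.1 ++ [e.1], e.2) := by
  simp only [fineIter, List.mem_flatMap, List.mem_map, eq_comm]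

/-- `fineIter` adds letters at the end of words, while `wordMap` applies the first letter outermost.
This form unrolls from the front, as inductions on the contractions require. -/
theorem mem_fineIter_succ' {u : OEdge m} {n : ℕ} {w : List (Fin N) × OEdge m} :
    w ∈ fineIter Q u (n + 1) ↔
      ∃ e ∈ fineRule Q u, ∃ w' ∈ fineIter Q e.2 n, w = (e.1 :: w'.1, w'.2) := by
  induction n generalizing w with
  | zero => rw [mem_fineIter_succ]; simp [fineIter]
  | succ n ih =>
    rw [mem_fineIter_succ]
    constructor
    · rintro ⟨w', hw', f, hf, rfl⟩
      obtain ⟨e, he, w'', hw'', rfl⟩ := ih.1 hw'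
      exact ⟨e, he, (w''.1 ++ [f.1], f.2), mem_fineIter_succ.2 ⟨w'', hw'', f, hf, rfl⟩, rfl⟩
    · rintro ⟨e, he, w', hw', rfl⟩
      obtain ⟨w'', hw'', f, hf, rfl⟩ := mem_fineIter_succ.1 hw'
      exact ⟨(e.1 :: w''.1, w''.2), ih.2 ⟨e, he, w'', hw'', rfl⟩, f, hf, rfl⟩

/-- Every edge `S_i(v_l^{β_i})` lies on exactly one of the paths `Q_j`, and exactly once. -/
structure IsEdgePartition (β : Fin N → ℤˣ) (Q : Fin m → List (CopyEdge N m)) : Prop where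
  orientation : ∀ j, ∀ e ∈ Q j, e.2.2 = β e.1
  cover : ∀ i l, ∃ j, (i, (l, β i)) ∈ Q j
  disjoint : ∀ j j', j ≠ j' → List.Disjoint (Q j) (Q j')
  nodup : ∀ j, (Q j).Nodup

/-- If `S_i(x)` lies on `τ(v)` and `S_i(x')` on `τ(v')` for different `v`, `v'` (up to orientation),
then `x` and `x'` are different up to orientation. -/
theorem IsEdgePartition.fst_ne {β : Fin N → ℤˣ} (hQ : IsEdgePartition β Q) {v v' : OEdge m}
    (hne : v.1 ≠ v'.1) {i : Fin N} {x x' : OEdge m} (hx : (i, x) ∈ fineRule Q v)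
    (hx' : (i, x') ∈ fineRule Q v') : x.1 ≠ x'.1 := by
  intro h
  rw [mem_fineRule] at hx hx'
  have h1 := hQ.orientation _ _ hx
  have h2 := hQ.orientation _ _ hx'
  simp only at h1 h2
  rw [h1] at hx
  rw [h2, ← h] at hx'
  exact hQ.disjoint _ _ hne hx hx'

/-- Different edges of `τ(v)` which are copies under the same map differ not only in
orientation. -/
theorem IsEdgePartition.fst_ne_of_ne {β : Fin N → ℤˣ} (hQ : IsEdgePartition β Q) {v : OEdge m}
    {i : Fin N} {x x' : OEdge m} (hx : (i, x) ∈ fineRule Q v) (hx' : (i, x') ∈ fineRule Q v)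
    (hne : x ≠ x') : x.1 ≠ x'.1 := by
  intro h
  rw [mem_fineRule] at hx hx'
  have h1 := hQ.orientation _ _ hx
  have h2 := hQ.orientation _ _ hx'
  simp only at h1 h2
  exact hne (Prod.ext h (mul_right_cancel (h1.trans h2.symm)))

/-- An empty rule for `j` erases `[j]` in the first step, and nothing reappears afterwards. Since
the exponent is at least one, `j` could not occur in its own iterate. -/
theorem IsPrimitivePartition.ne_nil (hQ : IsPrimitivePartition Q) (j : Fin m) : Q j ≠ [] := by
  obtain ⟨n, hn, h⟩ := hQ
  intro hj
  obtain ⟨k, rfl⟩ := Nat.exists_eq_add_of_le' hn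
  have := h j j
  rw [Function.iterate_add_apply, Function.iterate_one] at this
  have hz : ∀ k : ℕ, (fun w : List (Fin m) => w.flatMap (coarseRule Q))^[k] [] = [] := by
    intro k
    induction k with
    | zero => rfl
    | succ k ih => rw [Function.iterate_succ_apply]; exact ih
  simp only [List.flatMap_cons, List.flatMap_nil, List.append_nil, coarseRule, hj,
    List.map_nil] at this
  change j ∈ (fun w : List (Fin m) => w.flatMap (coarseRule Q))^[k] [] at this
  rw [hz] at this
  simp at this

theorem fineRule_length_pos (hQ : ∀ j, Q j ≠ []) (v : OEdge m) : 0 < (fineRule Q v).length := by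
  rw [length_fineRule]
  exact List.length_pos_iff.2 (hQ _)

/-- A property of letters which is inherited from the letters of the image is inherited along
iterates of the coarse substitution. -/
theorem coarse_iterate_induction (p : Fin m → Prop)
    (h : ∀ j, ∀ e ∈ Q j, p e.2.1 → p j) (n : ℕ) (w : List (Fin m)) {u : Fin m}
    (hu : u ∈ (fun w : List (Fin m) => w.flatMap (coarseRule Q))^[n] w) (hp : p u) :
    ∃ v ∈ w, p v := by
  induction n generalizing w with
  | zero => exact ⟨u, hu, hp⟩
  | succ n ih =>
    rw [Function.iterate_succ_apply] at hu
    obtain ⟨v, hv, hpv⟩ := ih _ hu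
    obtain ⟨j, hj, hvj⟩ := List.mem_flatMap.1 hv
    obtain ⟨e, he, rfl⟩ := List.mem_map.1 hvj
    exact ⟨j, hj, h j e he hpv⟩

variable [NeZero m]

@[simp] theorem OEdge.src_rev {X : Type} (a : Fin m → X) (v : OEdge m) :
    OEdge.src a v.rev = OEdge.tgt a v := by
  obtain ⟨j, ε⟩ := v
  rcases Int.units_eq_one_or ε with rfl | rfl <;> simp [OEdge.src, OEdge.tgt, OEdge.rev]

@[simp] theorem OEdge.tgt_rev {X : Type} (a : Fin m → X) (v : OEdge m) :
    OEdge.tgt a v.rev = OEdge.src a v := by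
  rw [← OEdge.src_rev, OEdge.rev_rev]

theorem isWalk_fineRule {X : Type} {S : Fin N → X → X} {a : Fin m → X}
    (hcons : IsConsistent S a Q) (v : OEdge m) :
    IsWalk (CopyEdge.src S a) (CopyEdge.tgt S a) (OEdge.src a v) (fineRule Q v)
      (OEdge.tgt a v) := by
  obtain ⟨j, ε⟩ := v
  rcases Int.units_eq_one_or ε with rfl | rfl
  · simpa [fineRule, OEdge.src, OEdge.tgt] using hcons j
  · have h1 : (-1 : ℤˣ) ≠ 1 := by decide
    have := (hcons j).reverse_map (rev := fun e => (e.1, e.2.rev))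
      (by intro e; simp [CopyEdge.src, CopyEdge.tgt]) (by intro e; simp [CopyEdge.src, CopyEdge.tgt])
    simpa [fineRule, OEdge.src, OEdge.tgt, h1] using this

theorem IsUnicursal.isEdgePartition {X : Type} {S : Fin N → X → X} {a : Fin m → X}
    {β : Fin N → ℤˣ} {P : List (CopyEdge N m)} (hP : IsUnicursal S a β P)
    (hQ : IsPathPartition P Q) : IsEdgePartition β Q := by
  have hmem : ∀ e, e ∈ P ↔ ∃ j, e ∈ Q j := by
    intro e
    rw [hQ.1]
    simp [List.mem_flatten, List.mem_ofFn']
  refine ⟨fun j e he => (hP.2.2 e).1 ((hmem e).2 ⟨j, he⟩), fun i l => ?_, hQ.2, fun j => ?_⟩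
  · exact (hmem _).1 ((hP.2.2 _).2 rfl)
  · have := hP.2.1
    rw [hQ.1, List.nodup_flatten] at this
    exact this.1 _ (by simp [List.mem_ofFn'])

end Substitution

/-! ### Existence of invariant families -/

theorem exists_compact_family {X : Type*} [MetricSpace X] [CompleteSpace X] [Nonempty X] {N : ℕ}
    {S : Fin N → X → X} {r : Fin N → ℝ} (hr0 : ∀ i, 0 < r i) (hr1 : ∀ i, r i < 1)
    (hS : ∀ i x y, dist (S i x) (S i y) = r i * dist x y) {V C : Type*} [Finite C]
    (lab : C → Fin N) (nxt : C → V) (rule : V → Set C) (hne : ∀ u, (rule u).Nonempty) :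
    ∃ E : V → Set X, (∀ u, (E u).Nonempty ∧ IsCompact (E u)) ∧
      ∀ u, E u = ⋃ c ∈ rule u, S (lab c) '' E (nxt c) := by
  obtain ⟨π, hπc, hπ⟩ := exists_coding_map hr0 hr1 hS
  let _ : TopologicalSpace C := ⊥
  have : DiscreteTopology C := ⟨rfl⟩
  -- The admissible infinite sequences of choices form a closed subset of a compact product; the
  -- invariant sets are their images under the coding map.
  let Z : V → Set (ℕ → C) := fun u => {z | z 0 ∈ rule u ∧ ∀ n, z (n + 1) ∈ rule (nxt (z n))}
  have hZc : ∀ u, IsCompact (Z u) := by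
    intro u
    refine IsClosed.isCompact ?_
    have h1 : IsClosed {z : ℕ → C | z 0 ∈ rule u} :=
      (isClosed_discrete (rule u)).preimage (continuous_apply 0)
    have h2 : ∀ n, IsClosed {z : ℕ → C | z (n + 1) ∈ rule (nxt (z n))} := fun n =>
      (isClosed_discrete {p : C × C | p.2 ∈ rule (nxt p.1)}).preimage
        (f := fun z : ℕ → C => (z n, z (n + 1)))
        ((continuous_apply n).prodMk (continuous_apply (n + 1)))
    have : Z u = {z | z 0 ∈ rule u} ∩ ⋂ n, {z | z (n + 1) ∈ rule (nxt (z n))} := by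
      ext z; simp [Z]
    rw [this]
    exact h1.inter (isClosed_iInter h2)
  have hcont : Continuous fun z : ℕ → C => π fun n => lab (z n) :=
    hπc.comp (continuous_pi fun n => continuous_of_discreteTopology.comp (continuous_apply n))
  refine ⟨fun u => (fun z : ℕ → C => π fun n => lab (z n)) '' Z u,
    fun u => ⟨Nonempty.image _ ?_, (hZc u).image hcont⟩, fun u => ?_⟩
  · choose c hc using hne
    exact ⟨fun n => c ((fun v => nxt (c v))^[n] u), hc u, fun n => by
      simp only [Function.iterate_succ_apply']; exact hc _⟩
  · ext x
    simp only [mem_iUnion]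
    constructor
    · rintro ⟨z, hz, rfl⟩
      exact ⟨z 0, hz.1, _, ⟨fun n => z (n + 1), ⟨hz.2 0, fun n => hz.2 (n + 1)⟩, rfl⟩,
        (hπ fun n => lab (z n)).symm⟩
    · rintro ⟨c, hc, _, ⟨z, hz, rfl⟩, rfl⟩
      refine ⟨fun n => Nat.casesOn n c z, ⟨hc, fun n => ?_⟩, ?_⟩
      · cases n with
        | zero => exact hz.1
        | succ n => exact hz.2 n
      · exact hπ _

/-! ### The induced graph-directed system -/

namespace OrderedGIFS

variable {X : Type} [MetricSpace X] {V : Type} {G : OrderedGIFS X V}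

theorem cons_mem_paths_iff {u : V} {k : ℕ} {e : G.Bridge} {p : List G.Bridge} :
    e :: p ∈ G.paths u (k + 1) ↔ G.init e = u ∧ p ∈ G.paths (G.term e) k := by
  constructor
  · rintro ⟨hl, v, hi, hv⟩
    exact ⟨hi, by simpa using hl, v, hv⟩
  · rintro ⟨hi, hl, v, hv⟩
    exact ⟨by simp [hl], v, hi, hv⟩

theorem exists_cons_of_mem_paths {u : V} {k : ℕ} {p : List G.Bridge} (hp : p ∈ G.paths u (k + 1)) :
    ∃ e q, p = e :: q := by
  cases p with
  | nil => exact absurd hp.1 (by simp)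
  | cons e q => exact ⟨e, q, rfl⟩

theorem dictLT_cons_iff {e f : G.Bridge} {p q : List G.Bridge} :
    G.dictLT (e :: p) (f :: q) ↔ G.order.lt e f ∨ e = f ∧ G.dictLT p q := by
  constructor
  · intro h
    cases h with
    | cons h => exact Or.inr ⟨rfl, h⟩
    | rel h => exact Or.inl h
  · rintro (h | ⟨rfl, h⟩)
    · exact List.Lex.rel h
    · exact List.Lex.cons h

end OrderedGIFS

/-! ### Families invariant under the fine substitution -/

section Induced

variable {X : Type} [MetricSpace X] {N m : ℕ} {S : Fin N → X → X}
  {Q : Fin m → List (CopyEdge N m)}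

/-- `E` is a family of non-empty compact sets invariant under the fine substitution. -/
structure IsSubstitutionFamily (S : Fin N → X → X) (Q : Fin m → List (CopyEdge N m))
    (E : OEdge m → Set X) : Prop where
  nonempty : ∀ u, (E u).Nonempty
  isCompact : ∀ u, IsCompact (E u)
  mem_iff : ∀ u x, x ∈ E u ↔ ∃ e ∈ fineRule Q u, ∃ y ∈ E e.2, S e.1 y = x

theorem isInvariantFamily_iff (hS : ∀ i, IsContractingSimilitude (S i)) (E : OEdge m → Set X) :
    (inducedGIFS S hS Q).IsInvariantFamily E ↔ IsSubstitutionFamily S Q E := by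
  have key : ∀ u x, (x ∈ ⋃ e : {e : (inducedGIFS S hS Q).Bridge // (inducedGIFS S hS Q).init e = u},
      (inducedGIFS S hS Q).map e '' E ((inducedGIFS S hS Q).term e)) ↔
      ∃ e ∈ fineRule Q u, ∃ y ∈ E e.2, S e.1 y = x := by
    intro u x
    simp only [mem_iUnion]
    constructor
    · rintro ⟨⟨⟨v, k⟩, hv⟩, y, hy, rfl⟩
      obtain rfl : v = u := hv
      exact ⟨(fineRule Q v).get k, List.get_mem _ _, y, hy, rfl⟩
    · rintro ⟨e, he, y, hy, rfl⟩
      obtain ⟨k, rfl⟩ := List.get_of_mem he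
      exact ⟨⟨⟨u, k⟩, rfl⟩, y, hy, rfl⟩
  constructor
  · rintro ⟨h1, h2⟩
    refine ⟨fun u => (h1 u).1, fun u => (h1 u).2, fun u x => ?_⟩
    conv_lhs => rw [h2 u]
    exact key u x
  · rintro ⟨h1, h2, h3⟩
    exact ⟨fun u => ⟨h1 u, h2 u⟩, fun u => Set.ext fun x => (h3 u x).trans (key u x).symm⟩

variable {r : Fin N → ℝ}

theorem exists_isSubstitutionFamily [CompleteSpace X] [Nonempty X] (hr0 : ∀ i, 0 < r i)
    (hr1 : ∀ i, r i < 1) (hr : ∀ i x y, dist (S i x) (S i y) = r i * dist x y)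
    (hQ : ∀ j, Q j ≠ []) : ∃ E, IsSubstitutionFamily S Q E := by
  obtain ⟨E, h1, h2⟩ := exists_compact_family hr0 hr1 hr (V := OEdge m) (C := CopyEdge N m)
    (fun e => e.1) (fun e => e.2) (fun u => {e | e ∈ fineRule Q u})
    (fun u => List.exists_mem_of_length_pos (fineRule_length_pos hQ u))
  refine ⟨E, fun u => (h1 u).1, fun u => (h1 u).2, fun u x => ?_⟩
  conv_lhs => rw [h2 u]
  simp

namespace IsSubstitutionFamily

variable {E F : OEdge m → Set X}

/-- Comparison of a bounded family with a family invariant under the substitution. -/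
theorem subset (hr0 : ∀ i, 0 < r i) (hr1 : ∀ i, r i < 1)
    (hr : ∀ i x y, dist (S i x) (S i y) = r i * dist x y) (hF : IsSubstitutionFamily S Q F)
    (hEb : ∀ u, Bornology.IsBounded (E u))
    (hE : ∀ u, ∀ x ∈ E u, ∃ e ∈ fineRule Q u, ∃ y ∈ E e.2, S e.1 y = x) (u : OEdge m) :
    E u ⊆ F u := by
  obtain ⟨ρ, hρ0, hρ1, hρ⟩ := exists_uniform_ratio hr0 hr1
  obtain ⟨D, hD⟩ := exists_dist_bound E F hEb fun u => (hF.isCompact u).isBounded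
  refine subset_of_contracting_families S hρ0.le hρ1
    (fun i x y => (hr i x y).le.trans (mul_le_mul_of_nonneg_right (hρ i) dist_nonneg)) E F
    (fun u x hx => ?_) (fun u => (hF.isCompact u).isClosed) hF.nonempty hD u
  obtain ⟨e, he, y, hy, rfl⟩ := hE u x hx
  exact ⟨e.1, e.2, y, hy, rfl, fun z hz => (hF.mem_iff u _).2 ⟨e, he, z, hz, rfl⟩⟩

theorem unique (hr0 : ∀ i, 0 < r i) (hr1 : ∀ i, r i < 1)
    (hr : ∀ i x y, dist (S i x) (S i y) = r i * dist x y) (hE : IsSubstitutionFamily S Q E)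
    (hF : IsSubstitutionFamily S Q F) : E = F :=
  funext fun u => Subset.antisymm
    (hF.subset hr0 hr1 hr (fun u => (hE.isCompact u).isBounded) (fun u x => (hE.mem_iff u x).1) u)
    (hE.subset hr0 hr1 hr (fun u => (hF.isCompact u).isBounded) (fun u x => (hF.mem_iff u x).1) u)

/-- The invariant sets do not depend on the orientation. -/
theorem rev_eq (hr0 : ∀ i, 0 < r i) (hr1 : ∀ i, r i < 1)
    (hr : ∀ i x y, dist (S i x) (S i y) = r i * dist x y) (hE : IsSubstitutionFamily S Q E)
    (u : OEdge m) : E u.rev = E u := by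
  have : IsSubstitutionFamily S Q fun u => E u.rev := by
    refine ⟨fun u => hE.nonempty _, fun u => hE.isCompact _, fun u x => ?_⟩
    rw [hE.mem_iff]
    constructor
    · rintro ⟨e, he, y, hy, rfl⟩
      exact ⟨(e.1, e.2.rev), mem_fineRule_rev.1 he, y, by simpa using hy, rfl⟩
    · rintro ⟨e, he, y, hy, rfl⟩
      exact ⟨(e.1, e.2.rev), mem_fineRule_rev.2 (by simpa using he), y, hy, rfl⟩
  exact congrFun (this.unique hr0 hr1 hr hE) u

theorem eq_pos (hr0 : ∀ i, 0 < r i) (hr1 : ∀ i, r i < 1)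
    (hr : ∀ i x y, dist (S i x) (S i y) = r i * dist x y) (hE : IsSubstitutionFamily S Q E)
    (u : OEdge m) : E u = E (u.1, 1) := by
  obtain ⟨j, ε⟩ := u
  rcases Int.units_eq_one_or ε with rfl | rfl
  · rfl
  · exact hE.rev_eq hr0 hr1 hr (j, 1)

/-- The invariant sets of the induced system cover the invariant set of the IFS. -/
theorem iUnion_eq [NeZero m] (hr0 : ∀ i, 0 < r i) (hr1 : ∀ i, r i < 1)
    (hr : ∀ i x y, dist (S i x) (S i y) = r i * dist x y) (hE : IsSubstitutionFamily S Q E)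
    {K : Set X} (hK : IsInvariantSet S K) {β : Fin N → ℤˣ} (hQ : IsEdgePartition β Q) :
    K = ⋃ j : Fin m, E (j, 1) := by
  obtain ⟨ρ, hρ0, hρ1, hρ⟩ := exists_uniform_ratio hr0 hr1
  have hpos := hE.eq_pos hr0 hr1 hr
  refine Subset.antisymm ?_ (iUnion_subset fun j => ?_)
  · have hc : IsCompact (⋃ j : Fin m, E (j, 1)) := isCompact_iUnion fun j => hE.isCompact _
    have hn : (⋃ j : Fin m, E (j, 1)).Nonempty :=
      nonempty_iUnion.2 ⟨0, hE.nonempty _⟩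
    obtain ⟨D, hD⟩ := exists_dist_bound (V := Unit) (fun _ => K) (fun _ => ⋃ j : Fin m, E (j, 1))
      (fun _ => hK.2.1.isBounded) (fun _ => hc.isBounded)
    refine subset_of_contracting_families S hρ0.le hρ1
      (fun i x y => (hr i x y).le.trans (mul_le_mul_of_nonneg_right (hρ i) dist_nonneg))
      (V := Unit) (fun _ => K) (fun _ => ⋃ j : Fin m, E (j, 1)) (fun u x hx => ?_)
      (fun _ => hc.isClosed) (fun _ => hn) hD ()
    rw [hK.2.2] at hx
    obtain ⟨i, y, hy, rfl⟩ := mem_iUnion.1 hx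
    refine ⟨i, (), y, hy, rfl, fun z hz => ?_⟩
    obtain ⟨l, hl⟩ := mem_iUnion.1 hz
    obtain ⟨j, hj⟩ := hQ.cover i l
    refine mem_iUnion.2 ⟨j, (hE.mem_iff _ _).2 ⟨(i, (l, β i)), ?_, z, ?_, rfl⟩⟩
    · simpa [mem_fineRule] using hj
    · rw [hpos]; exact hl
  · obtain ⟨D, hD⟩ := exists_dist_bound E (fun _ => K)
      (fun u => (hE.isCompact u).isBounded) (fun _ => hK.2.1.isBounded)
    refine subset_of_contracting_families S hρ0.le hρ1
      (fun i x y => (hr i x y).le.trans (mul_le_mul_of_nonneg_right (hρ i) dist_nonneg))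
      E (fun _ => K) (fun u x hx => ?_)
      (fun _ => hK.2.1.isClosed) (fun _ => hK.1) hD _
    obtain ⟨e, he, y, hy, rfl⟩ := (hE.mem_iff u x).1 hx
    refine ⟨e.1, e.2, y, hy, rfl, fun z hz => ?_⟩
    rw [hK.2.2]
    exact mem_iUnion.2 ⟨_, z, hz, rfl⟩

theorem wordMap_mem (hE : IsSubstitutionFamily S Q E) {u : OEdge m} {n : ℕ}
    {w : List (Fin N) × OEdge m} (hw : w ∈ fineIter Q u n) {y : X} (hy : y ∈ E w.2) :
    wordMap S w.1 y ∈ E u := by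
  induction n generalizing u w with
  | zero =>
    obtain rfl : w = ([], u) := by simpa [fineIter] using hw
    exact hy
  | succ n ih =>
    obtain ⟨e, he, w', hw', rfl⟩ := mem_fineIter_succ'.1 hw
    exact (hE.mem_iff _ _).2 ⟨e, he, _, ih hw' hy, rfl⟩

section EndPoints

variable [NeZero m] {a : Fin m → X}

/-- The singletons `{OEdge.src a u}` reproduce themselves, since the first edge of `τ(u)` starts
where `u` starts; comparison with the invariant family applies. -/
theorem src_mem (hr0 : ∀ i, 0 < r i) (hr1 : ∀ i, r i < 1)
    (hr : ∀ i x y, dist (S i x) (S i y) = r i * dist x y) (hE : IsSubstitutionFamily S Q E)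
    (hcons : IsConsistent S a Q) (hne : ∀ j, Q j ≠ []) (u : OEdge m) : OEdge.src a u ∈ E u := by
  refine hE.subset hr0 hr1 hr (E := fun u => {OEdge.src a u})
    (fun _ => Bornology.isBounded_singleton) ?_ u rfl
  rintro u x rfl
  have h := fineRule_length_pos hne u
  exact ⟨_, List.getElem_mem h, _, rfl, (isWalk_fineRule hcons u).src_head h⟩

theorem tgt_mem (hr0 : ∀ i, 0 < r i) (hr1 : ∀ i, r i < 1)
    (hr : ∀ i x y, dist (S i x) (S i y) = r i * dist x y) (hE : IsSubstitutionFamily S Q E)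
    (hcons : IsConsistent S a Q) (hne : ∀ j, Q j ≠ []) (u : OEdge m) : OEdge.tgt a u ∈ E u := by
  rw [← OEdge.src_rev, ← hE.rev_eq hr0 hr1 hr]
  exact hE.src_mem hr0 hr1 hr hcons hne _

end EndPoints

end IsSubstitutionFamily

/-! #### Linearity -/

section Linear

variable (hS : ∀ i, IsContractingSimilitude (S i))

theorem inducedGIFS_lt_iff {u : OEdge m} {i j : Fin (fineRule Q u).length} :
    (inducedGIFS S hS Q).order.lt ⟨u, i⟩ ⟨u, j⟩ ↔ i < j := Sigma.mk_lt_mk_iff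

theorem inducedGIFS_paths_nonempty (hne : ∀ j, Q j ≠ []) (k : ℕ) (u : OEdge m) :
    ((inducedGIFS S hS Q).paths u k).Nonempty := by
  induction k generalizing u with
  | zero => exact ⟨[], rfl, u, rfl⟩
  | succ k ih =>
    let e : (inducedGIFS S hS Q).Bridge := ⟨u, ⟨0, fineRule_length_pos hne u⟩⟩
    obtain ⟨p, hp⟩ := ih ((inducedGIFS S hS Q).term e)
    exact ⟨e :: p, OrderedGIFS.cons_mem_paths_iff.2 ⟨rfl, hp⟩⟩

variable [NeZero m] {a : Fin m → X} {E : OEdge m → Set X}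

/-- A path maximal in the dictionary order takes the last bridge at every step, and the last edge of
`τ(u)` ends where `u` ends. -/
theorem cylinder_tgt_mem (hcons : IsConsistent S a Q) (hne : ∀ j, Q j ≠ [])
    (htgt : ∀ u, OEdge.tgt a u ∈ E u) (k : ℕ) (u : OEdge m)
    (p : List (inducedGIFS S hS Q).Bridge) (hp : p ∈ (inducedGIFS S hS Q).paths u k)
    (hmax : ∀ q ∈ (inducedGIFS S hS Q).paths u k, ¬ (inducedGIFS S hS Q).dictLT p q) :
    OEdge.tgt a u ∈ (inducedGIFS S hS Q).cylinder E u p := by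
  induction k generalizing u p with
  | zero =>
    obtain rfl := List.length_eq_zero_iff.1 hp.1
    exact htgt u
  | succ k ih =>
    obtain ⟨⟨u', i⟩, p, rfl⟩ := OrderedGIFS.exists_cons_of_mem_paths hp
    obtain ⟨hu, hp'⟩ := OrderedGIFS.cons_mem_paths_iff.1 hp
    obtain rfl : u' = u := hu
    have hlast : i.1 + 1 = (fineRule Q u').length := by
      by_contra hlt
      have hi : i.1 + 1 < (fineRule Q u').length := lt_of_le_of_ne i.2 hlt
      let f : (inducedGIFS S hS Q).Bridge := ⟨u', ⟨i.1 + 1, hi⟩⟩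
      obtain ⟨q, hq⟩ := inducedGIFS_paths_nonempty hS hne k ((inducedGIFS S hS Q).term f)
      exact hmax (f :: q) (OrderedGIFS.cons_mem_paths_iff.2 ⟨rfl, hq⟩)
        (OrderedGIFS.dictLT_cons_iff.2
          (Or.inl ((inducedGIFS_lt_iff hS).2 (Nat.lt_succ_self i.1))))
    exact ⟨OEdge.tgt a _, ih _ p hp' fun q hq hlt =>
      hmax _ (OrderedGIFS.cons_mem_paths_iff.2 ⟨rfl, hq⟩)
        (OrderedGIFS.dictLT_cons_iff.2 (Or.inr ⟨rfl, hlt⟩)),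
      (isWalk_fineRule hcons u').tgt_last hlast⟩

theorem cylinder_src_mem (hcons : IsConsistent S a Q) (hne : ∀ j, Q j ≠ [])
    (hsrc : ∀ u, OEdge.src a u ∈ E u) (k : ℕ) (u : OEdge m)
    (p : List (inducedGIFS S hS Q).Bridge) (hp : p ∈ (inducedGIFS S hS Q).paths u k)
    (hmin : ∀ q ∈ (inducedGIFS S hS Q).paths u k, ¬ (inducedGIFS S hS Q).dictLT q p) :
    OEdge.src a u ∈ (inducedGIFS S hS Q).cylinder E u p := by
  induction k generalizing u p with
  | zero =>
    obtain rfl := List.length_eq_zero_iff.1 hp.1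
    exact hsrc u
  | succ k ih =>
    obtain ⟨⟨u', i⟩, p, rfl⟩ := OrderedGIFS.exists_cons_of_mem_paths hp
    obtain ⟨hu, hp'⟩ := OrderedGIFS.cons_mem_paths_iff.1 hp
    obtain rfl : u' = u := hu
    have hpos := fineRule_length_pos hne u'
    obtain rfl : i = ⟨0, hpos⟩ := by
      by_contra hlt
      have hi : 0 < i.1 := Nat.pos_of_ne_zero fun h => hlt (Fin.ext h)
      let f : (inducedGIFS S hS Q).Bridge := ⟨u', ⟨0, hpos⟩⟩
      obtain ⟨q, hq⟩ := inducedGIFS_paths_nonempty hS hne k ((inducedGIFS S hS Q).term f)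
      exact hmin (f :: q) (OrderedGIFS.cons_mem_paths_iff.2 ⟨rfl, hq⟩)
        (OrderedGIFS.dictLT_cons_iff.2 (Or.inl ((inducedGIFS_lt_iff hS).2 hi)))
    exact ⟨OEdge.src a _, ih _ p hp' fun q hq hlt =>
      hmin _ (OrderedGIFS.cons_mem_paths_iff.2 ⟨rfl, hq⟩)
        (OrderedGIFS.dictLT_cons_iff.2 (Or.inr ⟨rfl, hlt⟩)),
      (isWalk_fineRule hcons u').src_head hpos⟩

/-- At the first place where adjacent paths differ, the two bridges are consecutive, the lower path
continues maximally and the upper one minimally. The common end point of the two consecutive edges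
therefore lies in both cylinders. -/
theorem inducedGIFS_isLinear (hr0 : ∀ i, 0 < r i) (hr1 : ∀ i, r i < 1)
    (hr : ∀ i x y, dist (S i x) (S i y) = r i * dist x y)
    (hcons : IsConsistent S a Q) (hne : ∀ j, Q j ≠ []) : (inducedGIFS S hS Q).IsLinear := by
  intro E hE u k _ p q hpq
  rw [isInvariantFamily_iff] at hE
  have hsrc := hE.src_mem hr0 hr1 hr hcons hne
  have htgt := hE.tgt_mem hr0 hr1 hr hcons hne
  clear * - hsrc htgt hcons hne hpq
  induction k generalizing u p q with
  | zero =>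
    obtain ⟨hp, hq, hlt, -⟩ := hpq
    obtain rfl := List.length_eq_zero_iff.1 hp.1
    obtain rfl := List.length_eq_zero_iff.1 hq.1
    cases hlt
  | succ k ih =>
    obtain ⟨hp, hq, hlt, hadj⟩ := hpq
    obtain ⟨⟨v, i⟩, p, rfl⟩ := OrderedGIFS.exists_cons_of_mem_paths hp
    obtain ⟨⟨v', j⟩, q, rfl⟩ := OrderedGIFS.exists_cons_of_mem_paths hq
    obtain ⟨hu, hp'⟩ := OrderedGIFS.cons_mem_paths_iff.1 hp
    obtain ⟨hu', hq'⟩ := OrderedGIFS.cons_mem_paths_iff.1 hq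
    obtain rfl : v = u := hu
    obtain rfl : v' = v := hu'
    rcases OrderedGIFS.dictLT_cons_iff.1 hlt with h | ⟨h, hlex⟩
    · have hij : i.1 < j.1 := (inducedGIFS_lt_iff hS).1 h
      have hsucc : i.1 + 1 = j.1 := by
        by_contra hne'
        have h1 : i.1 + 1 < j.1 := lt_of_le_of_ne hij hne'
        let g : (inducedGIFS S hS Q).Bridge := ⟨v', ⟨i.1 + 1, h1.trans j.2⟩⟩
        obtain ⟨c, hc⟩ := inducedGIFS_paths_nonempty hS hne k ((inducedGIFS S hS Q).term g)
        exact hadj (g :: c) (OrderedGIFS.cons_mem_paths_iff.2 ⟨rfl, hc⟩)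
          ⟨OrderedGIFS.dictLT_cons_iff.2
            (Or.inl ((inducedGIFS_lt_iff hS).2 (Nat.lt_succ_self i.1))),
          OrderedGIFS.dictLT_cons_iff.2 (Or.inl ((inducedGIFS_lt_iff hS).2 h1))⟩
      have h1 := cylinder_tgt_mem hS hcons hne htgt k _ p hp' fun c hc hlt' =>
        hadj _ (OrderedGIFS.cons_mem_paths_iff.2 ⟨rfl, hc⟩)
          ⟨OrderedGIFS.dictLT_cons_iff.2 (Or.inr ⟨rfl, hlt'⟩),
          OrderedGIFS.dictLT_cons_iff.2 (Or.inl h)⟩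
      have h2 := cylinder_src_mem hS hcons hne hsrc k _ q hq' fun c hc hlt' =>
        hadj _ (OrderedGIFS.cons_mem_paths_iff.2 ⟨rfl, hc⟩)
          ⟨OrderedGIFS.dictLT_cons_iff.2 (Or.inl h),
          OrderedGIFS.dictLT_cons_iff.2 (Or.inr ⟨rfl, hlt'⟩)⟩
      have hlink := (isWalk_fineRule hcons v').link (k := i.1) (by rw [hsucc]; exact j.2)
      refine ⟨_, ⟨_, h1, rfl⟩, _, h2, ?_⟩
      simp only [hsucc] at hlink
      exact hlink.symm
    · obtain rfl : i = j := eq_of_heq (Sigma.mk.inj_iff.1 h).2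
      obtain ⟨z, hz1, hz2⟩ := ih _ p q ⟨hp', hq', hlex, fun c hc h =>
        hadj _ (OrderedGIFS.cons_mem_paths_iff.2 ⟨rfl, hc⟩)
          ⟨OrderedGIFS.dictLT_cons_iff.2 (Or.inr ⟨rfl, h.1⟩),
          OrderedGIFS.dictLT_cons_iff.2 (Or.inr ⟨rfl, h.2⟩)⟩⟩
      exact ⟨_, ⟨z, hz1, rfl⟩, z, hz2, rfl⟩

end Linear

end Induced

/-! ### Measures of the invariant sets -/

section Measures

variable {X : Type} [MetricSpace X] {N m : ℕ}
  {S : Fin N → X → X} {Q : Fin m → List (CopyEdge N m)} {r : Fin N → ℝ} {s : ℝ}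
  {E : OEdge m → Set X} {K : Set X} {β : Fin N → ℤˣ}

theorem sum_filter_orientation {M : Type*} [AddCommMonoid M] (β : Fin N → ℤˣ)
    (f : CopyEdge N m → M) :
    ∑ e with e.2.2 = β e.1, f e = ∑ i, ∑ l, f (i, (l, β i)) := by
  rw [Finset.sum_filter, Fintype.sum_prod_type]
  refine Finset.sum_congr rfl fun i _ => ?_
  rw [Fintype.sum_prod_type]
  exact Finset.sum_congr rfl fun l _ =>
    (Finset.sum_ite_eq' Finset.univ (β i) fun ε => f (i, (l, ε))).trans
      (if_pos (Finset.mem_univ _))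

/-- Double counting: the paths together use each oriented copy once. It turns sums over the
partition into sums over the pieces of the IFS. -/
theorem IsEdgePartition.sum_toFinset {M : Type*} [AddCommMonoid M] (hQ : IsEdgePartition β Q)
    (f : CopyEdge N m → M) :
    ∑ j, ∑ e ∈ (Q j).toFinset, f e = ∑ i, ∑ l, f (i, (l, β i)) := by
  rw [← sum_filter_orientation, ← Finset.sum_biUnion]
  · refine Finset.sum_congr ?_ fun _ _ => rfl
    ext ⟨i, l, ε⟩
    simp only [Finset.mem_biUnion, Finset.mem_univ, true_and, List.mem_toFinset, Finset.mem_filter]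
    constructor
    · rintro ⟨j, hj⟩
      exact hQ.orientation j _ hj
    · rintro rfl
      exact hQ.cover i l
  · intro j _ j' _ hne
    rw [Function.onFun, Finset.disjoint_left]
    intro e he he'
    exact hQ.disjoint j j' hne (List.mem_toFinset.1 he) (List.mem_toFinset.1 he')

/-- Multiplying the sign of an edge by that of `u` is an involution matching the edges of `τ(u)`
with those of `Q u.1`; the summand ignores signs. -/
theorem sum_toFinset_fineRule {M : Type*} [AddCommMonoid M] (f : Fin N → Fin m → M) (u : OEdge m) :
    ∑ e ∈ (fineRule Q u).toFinset, f e.1 e.2.1 = ∑ e ∈ (Q u.1).toFinset, f e.1 e.2.1 := by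
  refine Finset.sum_nbij' (fun e => (e.1, (e.2.1, e.2.2 * u.2)))
    (fun e => (e.1, (e.2.1, e.2.2 * u.2))) ?_ ?_ ?_ ?_ fun _ _ => rfl
  · intro e he
    exact List.mem_toFinset.2 (mem_fineRule.1 (List.mem_toFinset.1 he))
  · intro e he
    refine List.mem_toFinset.2 (mem_fineRule.2 ?_)
    simpa [mul_assoc] using List.mem_toFinset.1 he
  · intro e _
    simp [mul_assoc]
  · intro e _
    simp [mul_assoc]

namespace IsSubstitutionFamily

theorem eq_iUnion (hE : IsSubstitutionFamily S Q E) (u : OEdge m) :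
    E u = ⋃ e : (fineRule Q u).toFinset, S e.1.1 '' E e.1.2 := by
  ext x
  rw [hE.mem_iff]
  simp only [mem_iUnion, Subtype.exists, List.mem_toFinset, exists_prop]
  rfl

variable [NeZero m] [MeasurableSpace X] [BorelSpace X]

/-- The Hausdorff measures of the invariant sets satisfy the equations of the substitution. -/
theorem hausdorffMeasure_eq (hr0 : ∀ i, 0 < r i) (hr1 : ∀ i, r i < 1)
    (hr : ∀ i x y, dist (S i x) (S i y) = r i * dist x y) (hs : 0 ≤ s)
    (hsum : ∑ i, r i ^ s = 1) (hE : IsSubstitutionFamily S Q E) (hK : IsInvariantSet S K)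
    (hKfin : μH[s] K < ∞) (hQ : IsEdgePartition β Q) (u : OEdge m) :
    μH[s] (E u) = ∑ e ∈ (fineRule Q u).toFinset, ENNReal.ofReal (r e.1 ^ s) * μH[s] (E e.2) := by
  have hpos := hE.eq_pos hr0 hr1 hr
  set f : Fin N → Fin m → ℝ≥0∞ := fun i l => ENNReal.ofReal (r i ^ s) * μH[s] (E (l, 1)) with hf
  set h : Fin m → ℝ≥0∞ := fun j => μH[s] (E (j, 1)) with hh
  have hfin : ∀ j, h j ≠ ∞ := fun j => (lt_of_le_of_lt (measure_mono (by
    rw [hE.iUnion_eq hr0 hr1 hr hK hQ]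
    exact subset_iUnion (fun j : Fin m => E (j, 1)) j)) hKfin).ne
  have hle : ∀ j, h j ≤ ∑ e ∈ (Q j).toFinset, f e.1 e.2.1 := by
    intro j
    rw [← sum_toFinset_fineRule f (j, 1), hh]
    simp only
    rw [hE.eq_iUnion (j, 1)]
    refine (measure_iUnion_fintype_le _ _).trans ?_
    rw [← Finset.sum_coe_sort (fineRule Q (j, 1)).toFinset fun e => f e.1 e.2.1]
    refine Finset.sum_le_sum fun e _ => ?_
    rw [hausdorffMeasure_image_similitude (hr0 _) hs (hr _), hpos]
  -- Here Moran's equation enters: each `h l` is collected with total weight `∑ r i ^ s = 1`.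
  have htot : ∑ j, ∑ e ∈ (Q j).toFinset, f e.1 e.2.1 = ∑ j, h j := by
    rw [hQ.sum_toFinset fun e => f e.1 e.2.1]
    simp only [hf, ← Finset.mul_sum]
    rw [← Finset.sum_mul, ← ENNReal.ofReal_sum_of_nonneg fun i _ => Real.rpow_nonneg (hr0 i).le s,
      hsum, ENNReal.ofReal_one, one_mul]
  have heq : ∀ j, h j = ∑ e ∈ (Q j).toFinset, f e.1 e.2.1 := by
    intro j
    refine le_antisymm (hle j) ?_
    -- Termwise inequalities with equal finite totals are equalities; the terms other than `j` are
    -- cancelled.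
    have h1 : ∑ e ∈ (Q j).toFinset, f e.1 e.2.1 + ∑ l ∈ Finset.univ.erase j, h l ≤
        h j + ∑ l ∈ Finset.univ.erase j, h l := by
      rw [Finset.add_sum_erase _ _ (Finset.mem_univ j), ← htot,
        ← Finset.add_sum_erase _ _ (Finset.mem_univ j)]
      exact add_le_add_right (Finset.sum_le_sum fun l _ => hle l) _
    exact (ENNReal.add_le_add_iff_right (ENNReal.sum_ne_top.2 fun l _ => hfin l)).1 h1
  calc μH[s] (E u) = h u.1 := by rw [hpos]
    _ = ∑ e ∈ (fineRule Q u).toFinset, f e.1 e.2.1 := by rw [heq, sum_toFinset_fineRule]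
    _ = _ := Finset.sum_congr rfl fun e _ => by rw [hpos e.2]

theorem null_inter_rule (hr0 : ∀ i, 0 < r i) (hr1 : ∀ i, r i < 1)
    (hr : ∀ i x y, dist (S i x) (S i y) = r i * dist x y) (hs : 0 ≤ s)
    (hsum : ∑ i, r i ^ s = 1) (hE : IsSubstitutionFamily S Q E) (hK : IsInvariantSet S K)
    (hKfin : μH[s] K < ∞) (hQ : IsEdgePartition β Q) {u : OEdge m} {e f : CopyEdge N m}
    (he : e ∈ fineRule Q u) (hf : f ∈ fineRule Q u) (hne : e ≠ f) :
    μH[s] (S e.1 '' E e.2 ∩ S f.1 '' E f.2) = 0 := by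
  have hEfin : ∀ u, μH[s] (E u) ≠ ∞ := fun u => (lt_of_le_of_lt (measure_mono (by
    rw [hE.iUnion_eq hr0 hr1 hr hK hQ, hE.eq_pos hr0 hr1 hr u]
    exact subset_iUnion (fun j : Fin m => E (j, 1)) u.1)) hKfin).ne
  refine measure_inter_eq_zero_of_sum_le (ι := (fineRule Q u).toFinset)
    (A := fun e => S e.1.1 '' E e.1.2) (fun e => ?_) (fun e => ?_) ?_
    (i := ⟨e, List.mem_toFinset.2 he⟩) (j := ⟨f, List.mem_toFinset.2 hf⟩)
    (fun h => hne (congrArg Subtype.val h))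
  · exact ((hE.isCompact _).image (continuous_of_dist_eq_mul (hr0 _) (hr _))).measurableSet
  · rw [hausdorffMeasure_image_similitude (hr0 _) hs (hr _)]
    exact ENNReal.mul_ne_top ENNReal.ofReal_ne_top (hEfin _)
  · rw [← hE.eq_iUnion u, hE.hausdorffMeasure_eq hr0 hr1 hr hs hsum hK hKfin hQ u,
      ← Finset.sum_coe_sort (fineRule Q u).toFinset
        fun e => ENNReal.ofReal (r e.1 ^ s) * μH[s] (E e.2)]
    exact (Finset.sum_congr rfl fun e _ =>
      hausdorffMeasure_image_similitude (hr0 _) hs (hr _) _).le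

/-- Two different edges of level `n + 1` either have the same parent, and their overlap is a scaled
overlap within one rule, or lie in the pieces of different parents, whose overlap is null by
induction. -/
theorem null_inter_iter (hr0 : ∀ i, 0 < r i) (hr1 : ∀ i, r i < 1)
    (hr : ∀ i x y, dist (S i x) (S i y) = r i * dist x y) (hs : 0 ≤ s)
    (hsum : ∑ i, r i ^ s = 1) (hE : IsSubstitutionFamily S Q E) (hK : IsInvariantSet S K)
    (hKfin : μH[s] K < ∞) (hQ : IsEdgePartition β Q) {u : OEdge m} {n : ℕ}
    {w w' : List (Fin N) × OEdge m} (hw : w ∈ fineIter Q u n) (hw' : w' ∈ fineIter Q u n)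
    (hne : w ≠ w') : μH[s] (wordMap S w.1 '' E w.2 ∩ wordMap S w'.1 '' E w'.2) = 0 := by
  induction n generalizing w w' with
  | zero =>
    simp only [fineIter, List.mem_singleton] at hw hw'
    exact absurd (hw.trans hw'.symm) hne
  | succ n ih =>
    obtain ⟨v, hv, e, he, rfl⟩ := mem_fineIter_succ.1 hw
    obtain ⟨v', hv', e', he', rfl⟩ := mem_fineIter_succ.1 hw'
    have himg : ∀ (I : List (Fin N)) (e : CopyEdge N m),
        wordMap S (I ++ [e.1]) '' E e.2 = wordMap S I '' (S e.1 '' E e.2) := fun I e => by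
      rw [image_image]
      exact image_congr fun x _ => wordMap_append S I [e.1] x
    have hsub : ∀ v : OEdge m, ∀ e ∈ fineRule Q v, S e.1 '' E e.2 ⊆ E v := by
      rintro v e he _ ⟨y, hy, rfl⟩
      exact (hE.mem_iff _ _).2 ⟨e, he, y, hy, rfl⟩
    simp only [himg]
    by_cases hvv : v = v'
    · subst hvv
      have hee : e ≠ e' := by
        rintro rfl
        exact hne rfl
      rw [← image_inter (injective_of_dist_eq_mul (wordRatio_pos hr0 v.1) (dist_wordMap hr v.1)),
        hausdorffMeasure_image_similitude (wordRatio_pos hr0 v.1) hs (dist_wordMap hr v.1),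
        hE.null_inter_rule hr0 hr1 hr hs hsum hK hKfin hQ he he' hee, mul_zero]
    · exact measure_mono_null (inter_subset_inter (image_mono (hsub _ _ he))
        (image_mono (hsub _ _ he'))) (ih hv hv' hvv)

/-- A pure cell forces the invariant sets of different letters to have null intersection. -/
theorem null_inter_of_hasPureCell (hr0 : ∀ i, 0 < r i) (hr1 : ∀ i, r i < 1)
    (hr : ∀ i x y, dist (S i x) (S i y) = r i * dist x y) (hs : 0 ≤ s)
    (hsum : ∑ i, r i ^ s = 1) (hE : IsSubstitutionFamily S Q E) (hK : IsInvariantSet S K)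
    (hKfin : μH[s] K < ∞) (hQ : IsEdgePartition β Q) (hpure : HasPureCell Q) {j j' : Fin m}
    (hne : j ≠ j') : μH[s] (E (j, 1) ∩ E (j', 1)) = 0 := by
  obtain ⟨I, ε, u, hI⟩ := hpure
  have h := hE.null_inter_iter hr0 hr1 hr hs hsum hK hKfin hQ (hI j) (hI j')
    (fun h => hne (congrArg (fun w => w.2.1) h))
  -- Both pieces carry the same map `wordMap S I`, so their overlap is a similar copy of the overlap
  -- of the two invariant sets.
  rw [← image_inter (injective_of_dist_eq_mul (wordRatio_pos hr0 I) (dist_wordMap hr I)),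
    hausdorffMeasure_image_similitude (wordRatio_pos hr0 I) hs (dist_wordMap hr I),
    hE.eq_pos hr0 hr1 hr (j, ε), hE.eq_pos hr0 hr1 hr (j', ε), mul_eq_zero] at h
  exact h.resolve_left
    (ENNReal.ofReal_pos.2 (Real.rpow_pos_of_pos (wordRatio_pos hr0 I) s)).ne'

/-- Primitivity makes the measures of all invariant sets positive. -/
theorem hausdorffMeasure_pos (hr0 : ∀ i, 0 < r i) (hr1 : ∀ i, r i < 1)
    (hr : ∀ i x y, dist (S i x) (S i y) = r i * dist x y) (hs : 0 ≤ s)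
    (hE : IsSubstitutionFamily S Q E) (hK : IsInvariantSet S K)
    (hKpos : 0 < μH[s] K) (hQ : IsEdgePartition β Q)
    (hprim : IsPrimitivePartition Q) (u : OEdge m) : 0 < μH[s] (E u) := by
  have hpos := hE.eq_pos hr0 hr1 hr
  -- Some letter has positive measure because the sets cover `K`. Primitivity places it in an
  -- iterate of `u.1`, and positivity passes up from edges to rules.
  obtain ⟨l, hl⟩ : ∃ l : Fin m, 0 < μH[s] (E (l, 1)) := by
    by_contra! hcon
    refine hKpos.ne' ?_
    rw [hE.iUnion_eq hr0 hr1 hr hK hQ, measure_iUnion_null_iff]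
    exact fun j => le_zero_iff.1 (hcon j)
  obtain ⟨n, -, hn⟩ := hprim
  obtain ⟨v, hv, hvpos⟩ := coarse_iterate_induction (fun j => 0 < μH[s] (E (j, 1)))
    (fun j e he h => by
      have hsub : S e.1 '' E e.2 ⊆ E (j, 1) := by
        rintro _ ⟨y, hy, rfl⟩
        exact (hE.mem_iff _ _).2 ⟨e, by simpa [mem_fineRule] using he, y, hy, rfl⟩
      refine lt_of_lt_of_le ?_ (measure_mono hsub)
      rw [hausdorffMeasure_image_similitude (hr0 _) hs (hr _), hpos]
      exact ENNReal.mul_pos (ENNReal.ofReal_pos.2 (Real.rpow_pos_of_pos (hr0 _) s)).ne' h.ne')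
    n [u.1] (hn l u.1) hl
  rw [List.mem_singleton] at hv
  rw [hpos, ← hv]
  exact hvpos

end IsSubstitutionFamily

end Measures

/-! ### The open set condition for the induced system -/

/-- The invariant set lies in the closure of every open set that the IFS maps into itself. -/
theorem IsInvariantSet.subset_closure {X : Type} [MetricSpace X] {N : ℕ} {S : Fin N → X → X}
    {r : Fin N → ℝ} (hr0 : ∀ i, 0 < r i) (hr1 : ∀ i, r i < 1)
    (hr : ∀ i x y, dist (S i x) (S i y) = r i * dist x y) {K U : Set X}
    (hK : IsInvariantSet S K) (hU : U.Nonempty) (hSU : ∀ i, S i '' U ⊆ U) : K ⊆ closure U := by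
  obtain ⟨ρ, hρ0, hρ1, hρ⟩ := exists_uniform_ratio hr0 hr1
  obtain ⟨p, hp⟩ := hU
  have key : ∀ n : ℕ, ∀ x ∈ K, ∃ I : List (Fin N), I.length = n ∧ ∃ y ∈ K, wordMap S I y = x := by
    intro n x hx
    obtain ⟨w, hw⟩ := mem_iUnion.1 (hK.subset_iUnion_wordMap n hx)
    exact ⟨_, List.length_ofFn, hw⟩
  have hIU : ∀ I : List (Fin N), wordMap S I p ∈ U := by
    intro I
    induction I with
    | nil => exact hp
    | cons i I ih => exact hSU i ⟨_, ih, rfl⟩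
  obtain ⟨D, hD⟩ := exists_dist_bound (V := Unit) (fun _ => K) (fun _ => {p})
    (fun _ => hK.2.1.isBounded) (fun _ => Bornology.isBounded_singleton)
  intro x hx
  rw [Metric.mem_closure_iff]
  intro ε hε
  have ht : Tendsto (fun n : ℕ => ρ ^ n * D) atTop (𝓝 0) := by
    simpa using (tendsto_pow_atTop_nhds_zero_of_lt_one hρ0.le hρ1).mul_const D
  obtain ⟨n, hn⟩ := (ht.eventually (gt_mem_nhds hε)).exists
  obtain ⟨I, hI, y, hy, rfl⟩ := key n x hx
  refine ⟨_, hIU I, lt_of_le_of_lt ?_ hn⟩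
  rw [dist_wordMap hr, ← hI]
  exact mul_le_mul (wordRatio_le_pow hr0 hρ I) (hD () y hy p rfl) dist_nonneg
    (pow_nonneg hρ0.le _)

/-- A similitude of a Euclidean space is an open map. -/
theorem isOpenMap_similitude {d : ℕ} {f : EuclideanSpace ℝ (Fin d) → EuclideanSpace ℝ (Fin d)}
    {c : ℝ} (hc : 0 < c) (hf : ∀ x y, dist (f x) (f y) = c * dist x y) : IsOpenMap f := by
  -- After dividing by the ratio, an isometry of a strictly convex space into itself is affine, and
  -- equality of finite dimensions makes it a homeomorphism.
  have hg : Isometry fun x => c⁻¹ • f x := Isometry.of_dist_eq fun x y => by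
    rw [dist_smul₀, hf, Real.norm_of_nonneg (inv_nonneg.2 hc.le), inv_mul_cancel_left₀ hc.ne']
  have hgo : IsOpenMap fun x => c⁻¹ • f x :=
    (hg.affineIsometryOfStrictConvexSpace.toAffineIsometryEquiv rfl).toHomeomorph.isOpenMap
  have : f = fun x => c • (c⁻¹ • f x) := by
    ext1 x
    rw [smul_inv_smul₀ hc.ne']
  rw [this]
  exact (isOpenMap_smul₀ hc.ne').comp hgo

/-- The separating points `x j` supply seed sets `O j`, and the open set of a state collects the
images of the seeds along all iterates of the substitution. Seeds inside `U` separate words with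
different first letters, while the distance between the `x j` and the other invariant sets handles
exhausted words. -/
theorem inducedGIFS_openSetCondition {d N m : ℕ} [NeZero m]
    {S : Fin N → EuclideanSpace ℝ (Fin d) → EuclideanSpace ℝ (Fin d)} {r : Fin N → ℝ}
    (hS : ∀ i, IsContractingSimilitude (S i)) (hr0 : ∀ i, 0 < r i) (hr1 : ∀ i, r i < 1)
    (hr : ∀ i x y, dist (S i x) (S i y) = r i * dist x y) (hOSC : IFSOpenSetCondition S)
    {K : Set (EuclideanSpace ℝ (Fin d))} (hK : IsInvariantSet S K)
    {Q : Fin m → List (CopyEdge N m)} {β : Fin N → ℤˣ} (hQ : IsEdgePartition β Q)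
    {E : OEdge m → Set (EuclideanSpace ℝ (Fin d))} (hE : IsSubstitutionFamily S Q E)
    (hsep : ∀ j, (E (j, 1) \ ⋃ l ∈ {l | l ≠ j}, E (l, 1)).Nonempty) :
    (inducedGIFS S hS Q).OpenSetCondition := by
  obtain ⟨U, hUo, hUn, hSU, hUd⟩ := hOSC
  have hpos := hE.eq_pos hr0 hr1 hr
  have hinj : ∀ i, Function.Injective (S i) := fun i => injective_of_dist_eq_mul (hr0 i) (hr i)
  choose x hx using hsep
  have hδ : ∀ j, ∃ δ > 0, ∀ l ≠ j, ∀ y ∈ E (l, 1), δ ≤ dist (x j) y := by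
    intro j
    have hclosed : IsClosed (⋃ l ∈ {l | l ≠ j}, E (l, 1)) :=
      (Set.toFinite _).isClosed_biUnion fun l _ => (hE.isCompact _).isClosed
    obtain ⟨δ, hδ, hball⟩ := Metric.isOpen_iff.1 hclosed.isOpen_compl (x j) (hx j).2
    refine ⟨δ, hδ, fun l hl y hy => ?_⟩
    by_contra! hlt
    exact hball (Metric.mem_ball'.2 hlt) (mem_biUnion hl hy)
  choose δ hδ0 hδ using hδ
  obtain ⟨η, hη0, hη⟩ := exists_pos_le hδ0
  -- In `hfar` a seed point and the image of another seed point are each within `ρ` of their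
  -- centres, while these centres are at least `η` apart.
  set ρ := η / 2 with hρ
  have hρ0 : 0 < ρ := by positivity
  let O : Fin m → Set (EuclideanSpace ℝ (Fin d)) := fun j => U ∩ Metric.ball (x j) ρ
  have hOo : ∀ j, IsOpen (O j) := fun j => hUo.inter Metric.isOpen_ball
  have hOn : ∀ j, (O j).Nonempty := by
    intro j
    have hxK : x j ∈ K := by
      rw [hE.iUnion_eq hr0 hr1 hr hK hQ]
      exact mem_iUnion.2 ⟨j, (hx j).1⟩
    obtain ⟨y, hy, hxy⟩ := Metric.mem_closure_iff.1
      (hK.subset_closure hr0 hr1 hr hUn hSU hxK) ρ hρ0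
    exact ⟨y, hy, Metric.mem_ball'.2 hxy⟩
  have hIU : ∀ I : List (Fin N), ∀ y ∈ U, wordMap S I y ∈ U := by
    intro I y hy
    induction I with
    | nil => exact hy
    | cons i I ih => exact hSU i ⟨_, ih, rfl⟩
  have hfar : ∀ (j : Fin m) (v : OEdge m) (n : ℕ), ∀ w ∈ fineIter Q v n, j ≠ v.1 →
      ∀ z ∈ O j, ∀ y ∈ O w.2.1, wordMap S w.1 y ≠ z := by
    intro j v n w hw hne z hz y hy h
    have hmem : wordMap S w.1 (x w.2.1) ∈ E (v.1, 1) := by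
      rw [← hpos]
      refine hE.wordMap_mem hw ?_
      rw [hpos]
      exact (hx _).1
    have h1 := hδ j _ hne.symm _ hmem
    have h2 : dist (wordMap S w.1 y) (wordMap S w.1 (x w.2.1)) < ρ := by
      rw [dist_wordMap hr]
      refine lt_of_le_of_lt ?_ (Metric.mem_ball.1 hy.2)
      exact mul_le_of_le_one_left dist_nonneg (wordRatio_le_one hr0 hr1 _)
    have h3 : dist (x j) z < ρ := Metric.mem_ball'.1 hz.2
    have h4 := dist_triangle (x j) z (wordMap S w.1 (x w.2.1))
    rw [h] at h2
    have := hη j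
    linarith
  -- Peel off first letters: different ones are separated by `U`, and equal ones leave edges that
  -- still differ beyond orientation because the paths are disjoint. Once a word is exhausted,
  -- `hfar` applies.
  have hdisj : ∀ (n n' : ℕ) (v v' : OEdge m), ∀ w ∈ fineIter Q v n, ∀ w' ∈ fineIter Q v' n',
      v.1 ≠ v'.1 → ∀ y ∈ O w.2.1, ∀ y' ∈ O w'.2.1, wordMap S w.1 y ≠ wordMap S w'.1 y' := by
    intro n
    induction n with
    | zero =>
      intro n' v v' w hw w' hw' hne y hy y' hy' h
      obtain rfl : w = ([], v) := by simpa [fineIter] using hw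
      exact hfar v.1 v' n' w' hw' hne y hy y' hy' h.symm
    | succ n ih =>
      intro n' v v' w hw w' hw' hne y hy y' hy' h
      cases n' with
      | zero =>
        obtain rfl : w' = ([], v') := by simpa [fineIter] using hw'
        exact hfar v'.1 v (n + 1) w hw hne.symm y' hy' y hy h
      | succ n' =>
        obtain ⟨⟨i, e⟩, he, w, hwe, rfl⟩ := mem_fineIter_succ'.1 hw
        obtain ⟨⟨i', e'⟩, he', w', hwe', rfl⟩ := mem_fineIter_succ'.1 hw'
        by_cases hii : i = i'
        · subst hii
          exact ih n' e e' w hwe w' hwe' (hQ.fst_ne hne he he') y hy y' hy' (hinj i h)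
        · exact Set.disjoint_left.1 (hUd i i' hii) ⟨_, hIU w.1 y hy.1, rfl⟩
            ⟨_, hIU w'.1 y' hy'.1, h.symm⟩
  let G : OEdge m → Set (EuclideanSpace ℝ (Fin d)) := fun u =>
    ⋃ n, ⋃ w ∈ {w | w ∈ fineIter Q u n}, wordMap S w.1 '' O w.2.1
  have hG : ∀ u z, z ∈ G u ↔ ∃ n, ∃ w ∈ fineIter Q u n, ∃ y ∈ O w.2.1, wordMap S w.1 y = z := by
    intro u z
    simp only [G, mem_iUnion]
    constructor
    · rintro ⟨n, w, hw, y, hy, rfl⟩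
      exact ⟨n, w, hw, y, hy, rfl⟩
    · rintro ⟨n, w, hw, y, hy, rfl⟩
      exact ⟨n, w, hw, y, hy, rfl⟩
  refine ⟨G, fun u => ⟨?_, ?_⟩, ?_, ?_⟩
  · exact isOpen_iUnion fun n => isOpen_biUnion fun w _ =>
      isOpenMap_similitude (wordRatio_pos hr0 w.1) (dist_wordMap hr w.1) _ (hOo _)
  · obtain ⟨y, hy⟩ := hOn u.1
    exact ⟨y, (hG u y).2 ⟨0, ([], u), by simp [fineIter], y, hy, rfl⟩⟩
  · rintro ⟨u, k⟩ _ ⟨z, hz, rfl⟩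
    obtain ⟨n, w, hw, y, hy, rfl⟩ := (hG _ _).1 hz
    exact (hG _ _).2 ⟨n + 1, (_ :: w.1, w.2), mem_fineIter_succ'.2
      ⟨_, List.get_mem (fineRule Q u) k, w, hw, rfl⟩, y, hy, rfl⟩
  · rintro ⟨u, k⟩ ⟨v, l⟩ hne huv
    obtain rfl : u = v := huv
    have hkl : k ≠ l := fun h => hne (by rw [h])
    have hee : (fineRule Q u).get k ≠ (fineRule Q u).get l := fun h =>
      hkl ((nodup_fineRule hQ.nodup u).injective_get h)
    rw [Set.disjoint_left]
    rintro _ ⟨z, hz, rfl⟩ ⟨z', hz', h⟩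
    obtain ⟨n, w, hw, y, hy, rfl⟩ := (hG _ _).1 hz
    obtain ⟨n', w', hw', y', hy', rfl⟩ := (hG _ _).1 hz'
    have he := List.get_mem (fineRule Q u) k
    have he' := List.get_mem (fineRule Q u) l
    change S ((fineRule Q u).get l).1 _ = S ((fineRule Q u).get k).1 _ at h
    change w ∈ fineIter Q ((fineRule Q u).get k).2 n at hw
    change w' ∈ fineIter Q ((fineRule Q u).get l).2 n' at hw'
    generalize (fineRule Q u).get k = e at *
    generalize (fineRule Q u).get l = e' at *
    obtain ⟨i, e⟩ := e
    obtain ⟨i', e'⟩ := e'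
    by_cases hii : i = i'
    · subst hii
      exact hdisj n n' e e' w hw w' hw'
        (hQ.fst_ne_of_ne he he' fun h => hee (by rw [h])) y hy y' hy' (hinj i h.symm)
    · exact Set.disjoint_left.1 (hUd i i' hii) ⟨_, hIU w.1 y hy.1, rfl⟩
        ⟨_, hIU w'.1 y' hy'.1, h⟩

/-! ### Optimal parameterizations from ordered rules -/

theorem List.sum_map_eq_sum_range_getD {α M : Type*} [AddCommMonoid M] (g : α → M) (l : List α)
    (d : α) : (l.map g).sum = ∑ k ∈ Finset.range l.length, g (l.getD k d) := by
  induction l with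
  | nil => simp
  | cons a l ih =>
    rw [List.map_cons, List.sum_cons, ih, List.length_cons, Finset.sum_range_succ', add_comm]
    simp

/-- If compact sets `E w` are the unions of pieces `S_i(E v)`, ordered by lists `rule w` along
chains of points, and their Hausdorff measures are positive, finite and additive along the rules,
then each `E w` has an optimal parameterization. -/
theorem exists_isOptimalParameterization_of_rules {X : Type} [MetricSpace X] [CompleteSpace X]
    [MeasurableSpace X] [BorelSpace X] {N : ℕ} {W : Type} [Finite W] {S : Fin N → X → X}
    {r : Fin N → ℝ} (hr0 : ∀ i, 0 < r i) (hr1 : ∀ i, r i < 1)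
    (hr : ∀ i x y, dist (S i x) (S i y) = r i * dist x y) {s : ℝ≥0} (hs : 0 < s)
    (rule : W → List (Fin N × W)) (E : W → Set X) (hEc : ∀ w, IsCompact (E w))
    (hE : ∀ w x, x ∈ E w ↔ ∃ e ∈ rule w, ∃ y ∈ E e.2, S e.1 y = x) (src tgt : W → X)
    (hwalk : ∀ w, IsWalk (fun e : Fin N × W => S e.1 (src e.2)) (fun e => S e.1 (tgt e.2))
      (src w) (rule w) (tgt w))
    (hpos : ∀ w, 0 < μH[(s : ℝ)] (E w)) (hfin : ∀ w, μH[(s : ℝ)] (E w) < ∞)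
    (hsum : ∀ w, μH[(s : ℝ)] (E w) =
      ((rule w).map fun e => ENNReal.ofReal (r e.1 ^ (s : ℝ)) * μH[(s : ℝ)] (E e.2)).sum) (w : W) :
    ∃ φ : ℝ → X, IsOptimalParameterization s (E w) φ := by
  have hne : ∀ w, rule w ≠ [] := fun w h => (hpos w).ne' (by rw [hsum, h]; rfl)
  have hlen : ∀ w, 0 < (rule w).length := fun w => List.length_pos_iff.2 (hne w)
  -- Beyond the end of the list the head is repeated as a dummy value; only indices below the length
  -- carry meaning.
  let ch : W → ℕ → Fin N × W := fun w k => (rule w).getD k ((rule w).head (hne w))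
  have hch : ∀ w k (h : k < (rule w).length), ch w k = (rule w)[k] := fun w k h =>
    List.getD_eq_getElem _ _ h
  have : Nonempty X := by
    have : (E w).Nonempty := nonempty_iff_ne_empty.2 fun h => (hpos w).ne' (by rw [h, measure_empty])
    exact ⟨this.some⟩
  let G : OrderedSubdivision X N W :=
    { map := S
      ratio := r
      ratio_pos := hr0
      ratio_lt_one := hr1
      dist_map := hr
      s := s
      s_pos := NNReal.coe_pos.2 hs
      cnt := fun w => (rule w).length
      lab := fun w k => (ch w k).1
      nxt := fun w k => (ch w k).2
      len := fun w => (μH[(s : ℝ)] (E w)).toReal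
      len_pos := fun w => ENNReal.toReal_pos (hpos w).ne' (hfin w).ne
      len_eq := fun w => by
        rw [hsum, List.sum_map_eq_sum_range_getD _ _ ((rule w).head (hne w)),
          ENNReal.toReal_sum fun k _ => ENNReal.mul_ne_top ENNReal.ofReal_ne_top (hfin _).ne]
        refine Finset.sum_congr rfl fun k _ => ?_
        rw [ENNReal.toReal_mul, ENNReal.toReal_ofReal (Real.rpow_nonneg (hr0 _).le _)]
      src := src
      tgt := tgt
      src_eq := fun w => by
        rw [hch w 0 (hlen w)]
        exact ((hwalk w).src_head (hlen w)).symm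
      tgt_eq := fun w => by
        rw [hch w _ (Nat.sub_lt (hlen w) one_pos)]
        exact ((hwalk w).tgt_last (Nat.sub_add_cancel (hlen w))).symm
      link := fun w k h => by
        rw [hch w k (Nat.lt_of_succ_lt h), hch w (k + 1) h]
        exact (hwalk w).link h }
  obtain ⟨φ, hφ⟩ := G.exists_isCurve
  set T := OrderedSubdivision.IsCurve.trace G φ with hT
  have hTmem : ∀ w x, x ∈ T w ↔ ∃ e ∈ rule w, ∃ y ∈ T e.2, S e.1 y = x := by
    intro w x
    rw [hT, OrderedSubdivision.IsCurve.trace, hφ.image_eq w, mem_iUnion]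
    constructor
    · rintro ⟨k, y, hy, rfl⟩
      have h := hch w k k.2
      exact ⟨ch w k, h ▸ List.getElem_mem k.2, y, hy, rfl⟩
    · rintro ⟨e, he, y, hy, rfl⟩
      obtain ⟨k, hk, rfl⟩ := List.mem_iff_getElem.1 he
      rw [← hch w k hk] at hy ⊢
      exact ⟨⟨k, hk⟩, y, hy, rfl⟩
  have hTc : ∀ w, IsCompact (T w) := hφ.isCompact_image
  have hTn : ∀ w, (T w).Nonempty := fun w =>
    ⟨_, 0, left_mem_Icc.2 (G.len_pos w).le, rfl⟩
  have hEn : ∀ w, (E w).Nonempty := fun w =>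
    nonempty_iff_ne_empty.2 fun h => (hpos w).ne' (by rw [h, measure_empty])
  obtain ⟨ρ, hρ0, hρ1, hρ⟩ := exists_uniform_ratio hr0 hr1
  have hcontr : ∀ i x y, dist (S i x) (S i y) ≤ ρ * dist x y := fun i x y =>
    (hr i x y).le.trans (mul_le_mul_of_nonneg_right (hρ i) dist_nonneg)
  have hsubset : ∀ A B : W → Set X, (∀ w, IsCompact (A w)) → (∀ w, IsCompact (B w)) →
      (∀ w, (B w).Nonempty) → (∀ w x, x ∈ A w ↔ ∃ e ∈ rule w, ∃ y ∈ A e.2, S e.1 y = x) →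
      (∀ w x, x ∈ B w ↔ ∃ e ∈ rule w, ∃ y ∈ B e.2, S e.1 y = x) → ∀ w, A w ⊆ B w := by
    intro A B hA hB hBn hAm hBm w
    obtain ⟨D, hD⟩ := exists_dist_bound A B (fun w => (hA w).isBounded) fun w => (hB w).isBounded
    refine subset_of_contracting_families S hρ0.le hρ1 hcontr A B (fun u x hx => ?_)
      (fun u => (hB u).isClosed) hBn hD w
    obtain ⟨e, he, y, hy, rfl⟩ := (hAm u x).1 hx
    exact ⟨e.1, e.2, y, hy, rfl, fun z hz => (hBm u _).2 ⟨e, he, z, hz, rfl⟩⟩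
  -- The traces and the given sets solve the same set equations. Hence the lengths, defined as
  -- measures of `E`, are the measures of the traces.
  have hTE : ∀ w, T w = E w := fun w => Subset.antisymm
    (hsubset T E hTc hEc hEn hTmem hE w) (hsubset E T hEc hTc hTn hE hTmem w)
  rw [← hTE w]
  refine ⟨_, hφ.isOptimalParameterization (fun w => ?_) rfl w⟩
  change μH[(s : ℝ)] (T w) = ENNReal.ofReal (μH[(s : ℝ)] (E w)).toReal
  rw [hTE, ENNReal.ofReal_toReal (hfin w).ne]

/-! ### Assembly of the theorem -/

theorem theorem1p3 {d N m : ℕ} [NeZero m] (hN : 2 ≤ N)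
    (S : Fin N → EuclideanSpace ℝ (Fin d) → EuclideanSpace ℝ (Fin d))
    (hS : ∀ i, IsContractingSimilitude (S i)) (hOSC : IFSOpenSetCondition S)
    (K : Set (EuclideanSpace ℝ (Fin d))) (hK : IsInvariantSet S K)
    (s : ℝ≥0) (hs : dimH K = (s : ℝ≥0∞))
    (a : Fin m → EuclideanSpace ℝ (Fin d)) (ha : Function.Injective a)
    (hA : IsSkeleton S K (Set.range a))
    (β : Fin N → ℤˣ)
    (P : List (CopyEdge N m)) (hP : IsUnicursal S a β P)
    (Q : Fin m → List (CopyEdge N m)) (hQ : IsPathPartition P Q)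
    (hcons : IsConsistent S a Q) (hprim : IsPrimitivePartition Q) (hpure : HasPureCell Q) :
    -- (i) the induced GIFS is a linear GIFS satisfying the open set condition
    ((inducedGIFS S hS Q).IsLinear ∧ (inducedGIFS S hS Q).OpenSetCondition) ∧
    -- (ii) its invariant sets exist, are unique, cover `K`, and have null overlaps
    (∃! E, (inducedGIFS S hS Q).IsInvariantFamily E) ∧
    (∀ E, (inducedGIFS S hS Q).IsInvariantFamily E →
      K = ⋃ j : Fin m, E (j, 1) ∧
      ∀ i j : Fin m, i ≠ j → μH[(s : ℝ)] (E (i, 1) ∩ E (j, 1)) = 0) ∧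
    -- (iii) `K` admits optimal parameterizations
    ∃ φ : ℝ → EuclideanSpace ℝ (Fin d), IsOptimalParameterization s K φ := by
  choose r hr0 hr1 hr using id hS
  obtain ⟨hs0, hsum, hKpos, hKfin⟩ := moran hN hr0 hr1 hr hOSC hK hs
  have hs' : (0 : ℝ) ≤ s := s.2
  have hEQ := hP.isEdgePartition hQ
  have hne := hprim.ne_nil
  obtain ⟨E, hE⟩ := exists_isSubstitutionFamily (S := S) hr0 hr1 hr hne
  have hcover := hE.iUnion_eq hr0 hr1 hr hK hEQ
  have hpos := hE.hausdorffMeasure_pos hr0 hr1 hr hs' hK hKpos hEQ hprim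
  have hnull : ∀ i j : Fin m, i ≠ j → μH[(s : ℝ)] (E (i, 1) ∩ E (j, 1)) = 0 := fun i j hij =>
    hE.null_inter_of_hasPureCell hr0 hr1 hr hs' hsum hK hKfin hEQ hpure hij
  have hfin : ∀ u, μH[(s : ℝ)] (E u) < ∞ := fun u => lt_of_le_of_lt (measure_mono (by
    rw [hcover, hE.eq_pos hr0 hr1 hr u]
    exact subset_iUnion (fun j : Fin m => E (j, 1)) u.1)) hKfin
  refine ⟨⟨inducedGIFS_isLinear hS hr0 hr1 hr hcons hne,
    inducedGIFS_openSetCondition hS hr0 hr1 hr hOSC hK hEQ hE fun j => ?_⟩,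
    ⟨E, (isInvariantFamily_iff hS E).2 hE, fun F hF =>
      ((isInvariantFamily_iff hS F).1 hF).unique hr0 hr1 hr hE⟩, fun F hF => ?_, ?_⟩
  · have hz : μH[(s : ℝ)] (E (j, 1) ∩ ⋃ l ∈ {l | l ≠ j}, E (l, 1)) = 0 := by
      rw [inter_iUnion₂, measure_biUnion_null_iff (Set.to_countable _)]
      exact fun l hl => hnull j l (Ne.symm hl)
    refine nonempty_iff_ne_empty.2 fun h => (hpos (j, 1)).ne' ?_
    rw [sdiff_eq_empty] at h
    rwa [inter_eq_left.2 h] at hz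
  · obtain rfl := ((isInvariantFamily_iff hS F).1 hF).unique hr0 hr1 hr hE
    exact ⟨hcover, hnull⟩
  · obtain ⟨x, y, hxy⟩ := hP.1
    -- The extra state `none` stands for `K` itself, subdivided along the whole path `P`; all its
    -- children are edges governed by the fine substitution.
    let rule : Option (OEdge m) → List (Fin N × Option (OEdge m)) := fun w =>
      (w.elim P (fineRule Q)).map fun e => (e.1, some e.2)
    let F : Option (OEdge m) → Set (EuclideanSpace ℝ (Fin d)) := fun w => w.elim K E
    -- `P` lists all oriented copies, so the sum factors as `∑ r i ^ s` times the sum of the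
    -- measures of the `E (j, 1)`, which is `μH[s] K` since the overlaps are null.
    have hPsum : μH[(s : ℝ)] K =
        ∑ e ∈ P.toFinset, ENNReal.ofReal (r e.1 ^ (s : ℝ)) * μH[(s : ℝ)] (E e.2) := by
      have h1 : P.toFinset = Finset.univ.filter fun e : CopyEdge N m => e.2.2 = β e.1 := by
        ext e
        rw [List.mem_toFinset, hP.2.2, Finset.mem_filter]
        exact ⟨fun h => ⟨Finset.mem_univ _, h⟩, fun h => h.2⟩
      rw [h1, sum_filter_orientation β fun e =>
        ENNReal.ofReal (r e.1 ^ (s : ℝ)) * μH[(s : ℝ)] (E e.2)]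
      simp only [hE.eq_pos hr0 hr1 hr (_, β _), ← Finset.mul_sum]
      rw [← Finset.sum_mul, ← ENNReal.ofReal_sum_of_nonneg fun i _ =>
        Real.rpow_nonneg (hr0 i).le _, hsum, ENNReal.ofReal_one, one_mul]
      conv_lhs => rw [hcover]
      rw [measure_iUnion₀ (fun i j hij => hnull i j hij)
        fun j => (hE.isCompact _).measurableSet.nullMeasurableSet, tsum_fintype]
    refine exists_isOptimalParameterization_of_rules hr0 hr1 hr hs0 rule F ?_ ?_
      (fun w => w.elim x (OEdge.src a)) (fun w => w.elim y (OEdge.tgt a)) ?_ ?_ ?_ ?_ none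
    · rintro (_ | v)
      · exact hK.2.1
      · exact hE.isCompact v
    · rintro (_ | v) z
      · change z ∈ K ↔ _
        rw [hK.2.2]
        simp only [rule, F, mem_iUnion, Option.elim_none, List.mem_map]
        constructor
        · rintro ⟨i, p, hp, rfl⟩
          rw [hcover] at hp
          obtain ⟨l, hl⟩ := mem_iUnion.1 hp
          refine ⟨_, ⟨(i, (l, β i)), (hP.2.2 _).2 rfl, rfl⟩, p, ?_, rfl⟩
          exact (hE.eq_pos hr0 hr1 hr (l, β i)).ge hl
        · rintro ⟨_, ⟨e, -, rfl⟩, p, hp, rfl⟩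
          refine ⟨e.1, p, ?_, rfl⟩
          rw [hcover]
          exact mem_iUnion.2 ⟨e.2.1, (hE.eq_pos hr0 hr1 hr e.2).le hp⟩
      · change z ∈ E v ↔ _
        rw [hE.mem_iff]
        simp [rule, F]
    · rintro (_ | v)
      · exact hxy.map (fun e : CopyEdge N m => (e.1, some e.2)) (fun _ => rfl) fun _ => rfl
      · exact (isWalk_fineRule hcons v).map (fun e : CopyEdge N m => (e.1, some e.2))
          (fun _ => rfl) fun _ => rfl
    · rintro (_ | v)
      · exact hKpos
      · exact hpos v
    · rintro (_ | v)
      · exact hKfin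
      · exact hfin v
    · have hlist : ∀ l : List (CopyEdge N m), l.Nodup →
          ((l.map fun e => (e.1, some e.2)).map fun e : Fin N × Option (OEdge m) =>
            ENNReal.ofReal (r e.1 ^ (s : ℝ)) * μH[(s : ℝ)] (F e.2)).sum =
          ∑ e ∈ l.toFinset, ENNReal.ofReal (r e.1 ^ (s : ℝ)) * μH[(s : ℝ)] (E e.2) := by
        intro l hl
        rw [List.map_map, List.sum_toFinset _ hl]
        rfl
      rintro (_ | v)
      · exact hPsum.trans (hlist P hP.2.1).symm
      · exact (hE.hausdorffMeasure_eq hr0 hr1 hr hs' hsum hK hKfin hEQ v).trans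
          (hlist _ (nodup_fineRule hEQ.nodup v)).symm
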